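/- Let $L>0$ and $0<r<1$. Let $a_0,a_1,a_2,\dots$ be i.i.d. standard complex Gaussian random variables (density $\frac1\pi e^{-|z|^2}$ on $\mathbb C$), and let $$\mathbf f_L(z)=\sum_{n=0}^\infty \Big(\frac{L(L+1)\cdots(L+n-1)}{n!}\Big)^{1/2}a_n z^n ,$$ the hyperbolic Gaussian analytic function, which almost surely is analytic in the unit disk. Let $n(r)$ be the number of zeros of $\mathbf f_L$, counted with multiplicity, in the disk $\{|z|<r\}$. Then there are constants $\beta,C_1,C_2,C_3>0$ and $K\in\mathbb R$, depending only on $L$ and $r$, such that for every $m\ge 1$ $$C_1\,e^{-m^2|\log r|-K m\log m}\;\le\;\mathbf P[n(r)\ge m]\;\le\; C_2\,e^{-\beta m^2}.$$ In particular, if $e^{-1}<r<1$, then also (with $C_1$ chosen suitably) $$C_1\,e^{-m^2/|\log r|}\le \mathbf P[n(r)\ge m]\qquad\text{for every } m\ge 1.$$ Moreover, for $L=1$ and every $m\ge1$, $$r^{m(m+1)}\;\le\;\mathbf P[n(r)\ge m]\;\le\; r^{m(m+1)}\big(1+C_3\,e^{m\log m}\big).$$ -/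

import Mathlib

open MeasureTheory ProbabilityTheory
open scoped ENNReal

/-- The law of a standard complex Gaussian: density `π⁻¹ exp (-|z|²)` with respect to Lebesgue
measure on `ℂ`. -/
noncomputable def stdComplexGaussian : Measure ℂ :=
  (volume : Measure ℂ).withDensity
    (fun z : ℂ => ENNReal.ofReal (Real.pi⁻¹ * Real.exp (-‖z‖ ^ 2)))

/-- `a 0, a 1, a 2, …` are independent standard complex Gaussian random variables. -/
structure IsIIDStdComplexGaussian {Ω : Type*} [MeasurableSpace Ω] (P : Measure Ω)
    (a : ℕ → Ω → ℂ) : Prop where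
  hasLaw : ∀ n, HasLaw (a n) stdComplexGaussian P
  indep : iIndepFun a P

/-- The coefficient `binom(-L, n)^{1/2} = √(L (L+1) ⋯ (L+n-1) / n!)`
(the sign of the binomial coefficient is dropped, as usual in this setting). -/
noncomputable def hyperbolicCoeff (L : ℝ) (n : ℕ) : ℝ :=
  Real.sqrt ((∏ k ∈ Finset.range n, (L + k)) / (Nat.factorial n : ℝ))

/-- The power series `∑ₙ binom(-L, n)^{1/2} aₙ zⁿ` with given coefficients `aₙ`.
For independent standard complex Gaussian `aₙ` this is the hyperbolic Gaussian analytic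
function; it almost surely converges on the unit disk. -/
noncomputable def hyperbolicGAF (L : ℝ) (a : ℕ → ℂ) (z : ℂ) : ℂ :=
  ∑' n : ℕ, (hyperbolicCoeff L n : ℂ) * a n * z ^ n

/-- The number of zeros, with multiplicity, of `f` in the open disk of radius `r` around `0`:
the sum of the orders of vanishing over the points of the disk (as a supremum of finite
subsums, possibly infinite; points that are not zeros have order `0`). -/
noncomputable def zeroCount (f : ℂ → ℂ) (r : ℝ) : ℕ∞ :=
  ⨆ (s : Finset ℂ) (_ : (s : Set ℂ) ⊆ Metric.ball 0 r), ∑ z ∈ s, analyticOrderAt f z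

/-- The probability `P[n(r) ≥ m]` for the hyperbolic Gaussian analytic function with parameter
`L` and random coefficients `a`. -/
noncomputable def overcrowdingProb {Ω : Type*} [MeasurableSpace Ω] (P : Measure Ω)
    (a : ℕ → Ω → ℂ) (L r : ℝ) (m : ℕ) : ℝ :=
  P.real {ω | (m : ℕ∞) ≤ zeroCount (hyperbolicGAF L (fun n => a n ω)) r}

/-! For the lower bound with general `L`, an explicit box of coefficients forces exactly `m` zeros.
If `aₙ` is of size about `r ^ (m - n)`, up to a power of `m`, for `n < m`, if `a_m` exceeds a
constant, and if the later coefficients grow at most linearly, then the `m`-th term dominates all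
the others on `|z| = r`. Rouché's theorem then gives `m` zeros
(`zeroCount_powerSeries_of_dominant`). The small coefficients cost `∏ r ^ (2 * (m - n)) = r ^ (m *
(m + 1))`, up to a factor `exp (-O(m log m))` for `m ≥ 2` (`exists_overcrowding_lower`). Where `|log
r| < 1`, the strict gap `1 / |log r| > |log r|` absorbs the `m log m` term, which gives the bound
with `1 / |log r|`.

For the upper bound with general `L`, dividing out `m` zeros by Blaschke factors shows that `f` is
at most its maximum on a larger circle times `κ ^ m` with `κ < 1` (`norm_le_of_le_zeroCount`). By
Cauchy's estimate either some coefficient is exponentially large in `m`, which has doubly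
exponentially small probability, or a positive fraction of the first `m` coefficients are
exponentially small, which has probability `exp (-c * m ^ 2)` by independence
(`exists_overcrowding_upper`).

For `L = 1` the power series with Gaussian coefficients is realised as a limit of random polynomials
with an explicit root count. Choose a monic polynomial of degree `N` uniformly, in coefficient
space, among those with all roots in the unit disk. The Szegő recursion parametrises these
polynomials by Verblunsky coefficients, and its Jacobian makes those coefficients independent with
densities proportional to `(1 - |α|²) ^ k` (`map_szegoStep`). They can therefore be obtained from
independent Gaussians by radial maps (`map_verblunskyMap`). With this coupling, `√N` times the ratio
of the polynomial to its reversal converges locally uniformly to `∑ xₙ zⁿ`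
(`tendstoUniformlyOn_schurIterate`). The reversal does not vanish in the disk, so the ratio has the
zeros of the polynomial there.

In terms of the roots, the uniform law has density proportional to `|Vandermonde|²` on the disk
(`stableLaw_apply`). Orthogonality of monomials turns the generating function of the root count into
`∏ (1 - p_k + p_k x)` with `p_k = r ^ (2 * (k + 1))` (`integral_norm_det_vandermonde_sq_mul_prod`):
the count is distributed as a sum of independent Bernoulli variables. The first `m` all succeeding
gives the lower bound `r ^ (m * (m + 1))`, and an exponential Markov inequality gives the same power
up to a constant. Hurwitz's theorem carries both bounds to the limit. -/

/-! ### Zero counts and division by zeros -/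

open Metric in
theorem zeroCount_congr {f g : ℂ → ℂ} {r : ℝ} (h : Set.EqOn f g (ball 0 r)) :
    zeroCount f r = zeroCount g r := by
  unfold zeroCount
  refine iSup_congr fun s => iSup_congr fun hs => Finset.sum_congr rfl fun z hz => ?_
  refine analyticOrderAt_congr ?_
  filter_upwards [isOpen_ball.mem_nhds (hs hz)] with x hx using h hx

theorem zeroCount_mono (f : ℂ → ℂ) {r r' : ℝ} (h : r ≤ r') : zeroCount f r ≤ zeroCount f r' := by
  unfold zeroCount
  refine iSup₂_le fun s hs => ?_
  exact le_iSup₂_of_le s (hs.trans (Metric.ball_subset_ball h)) le_rfl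

theorem sum_analyticOrderAt_le_zeroCount (f : ℂ → ℂ) {r : ℝ} {s : Finset ℂ}
    (hs : (s : Set ℂ) ⊆ Metric.ball 0 r) : ∑ z ∈ s, analyticOrderAt f z ≤ zeroCount f r :=
  le_iSup₂_of_le (f := fun (s : Finset ℂ) (_ : (s : Set ℂ) ⊆ Metric.ball 0 r) =>
    ∑ z ∈ s, analyticOrderAt f z) s hs le_rfl

theorem exists_finset_of_le_zeroCount {f : ℂ → ℂ} {r : ℝ} {m : ℕ} (h : (m : ℕ∞) ≤ zeroCount f r) :
    ∃ s : Finset ℂ, (s : Set ℂ) ⊆ Metric.ball 0 r ∧ (m : ℕ∞) ≤ ∑ z ∈ s, analyticOrderAt f z := by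
  by_contra! hc
  rcases m with _ | k
  · simpa using hc ∅ (by simp)
  · have : zeroCount f r ≤ k := iSup₂_le fun s hs => by
      have := hc s hs
      push_cast at this
      exact Order.le_of_lt_add_one this
    have h2 := h.trans this
    norm_cast at h2
    omega

/-- A finite witness set in an open disk already lies in a smaller one. This gives Hurwitz's theorem
room to choose a circle free of zeros. -/
theorem exists_lt_of_le_zeroCount {f : ℂ → ℂ} {r : ℝ} {m : ℕ} (h : (m : ℕ∞) ≤ zeroCount f r) :
    ∃ r' < r, (m : ℕ∞) ≤ zeroCount f r' := by
  obtain ⟨s, hs, hm⟩ := exists_finset_of_le_zeroCount h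
  rcases s.eq_empty_or_nonempty with rfl | hne
  · refine ⟨r - 1, by linarith, ?_⟩
    simp only [Finset.sum_empty, nonpos_iff_eq_zero, Nat.cast_eq_zero] at hm
    simp [hm]
  · obtain ⟨w, hw, hmax⟩ := s.exists_max_image (fun z => ‖z‖) hne
    have hwr : ‖w‖ < r := by simpa using hs hw
    refine ⟨(‖w‖ + r) / 2, by linarith, hm.trans (sum_analyticOrderAt_le_zeroCount f ?_)⟩
    intro z hz
    have := hmax z hz
    simp only [Metric.mem_ball, dist_zero_right]
    linarith

theorem analyticAt_of_differentiableOn_ball {f : ℂ → ℂ} {R : ℝ}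
    (hf : DifferentiableOn ℂ f (Metric.ball 0 R)) {z : ℂ} (hz : z ∈ Metric.ball (0 : ℂ) R) :
    AnalyticAt ℂ f z :=
  hf.analyticAt (Metric.isOpen_ball.mem_nhds hz)

theorem zeroCount_mul_of_ne_zero {u g : ℂ → ℂ} {r : ℝ} (hu : DifferentiableOn ℂ u (Metric.ball 0 r))
    (hg : DifferentiableOn ℂ g (Metric.ball 0 r)) (h0 : ∀ z ∈ Metric.ball (0 : ℂ) r, u z ≠ 0) :
    zeroCount (fun z => u z * g z) r = zeroCount g r := by
  unfold zeroCount
  refine iSup_congr fun s => iSup_congr fun hs => Finset.sum_congr rfl fun z hz => ?_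
  have h1 := analyticOrderAt_mul (analyticAt_of_differentiableOn_ball hu (hs hz))
    (analyticAt_of_differentiableOn_ball hg (hs hz))
  have h2 : analyticOrderAt u z = 0 := analyticOrderAt_eq_zero.2 (Or.inr (h0 z (hs hz)))
  rw [h2, zero_add] at h1
  exact h1

theorem zeroCount_eq_zero_of_ne_zero {f : ℂ → ℂ} {r : ℝ}
    (h0 : ∀ z ∈ Metric.ball (0 : ℂ) r, f z ≠ 0) : zeroCount f r = 0 := by
  unfold zeroCount
  simp only [ENat.iSup_eq_zero]
  intro s hs
  exact Finset.sum_eq_zero fun z hz => analyticOrderAt_eq_zero.2 (Or.inr (h0 z (hs hz)))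

theorem zeroCount_sub_mul {g : ℂ → ℂ} {r : ℝ} {w : ℂ} (hw : w ∈ Metric.ball (0 : ℂ) r)
    (hg : DifferentiableOn ℂ g (Metric.ball 0 r)) :
    zeroCount (fun z => (z - w) * g z) r = zeroCount g r + 1 := by
  have hord : ∀ z ∈ Metric.ball (0 : ℂ) r, analyticOrderAt (fun z => (z - w) * g z) z
      = (if z = w then 1 else 0) + analyticOrderAt g z := by
    intro z hz
    have h1 := analyticOrderAt_mul (f := fun z => z - w) (by fun_prop : AnalyticAt ℂ _ z)
      (analyticAt_of_differentiableOn_ball hg hz)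
    refine Eq.trans h1 ?_
    congr 1
    split_ifs with h
    · subst h
      exact analyticOrderAt_id_sub_const_self
    · exact analyticOrderAt_id_sub_const_of_ne h
  have hsum : ∀ s : Finset ℂ, (s : Set ℂ) ⊆ Metric.ball 0 r →
      ∑ z ∈ s, analyticOrderAt (fun z => (z - w) * g z) z
        = (if w ∈ s then 1 else 0) + ∑ z ∈ s, analyticOrderAt g z := by
    intro s hs
    rw [Finset.sum_congr rfl fun z hz => hord z (hs hz), Finset.sum_add_distrib]
    simp
  apply le_antisymm
  · refine iSup₂_le fun s hs => ?_
    rw [hsum s hs, add_comm]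
    gcongr
    · exact sum_analyticOrderAt_le_zeroCount g hs
    · split_ifs <;> simp
  -- The supremum need not be attained when it is infinite. Under the contrary assumption the left
  -- side is a finite `k`, which has a witness set for `g`; adding `w` to that set produces order `k
  -- + 1`.
  · by_contra! hlt
    have hfin : zeroCount (fun z => (z - w) * g z) r ≠ ⊤ := ne_top_of_lt hlt
    obtain ⟨k, hk⟩ := ENat.ne_top_iff_exists.1 hfin
    rw [← hk] at hlt
    have h2 : (k : ℕ∞) ≤ zeroCount g r := Order.le_of_lt_add_one hlt
    obtain ⟨s, hs, hm⟩ := exists_finset_of_le_zeroCount h2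
    have hs' : ((insert w s : Finset ℂ) : Set ℂ) ⊆ Metric.ball 0 r := by
      simp [Set.insert_subset_iff, hs, hw, -Metric.mem_ball]
    have h3 := sum_analyticOrderAt_le_zeroCount (fun z => (z - w) * g z) hs'
    rw [hsum _ hs', ← hk] at h3
    have h4 : ∑ z ∈ s, analyticOrderAt g z ≤ ∑ z ∈ insert w s, analyticOrderAt g z :=
      Finset.sum_le_sum_of_subset (Finset.subset_insert w s)
    simp only [Finset.mem_insert_self, if_true] at h3
    have h5 : (1 : ℕ∞) + k ≤ k := le_trans (by gcongr; exact hm.trans h4) h3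
    norm_cast at h5
    omega

theorem exists_eq_sub_mul {f : ℂ → ℂ} {R : ℝ} {w : ℂ} (hw : w ∈ Metric.ball (0 : ℂ) R)
    (hf : DifferentiableOn ℂ f (Metric.ball 0 R)) (h0 : f w = 0) :
    ∃ g : ℂ → ℂ, DifferentiableOn ℂ g (Metric.ball 0 R) ∧ ∀ z, f z = (z - w) * g z := by
  refine ⟨dslope f w, (Complex.differentiableOn_dslope (Metric.isOpen_ball.mem_nhds hw)).2 hf, ?_⟩
  intro z
  have := sub_smul_dslope f w z
  rw [h0, sub_zero, smul_eq_mul] at this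
  exact this.symm

/-- Zeros are divided out one at a time with `dslope`. The quotient stays holomorphic on the larger
disk of radius `R`, so it can still be estimated on circles outside the disk in which zeros are
counted. -/
theorem exists_eq_prod_mul {R r : ℝ} (hrR : r ≤ R) : ∀ (m : ℕ) {f : ℂ → ℂ},
    DifferentiableOn ℂ f (Metric.ball 0 R) → (m : ℕ∞) ≤ zeroCount f r →
    ∃ (S : Multiset ℂ) (g : ℂ → ℂ), S.card = m ∧ (∀ w ∈ S, w ∈ Metric.ball (0 : ℂ) r) ∧
      DifferentiableOn ℂ g (Metric.ball 0 R) ∧ (∀ z, f z = (S.map fun w => z - w).prod * g z) ∧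
      zeroCount f r = zeroCount g r + m
  | 0, f, hf, _ => ⟨0, f, by simp, by simp, hf, by simp, by simp⟩
  | m + 1, f, hf, hm => by
    obtain ⟨w, hw, hfw⟩ : ∃ w ∈ Metric.ball (0 : ℂ) r, f w = 0 := by
      by_contra! hc
      rw [zeroCount_eq_zero_of_ne_zero hc] at hm
      norm_cast at hm
    obtain ⟨g, hg, hfg⟩ := exists_eq_sub_mul (Metric.ball_subset_ball hrR hw) hf hfw
    have hz : zeroCount f r = zeroCount g r + 1 := by
      rw [← zeroCount_sub_mul hw (hg.mono (Metric.ball_subset_ball hrR))]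
      exact zeroCount_congr fun z _ => hfg z
    have hm' : (m : ℕ∞) ≤ zeroCount g r := by
      rw [hz] at hm
      push_cast at hm
      exact (ENat.add_le_add_iff_right (by simp)).1 hm
    obtain ⟨S, k, hS, hSr, hk, hgk, hzk⟩ := exists_eq_prod_mul hrR m hg hm'
    refine ⟨w ::ₘ S, k, by simp [hS], ?_, hk, ?_, ?_⟩
    · simpa [hw, -Metric.mem_ball] using hSr
    · intro z
      rw [hfg, hgk]
      simp [mul_assoc]
    · rw [hz, hzk]
      push_cast
      ring

/-! ### Blaschke factors and finiteness of the zero count -/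

/-- The contraction factor of a Blaschke factor with zero in the disk of radius `r`, relative to
the disk of radius `ρ`, on the disk of radius `r`. -/
noncomputable def blaschkeFactor (r ρ : ℝ) : ℝ := Real.sqrt (1 - ((ρ ^ 2 - r ^ 2) / (2 * ρ ^ 2)) ^ 2)

theorem blaschkeFactor_pos {r ρ : ℝ} (hr : 0 ≤ r) (hρ : r < ρ) : 0 < blaschkeFactor r ρ := by
  have h0 : 0 < ρ := hr.trans_lt hρ
  refine Real.sqrt_pos.2 ?_
  have h1 : (ρ ^ 2 - r ^ 2) / (2 * ρ ^ 2) ≤ 1 / 2 := by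
    rw [div_le_div_iff₀ (by positivity) (by norm_num)]
    nlinarith
  have h2 : 0 ≤ (ρ ^ 2 - r ^ 2) / (2 * ρ ^ 2) := div_nonneg (by nlinarith) (by positivity)
  nlinarith

theorem blaschkeFactor_lt_one {r ρ : ℝ} (hr : 0 ≤ r) (hρ : r < ρ) : blaschkeFactor r ρ < 1 := by
  have h0 : 0 < ρ := hr.trans_lt hρ
  have h2 : 0 < (ρ ^ 2 - r ^ 2) / (2 * ρ ^ 2) := div_pos (by nlinarith) (by positivity)
  rw [blaschkeFactor, Real.sqrt_lt' one_pos]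
  nlinarith [pow_pos h2 2]

/-- With `D = |ρ² - w̄ z|`, the identity `D² - ρ² |z - w|² = (ρ² - |z|²) (ρ² - |w|²)` bounds the
deficit below by `(ρ² - r²)²`, and `D ≤ 2 ρ²` makes this a fixed fraction of `D²`. -/
theorem norm_blaschke_le {r ρ : ℝ} (hr : 0 ≤ r) (hρ : r < ρ) {z w : ℂ} (hz : ‖z‖ ≤ r) (hw : ‖w‖ ≤ r) :
    ρ * ‖z - w‖ ≤ blaschkeFactor r ρ * ‖(ρ : ℂ) ^ 2 - (starRingEnd ℂ) w * z‖ := by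
  have h0 : 0 < ρ := hr.trans_lt hρ
  rw [blaschkeFactor]
  refine le_of_sq_le_sq ?_ (by positivity)
  rw [mul_pow, mul_pow, Real.sq_sqrt]
  swap
  · have h1 : (ρ ^ 2 - r ^ 2) / (2 * ρ ^ 2) ≤ 1 / 2 := by
      rw [div_le_div_iff₀ (by positivity) (by norm_num)]
      nlinarith
    have h2 : 0 ≤ (ρ ^ 2 - r ^ 2) / (2 * ρ ^ 2) := div_nonneg (by nlinarith) (by positivity)
    nlinarith
  set D := ‖(ρ : ℂ) ^ 2 - (starRingEnd ℂ) w * z‖ with hD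
  have hDle : D ≤ 2 * ρ ^ 2 := by
    calc D ≤ ‖(ρ : ℂ) ^ 2‖ + ‖(starRingEnd ℂ) w * z‖ := norm_sub_le _ _
      _ = ρ ^ 2 + ‖w‖ * ‖z‖ := by simp [abs_of_pos h0]
      _ ≤ ρ ^ 2 + r * r := by gcongr
      _ ≤ _ := by nlinarith
  have hid : D ^ 2 - ρ ^ 2 * ‖z - w‖ ^ 2 = (ρ ^ 2 - ‖z‖ ^ 2) * (ρ ^ 2 - ‖w‖ ^ 2) := by
    rw [hD]
    simp only [← Complex.normSq_eq_norm_sq, Complex.normSq_apply]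
    simp [pow_two]
    ring
  have hz2 : ‖z‖ ^ 2 ≤ r ^ 2 := by gcongr
  have hw2 : ‖w‖ ^ 2 ≤ r ^ 2 := by gcongr
  have h3 : (ρ ^ 2 - r ^ 2) ^ 2 ≤ (ρ ^ 2 - ‖z‖ ^ 2) * (ρ ^ 2 - ‖w‖ ^ 2) := by
    have : 0 ≤ ρ ^ 2 - r ^ 2 := by nlinarith
    nlinarith
  have h4 : ((ρ ^ 2 - r ^ 2) / (2 * ρ ^ 2)) ^ 2 * D ^ 2 ≤ (ρ ^ 2 - r ^ 2) ^ 2 := by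
    rw [div_pow, div_mul_eq_mul_div, div_le_iff₀ (by positivity)]
    gcongr
  nlinarith

/-- A bounded analytic function with `m` zeros in a disk is exponentially small there. -/
theorem norm_le_of_le_zeroCount {f : ℂ → ℂ} {r ρ R M : ℝ} (hr : 0 ≤ r) (hρ : r < ρ) (hR : ρ < R)
    (hf : DifferentiableOn ℂ f (Metric.ball 0 R)) (hM : ∀ z : ℂ, ‖z‖ = ρ → ‖f z‖ ≤ M) {m : ℕ}
    (hm : (m : ℕ∞) ≤ zeroCount f r) {z : ℂ} (hz : ‖z‖ ≤ r) :
    ‖f z‖ ≤ M * blaschkeFactor r ρ ^ m := by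
  have h0 : 0 < ρ := hr.trans_lt hρ
  obtain ⟨S, g, hS, hSr, hg, hfg, -⟩ := exists_eq_prod_mul (hρ.trans hR).le m hf hm
  -- Each factor `z - w` of `f` is replaced by `(ρ² - w̄ z) / ρ`, which has the same modulus on `|z|
  -- = ρ`. The maximum principle therefore bounds `h` by `M`, and every factor that is changed back
  -- gains `blaschkeFactor r ρ`.
  set h : ℂ → ℂ := fun z =>
    (S.map fun w => ((ρ : ℂ) ^ 2 - (starRingEnd ℂ) w * z) / ρ).prod * g z with hh
  have hprod : ∀ T : Multiset ℂ, Differentiable ℂ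
      (fun z : ℂ => (T.map fun w => ((ρ : ℂ) ^ 2 - (starRingEnd ℂ) w * z) / ρ).prod) := by
    intro T
    induction T using Multiset.induction with
    | empty => simp
    | cons a T ih =>
      simp only [Multiset.map_cons, Multiset.prod_cons]
      exact Differentiable.mul (by fun_prop) ih
  have hhd : DifferentiableOn ℂ h (Metric.ball 0 R) := (hprod S).differentiableOn.mul hg
  have hhs : ∀ z : ℂ, ‖z‖ = ρ → ‖h z‖ ≤ M := by
    intro z hz
    refine le_trans (le_of_eq ?_) (hM z hz)
    rw [hh, hfg]
    simp only [norm_mul]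
    congr 1
    have key : ∀ w : ℂ, ‖((ρ : ℂ) ^ 2 - (starRingEnd ℂ) w * z) / ρ‖ = ‖z - w‖ := by
      intro w
      have : (ρ : ℂ) ^ 2 - (starRingEnd ℂ) w * z = z * (starRingEnd ℂ) (z - w) := by
        rw [map_sub, mul_sub, Complex.mul_conj, Complex.normSq_eq_norm_sq, hz]
        push_cast
        ring
      rw [this, norm_div, norm_mul, hz, RCLike.norm_conj, Complex.norm_real, Real.norm_eq_abs,
        abs_of_pos h0]
      field_simp
    have := map_multiset_prod (normHom : ℂ →*₀ ℝ) (S.map fun w => ((ρ : ℂ) ^ 2 - (starRingEnd ℂ) w * z) / ρ)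
    simp only [normHom, MonoidWithZeroHom.coe_mk, ZeroHom.coe_mk, Multiset.map_map,
      Function.comp_def] at this
    rw [this]
    have := map_multiset_prod (normHom : ℂ →*₀ ℝ) (S.map fun w => z - w)
    simp only [normHom, MonoidWithZeroHom.coe_mk, ZeroHom.coe_mk, Multiset.map_map,
      Function.comp_def] at this
    rw [this]
    simp only [key]
  have hhb : ‖h z‖ ≤ M := by
    refine Complex.norm_le_of_forall_mem_frontier_norm_le (U := Metric.ball (0 : ℂ) ρ)
      Metric.isBounded_ball ?_ ?_ (subset_closure ?_)
    · refine DifferentiableOn.diffContOnCl ?_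
      rw [closure_ball _ h0.ne']
      exact hhd.mono (Metric.closedBall_subset_ball hR)
    · rw [frontier_ball _ h0.ne']
      intro z hz
      exact hhs z (by simpa using hz)
    · simpa using hz.trans_lt hρ
  rw [hfg, norm_mul]
  have hfac : ∀ T : Multiset ℂ, (∀ w ∈ T, w ∈ Metric.ball (0 : ℂ) r) →
      ‖(T.map fun w => z - w).prod‖ ≤ blaschkeFactor r ρ ^ T.card *
        ‖(T.map fun w => ((ρ : ℂ) ^ 2 - (starRingEnd ℂ) w * z) / ρ).prod‖ := by
    intro T
    induction T using Multiset.induction with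
    | empty => simp
    | cons a T ih =>
      intro hT
      simp only [Multiset.map_cons, Multiset.prod_cons, norm_mul, Multiset.card_cons]
      have h1 := ih fun w hw => hT w (Multiset.mem_cons_of_mem hw)
      have h2 : ‖a‖ ≤ r := by
        have := hT a (Multiset.mem_cons_self a T)
        simp only [Metric.mem_ball, dist_zero_right] at this
        exact this.le
      have h3 := norm_blaschke_le hr hρ hz h2
      have h4 : ‖z - a‖ ≤ blaschkeFactor r ρ * ‖((ρ : ℂ) ^ 2 - (starRingEnd ℂ) a * z) / ρ‖ := by
        rw [norm_div, Complex.norm_real, Real.norm_eq_abs, abs_of_pos h0, ← mul_div_assoc,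
          le_div_iff₀ h0]
        linarith
      calc _ ≤ _ := mul_le_mul h4 h1 (norm_nonneg _)
            (mul_nonneg (blaschkeFactor_pos hr hρ).le (norm_nonneg _))
        _ = _ := by ring
  have h5 := hfac S hSr
  rw [hS] at h5
  calc _ ≤ _ := mul_le_mul_of_nonneg_right h5 (norm_nonneg (g z))
    _ = ‖h z‖ * blaschkeFactor r ρ ^ m := by simp only [hh, norm_mul]; ring
    _ ≤ _ := by
      have := (blaschkeFactor_pos hr hρ).le
      gcongr

theorem eqOn_zero_of_eqOn_zero_ball {f : ℂ → ℂ} {r R : ℝ} (hr : 0 < r)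
    (hf : DifferentiableOn ℂ f (Metric.ball 0 R)) (h : ∀ z ∈ Metric.ball (0 : ℂ) r, f z = 0) :
    ∀ z ∈ Metric.ball (0 : ℂ) R, f z = 0 := by
  intro z hz
  have hR : 0 < R := dist_nonneg.trans_lt (Metric.mem_ball.1 hz)
  have h1 : AnalyticOnNhd ℂ f (Metric.ball 0 R) := hf.analyticOnNhd Metric.isOpen_ball
  refine h1.eqOn_zero_of_preconnected_of_eventuallyEq_zero (convex_ball 0 R).isPreconnected
    (Metric.mem_ball_self hR) ?_ hz
  filter_upwards [Metric.ball_mem_nhds (0 : ℂ) hr] with x hx using h x hx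

/-- An infinite count would allow the Blaschke bound `M * κ ^ m` for every `m`, so `f` would vanish
on the small disk and then everywhere by the identity theorem. -/
theorem zeroCount_ne_top {f : ℂ → ℂ} {r R : ℝ} (hr : 0 < r) (hR : r < R)
    (hf : DifferentiableOn ℂ f (Metric.ball 0 R)) (h0 : ∃ z ∈ Metric.ball (0 : ℂ) R, f z ≠ 0) :
    zeroCount f r ≠ ⊤ := by
  intro htop
  obtain ⟨z₀, hz₀, hne⟩ := h0
  refine hne (eqOn_zero_of_eqOn_zero_ball hr hf ?_ z₀ hz₀)
  intro z hz
  set ρ := (r + R) / 2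
  have hρ : r < ρ := by simp only [ρ]; linarith
  have hρR : ρ < R := by simp only [ρ]; linarith
  have hcpt : IsCompact (Metric.sphere (0 : ℂ) ρ) := isCompact_sphere 0 ρ
  obtain ⟨M, hM⟩ := hcpt.exists_bound_of_continuousOn
    (hf.continuousOn.mono ((Metric.sphere_subset_closedBall).trans (Metric.closedBall_subset_ball hρR)))
  have hle : ∀ m : ℕ, ‖f z‖ ≤ M * blaschkeFactor r ρ ^ m := fun m =>
    norm_le_of_le_zeroCount hr.le hρ hρR hf (fun z hz => hM z (by simpa using hz))
      (by rw [htop]; exact le_top) (by simpa using (Metric.mem_ball.1 hz).le)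
  have hlim : Filter.Tendsto (fun m : ℕ => M * blaschkeFactor r ρ ^ m) Filter.atTop (nhds (M * 0)) :=
    (tendsto_pow_atTop_nhds_zero_of_lt_one (blaschkeFactor_pos hr.le hρ).le
      (blaschkeFactor_lt_one hr.le hρ)).const_mul M
  rw [mul_zero] at hlim
  exact norm_le_zero_iff.1 (ge_of_tendsto' hlim hle)

theorem exists_factorization {f : ℂ → ℂ} {r R : ℝ} (hr : 0 < r) (hR : r < R)
    (hf : DifferentiableOn ℂ f (Metric.ball 0 R)) (h0 : ∃ z ∈ Metric.ball (0 : ℂ) R, f z ≠ 0) :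
    ∃ (S : Multiset ℂ) (g : ℂ → ℂ), zeroCount f r = S.card ∧
      (∀ w ∈ S, w ∈ Metric.ball (0 : ℂ) r) ∧
      DifferentiableOn ℂ g (Metric.ball 0 R) ∧ (∀ z, f z = (S.map fun w => z - w).prod * g z) ∧
      ∀ z ∈ Metric.ball (0 : ℂ) r, g z ≠ 0 := by
  obtain ⟨n, hn⟩ := ENat.ne_top_iff_exists.1 (zeroCount_ne_top hr hR hf h0)
  obtain ⟨S, g, hS, hSr, hg, hfg, hz⟩ := exists_eq_prod_mul hR.le n hf hn.le
  refine ⟨S, g, by rw [← hn, hS], hSr, hg, hfg, ?_⟩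
  have hgz : zeroCount g r = 0 := by
    rw [← hn] at hz
    have hfin : zeroCount g r ≠ ⊤ := by
      intro h
      rw [h, top_add] at hz
      exact ENat.natCast_ne_top n hz
    obtain ⟨k, hk⟩ := ENat.ne_top_iff_exists.1 hfin
    rw [← hk] at hz ⊢
    norm_cast at hz ⊢
    omega
  intro z hz0 hgz0
  have hsum := sum_analyticOrderAt_le_zeroCount g (r := r) (s := {z}) (by simpa using hz0)
  rw [hgz, Finset.sum_singleton, nonpos_iff_eq_zero, analyticOrderAt_eq_zero] at hsum
  exact hsum.elim (fun h => h (analyticAt_of_differentiableOn_ball hg (Metric.ball_subset_ball hR.le hz0)))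
    (fun h => h hgz0)

/-! ### The argument principle, Rouché and Hurwitz -/

theorem circleIntegrable_logDeriv {f : ℂ → ℂ} {r R : ℝ} (hr : 0 < r) (hR : r < R)
    (hf : DifferentiableOn ℂ f (Metric.ball 0 R)) (h0 : ∀ z ∈ Metric.sphere (0 : ℂ) r, f z ≠ 0) :
    CircleIntegrable (logDeriv f) 0 r := by
  refine ContinuousOn.circleIntegrable hr.le ?_
  have hsub : Metric.sphere (0 : ℂ) r ⊆ Metric.ball 0 R :=
    Metric.sphere_subset_closedBall.trans (Metric.closedBall_subset_ball hR)
  exact ((hf.deriv Metric.isOpen_ball).continuousOn.mono hsub).div (hf.continuousOn.mono hsub) h0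

theorem circleIntegral_logDeriv_of_ne_zero {g : ℂ → ℂ} {r R : ℝ} (hr : 0 < r) (hR : r < R)
    (hg : DifferentiableOn ℂ g (Metric.ball 0 R)) (h0 : ∀ z ∈ Metric.closedBall (0 : ℂ) r, g z ≠ 0) :
    ∮ z in C(0, r), logDeriv g z = 0 := by
  have hsub : Metric.closedBall (0 : ℂ) r ⊆ Metric.ball 0 R := Metric.closedBall_subset_ball hR
  refine Complex.circleIntegral_eq_zero_of_differentiable_on_off_countable hr.le
    Set.countable_empty ?_ ?_
  · exact ((hg.deriv Metric.isOpen_ball).continuousOn.mono hsub).div (hg.continuousOn.mono hsub) h0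
  · intro z hz
    have hz' := Metric.ball_subset_closedBall hz.1
    have hn := Metric.isOpen_ball.mem_nhds (hsub hz')
    exact ((hg.deriv Metric.isOpen_ball).differentiableAt hn).div (hg.differentiableAt hn) (h0 z hz')

/-- Each linear factor adds `(z - a)⁻¹` to the logarithmic derivative, hence `2πi` to the integral.
Differentiability and nonvanishing are carried along because the induction step needs both. -/
theorem circleIntegral_logDeriv_prod_mul {g : ℂ → ℂ} {r R : ℝ} (hr : 0 < r) (hR : r < R)
    (hg : DifferentiableOn ℂ g (Metric.ball 0 R)) (h0 : ∀ z ∈ Metric.closedBall (0 : ℂ) r, g z ≠ 0)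
    (S : Multiset ℂ) (hS : ∀ w ∈ S, w ∈ Metric.ball (0 : ℂ) r) :
    DifferentiableOn ℂ (fun z => (S.map fun w => z - w).prod * g z) (Metric.ball 0 R) ∧
    (∀ z ∈ Metric.sphere (0 : ℂ) r, (S.map fun w => z - w).prod * g z ≠ 0) ∧
    ∮ z in C(0, r), logDeriv (fun z => (S.map fun w => z - w).prod * g z) z
      = 2 * Real.pi * Complex.I * S.card := by
  induction S using Multiset.induction with
  | empty =>
    simp only [Multiset.map_zero, Multiset.prod_zero, one_mul, Multiset.card_zero, Nat.cast_zero,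
      mul_zero]
    exact ⟨hg, fun z hz => h0 z (Metric.sphere_subset_closedBall hz),
      circleIntegral_logDeriv_of_ne_zero hr hR hg h0⟩
  | cons a T ih =>
    obtain ⟨h1, h2, h3⟩ := ih fun w hw => hS w (Multiset.mem_cons_of_mem hw)
    have ha := hS a (Multiset.mem_cons_self a T)
    have hane : ∀ z ∈ Metric.sphere (0 : ℂ) r, z - a ≠ 0 := by
      intro z hz h
      rw [sub_eq_zero.1 h] at hz
      rw [mem_sphere_zero_iff_norm] at hz
      rw [mem_ball_zero_iff] at ha
      linarith
    simp only [Multiset.map_cons, Multiset.prod_cons, mul_assoc, Multiset.card_cons]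
    refine ⟨DifferentiableOn.mul (by fun_prop) h1, fun z hz => mul_ne_zero (hane z hz) (h2 z hz), ?_⟩
    have hint := circleIntegrable_logDeriv hr hR h1 h2
    have hint2 : CircleIntegrable (fun z => (z - a)⁻¹) 0 r := by
      refine ContinuousOn.circleIntegrable hr.le ?_
      exact ContinuousOn.inv₀ (by fun_prop) hane
    have hcongr : ∮ z in C(0, r), logDeriv (fun z => (z - a) * ((T.map fun w => z - w).prod * g z)) z
        = ∮ z in C(0, r), ((z - a)⁻¹ + logDeriv (fun z => (T.map fun w => z - w).prod * g z) z) := by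
      refine circleIntegral.integral_congr hr.le fun z hz => ?_
      have hn := Metric.isOpen_ball.mem_nhds
        (Metric.closedBall_subset_ball hR (Metric.sphere_subset_closedBall hz))
      have := logDeriv_mul (f := fun z => z - a) (g := fun z => (T.map fun w => z - w).prod * g z)
        z (hane z hz) (h2 z hz) (by fun_prop) (h1.differentiableAt hn)
      refine this.trans ?_
      congr 1
      simp [logDeriv_apply]
    rw [hcongr, circleIntegral.integral_add hint2 hint, h3,
      circleIntegral.integral_sub_inv_of_mem_ball ha]
    push_cast
    ring

/-- The argument principle on a disk. -/
theorem argument_principle {f : ℂ → ℂ} {r R : ℝ} (hr : 0 < r) (hR : r < R)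
    (hf : DifferentiableOn ℂ f (Metric.ball 0 R)) (h0 : ∀ z ∈ Metric.sphere (0 : ℂ) r, f z ≠ 0) :
    ∃ n : ℕ, zeroCount f r = n ∧
      ∮ z in C(0, r), logDeriv f z = 2 * Real.pi * Complex.I * n := by
  have hsub : Metric.sphere (0 : ℂ) r ⊆ Metric.ball 0 R :=
    Metric.sphere_subset_closedBall.trans (Metric.closedBall_subset_ball hR)
  obtain ⟨z₀, hz₀⟩ : (Metric.sphere (0 : ℂ) r).Nonempty := (NormedSpace.sphere_nonempty).2 hr.le
  obtain ⟨S, g, hS, hSr, hg, hfg, hg0⟩ := exists_factorization hr hR hf ⟨z₀, hsub hz₀, h0 z₀ hz₀⟩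
  refine ⟨S.card, hS, ?_⟩
  have hg1 : ∀ z ∈ Metric.closedBall (0 : ℂ) r, g z ≠ 0 := by
    intro z hz
    rcases (mem_closedBall_zero_iff.1 hz).lt_or_eq with h | h
    · exact hg0 z (mem_ball_zero_iff.2 h)
    · intro h1
      exact h0 z (mem_sphere_zero_iff_norm.2 h) (by rw [hfg, h1, mul_zero])
  rw [funext hfg]
  exact (circleIntegral_logDeriv_prod_mul hr hR hg hg1 S hSr).2.2

/-- **Rouché's theorem** for disks centered at the origin. -/
theorem rouche {f g : ℂ → ℂ} {r R : ℝ} (hr : 0 < r) (hR : r < R)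
    (hf : DifferentiableOn ℂ f (Metric.ball 0 R)) (hg : DifferentiableOn ℂ g (Metric.ball 0 R))
    (h : ∀ z ∈ Metric.sphere (0 : ℂ) r, ‖f z - g z‖ < ‖g z‖) :
    zeroCount f r = zeroCount g r := by
  have hg0 : ∀ z ∈ Metric.sphere (0 : ℂ) r, g z ≠ 0 := fun z hz h1 => by
    have := h z hz
    rw [h1, norm_zero] at this
    exact (norm_nonneg _).not_gt this
  have hf0 : ∀ z ∈ Metric.sphere (0 : ℂ) r, f z ≠ 0 := fun z hz h1 => by
    have := h z hz
    rw [h1, zero_sub, norm_neg] at this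
    exact lt_irrefl _ this
  obtain ⟨n, hn, hnI⟩ := argument_principle hr hR hf hf0
  obtain ⟨k, hk, hkI⟩ := argument_principle hr hR hg hg0
  have hsub : Metric.sphere (0 : ℂ) r ⊆ Metric.ball 0 R :=
    Metric.sphere_subset_closedBall.trans (Metric.closedBall_subset_ball hR)
  have hzero : ∮ z in C(0, r), (logDeriv f z - logDeriv g z) = 0 := by
    -- On the circle `f / g` stays within distance `1` of `1`, hence in the slit plane, so the
    -- principal logarithm of `f / g` is a primitive of the difference of logarithmic derivatives.
    refine circleIntegral.integral_eq_zero_of_hasDerivWithinAt (f := fun z => Complex.log (f z / g z))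
      hr.le fun z hz => HasDerivAt.hasDerivWithinAt ?_
    have hnz := Metric.isOpen_ball.mem_nhds (hsub hz)
    have h1 := (hf.differentiableAt hnz).hasDerivAt
    have h2 := (hg.differentiableAt hnz).hasDerivAt
    have hslit : f z / g z ∈ Complex.slitPlane := by
      have : ‖f z / g z - 1‖ < 1 := by
        rw [div_sub_one (hg0 z hz), norm_div, div_lt_one (norm_pos_iff.2 (hg0 z hz))]
        exact h z hz
      have h3 := Complex.mem_slitPlane_of_norm_lt_one this
      rwa [add_sub_cancel] at h3
    have h4 : HasDerivAt (fun z => f z / g z)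
        ((deriv f z * g z - f z * deriv g z) / g z ^ 2) z := h1.div h2 (hg0 z hz)
    refine (h4.clog hslit).congr_deriv ?_
    have := hf0 z hz
    have := hg0 z hz
    simp only [logDeriv_apply]
    field_simp
  rw [circleIntegral.integral_sub (circleIntegrable_logDeriv hr hR hf hf0)
    (circleIntegrable_logDeriv hr hR hg hg0), hnI, hkI, ← mul_sub, mul_eq_zero] at hzero
  have h2 : (n : ℂ) - k = 0 := hzero.resolve_left Complex.two_pi_I_ne_zero
  rw [hn, hk]
  have h3 : (n : ℂ) = k := sub_eq_zero.1 h2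
  exact_mod_cast h3

/-- The zeros in the disk have only finitely many moduli, so some radius between `s` and `r` avoids
them all. -/
theorem exists_radius_ne_zero {f : ℂ → ℂ} {s r R : ℝ} (hs : 0 ≤ s) (hsr : s < r) (hR : r < R)
    (hf : DifferentiableOn ℂ f (Metric.ball 0 R)) (h0 : ∃ z ∈ Metric.ball (0 : ℂ) R, f z ≠ 0) :
    ∃ ρ, s < ρ ∧ ρ < r ∧ ∀ z ∈ Metric.sphere (0 : ℂ) ρ, f z ≠ 0 := by
  obtain ⟨S, g, -, -, -, hfg, hg0⟩ := exists_factorization (hs.trans_lt hsr) hR hf h0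
  obtain ⟨ρ, hρ, hρS⟩ := (Set.Ioo_infinite hsr).exists_notMem_finset (S.map fun w => ‖w‖).toFinset
  refine ⟨ρ, hρ.1, hρ.2, fun z hz => ?_⟩
  rw [mem_sphere_zero_iff_norm] at hz
  rw [hfg]
  refine mul_ne_zero ?_ (hg0 z (by rw [mem_ball_zero_iff, hz]; exact hρ.2))
  rw [Ne, Multiset.prod_eq_zero_iff, Multiset.mem_map]
  rintro ⟨w, hw, hzw⟩
  apply hρS
  rw [Multiset.mem_toFinset, Multiset.mem_map]
  exact ⟨w, hw, by rw [← sub_eq_zero.1 hzw, hz]⟩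

/-- The minimum of `|f|` on the circle is positive, so uniformly close functions satisfy the
hypothesis of Rouché's theorem. -/
theorem eventually_zeroCount_eq {ι : Type*} {l : Filter ι} {F : ι → ℂ → ℂ} {f : ℂ → ℂ} {ρ R : ℝ}
    (hρ : 0 < ρ) (hR : ρ < R) (hF : ∀ᶠ i in l, DifferentiableOn ℂ (F i) (Metric.ball 0 R))
    (hf : DifferentiableOn ℂ f (Metric.ball 0 R))
    (hlim : TendstoUniformlyOn F f l (Metric.closedBall 0 ρ))
    (h0 : ∀ z ∈ Metric.sphere (0 : ℂ) ρ, f z ≠ 0) :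
    ∀ᶠ i in l, zeroCount (F i) ρ = zeroCount f ρ := by
  have hsub : Metric.sphere (0 : ℂ) ρ ⊆ Metric.ball 0 R :=
    Metric.sphere_subset_closedBall.trans (Metric.closedBall_subset_ball hR)
  obtain ⟨z₀, hz₀, hmin⟩ := (isCompact_sphere (0 : ℂ) ρ).exists_isMinOn
    ((NormedSpace.sphere_nonempty).2 hρ.le) (hf.continuousOn.mono hsub).norm
  have hpos : 0 < ‖f z₀‖ := norm_pos_iff.2 (h0 z₀ hz₀)
  filter_upwards [hF, Metric.tendstoUniformlyOn_iff.1 hlim _ hpos] with i hi hi2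
  refine rouche hρ hR hi hf fun z hz => ?_
  have h1 := hi2 z (Metric.sphere_subset_closedBall hz)
  rw [dist_comm, dist_eq_norm] at h1
  exact h1.trans_le (hmin hz)

/-- Lower semicontinuity of the number of zeros (Hurwitz). -/
theorem eventually_le_zeroCount {ι : Type*} {l : Filter ι} {F : ι → ℂ → ℂ} {f : ℂ → ℂ} {r R : ℝ}
    (hr : 0 < r) (hR : r < R) (hF : ∀ᶠ i in l, DifferentiableOn ℂ (F i) (Metric.ball 0 R))
    (hf : DifferentiableOn ℂ f (Metric.ball 0 R))
    (hlim : TendstoUniformlyOn F f l (Metric.closedBall 0 r))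
    (h0 : ∃ z ∈ Metric.ball (0 : ℂ) R, f z ≠ 0) {m : ℕ} (hm : (m : ℕ∞) ≤ zeroCount f r) :
    ∀ᶠ i in l, (m : ℕ∞) ≤ zeroCount (F i) r := by
  obtain ⟨r', hr', hm'⟩ := exists_lt_of_le_zeroCount hm
  obtain ⟨ρ, h1, h2, h3⟩ := exists_radius_ne_zero (le_max_right r' 0) (max_lt hr' hr) hR hf h0
  have hρ : 0 < ρ := (le_max_right _ _).trans_lt h1
  filter_upwards [eventually_zeroCount_eq hρ (h2.trans hR) hF hf
    (hlim.mono (Metric.closedBall_subset_closedBall h2.le)) h3] with i hi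
  calc (m : ℕ∞) ≤ zeroCount f r' := hm'
    _ ≤ zeroCount f ρ := zeroCount_mono f ((le_max_left _ _).trans h1.le)
    _ = zeroCount (F i) ρ := hi.symm
    _ ≤ zeroCount (F i) r := zeroCount_mono _ h2.le

/-- The radius must increase from `s` to `r`, since zeros of the approximants can converge to the
circle `|z| = s`. -/
theorem le_zeroCount_of_frequently {ι : Type*} {l : Filter ι} {F : ι → ℂ → ℂ} {f : ℂ → ℂ}
    {s r R : ℝ} (hs : 0 ≤ s) (hsr : s < r) (hR : r < R)
    (hF : ∀ᶠ i in l, DifferentiableOn ℂ (F i) (Metric.ball 0 R))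
    (hf : DifferentiableOn ℂ f (Metric.ball 0 R))
    (hlim : TendstoUniformlyOn F f l (Metric.closedBall 0 r))
    (h0 : ∃ z ∈ Metric.ball (0 : ℂ) R, f z ≠ 0) {m : ℕ}
    (hm : ∃ᶠ i in l, (m : ℕ∞) ≤ zeroCount (F i) s) :
    (m : ℕ∞) ≤ zeroCount f r := by
  obtain ⟨ρ, h1, h2, h3⟩ := exists_radius_ne_zero hs hsr hR hf h0
  have hρ : 0 < ρ := hs.trans_lt h1
  have hev := eventually_zeroCount_eq hρ (h2.trans hR) hF hf
    (hlim.mono (Metric.closedBall_subset_closedBall h2.le)) h3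
  obtain ⟨i, hi, hi2⟩ := (hm.and_eventually hev).exists
  calc (m : ℕ∞) ≤ zeroCount (F i) s := hi
    _ ≤ zeroCount (F i) ρ := zeroCount_mono _ h1.le
    _ = zeroCount f ρ := hi2
    _ ≤ zeroCount f r := zeroCount_mono _ h2.le

/-! ### Power series: coefficients and zeros -/

theorem norm_powerSeries_term_le {b : ℕ → ℂ} {R : ℝ} {z : ℂ} (hz : ‖z‖ ≤ R) (n : ℕ) :
    ‖b n * z ^ n‖ ≤ ‖b n‖ * R ^ n := by
  rw [norm_mul, norm_pow]
  gcongr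

theorem summable_norm_powerSeries {b : ℕ → ℂ} {R : ℝ} (hb : Summable fun n => ‖b n‖ * R ^ n)
    {z : ℂ} (hz : ‖z‖ ≤ R) : Summable fun n => ‖b n * z ^ n‖ :=
  Summable.of_nonneg_of_le (fun _ => norm_nonneg _) (norm_powerSeries_term_le hz) hb

theorem differentiableOn_powerSeries {b : ℕ → ℂ} {R : ℝ} (hb : Summable fun n => ‖b n‖ * R ^ n) :
    DifferentiableOn ℂ (fun z => ∑' n, b n * z ^ n) (Metric.ball 0 R) :=
  Complex.differentiableOn_tsum_of_summable_norm hb (fun n => by fun_prop) Metric.isOpen_ball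
    fun n _ hw => norm_powerSeries_term_le (mem_ball_zero_iff.1 hw).le n

theorem norm_powerSeries_le {b : ℕ → ℂ} {R : ℝ} (hb : Summable fun n => ‖b n‖ * R ^ n)
    {z : ℂ} (hz : ‖z‖ ≤ R) : ‖∑' n, b n * z ^ n‖ ≤ ∑' n, ‖b n‖ * R ^ n :=
  (norm_tsum_le_tsum_norm (summable_norm_powerSeries hb hz)).trans
    ((summable_norm_powerSeries hb hz).tsum_le_tsum (norm_powerSeries_term_le hz) hb)

theorem hasFPowerSeriesAt_powerSeries {b : ℕ → ℂ} {R : ℝ} (hR : 0 < R)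
    (hb : Summable fun n => ‖b n‖ * R ^ n) :
    HasFPowerSeriesOnBall (fun z => ∑' n, b n * z ^ n)
      (FormalMultilinearSeries.ofScalars ℂ b) 0 (ENNReal.ofReal R) where
  r_le := by
    refine FormalMultilinearSeries.le_radius_of_summable _ ?_
    simpa [FormalMultilinearSeries.ofScalars_norm, hR.le] using hb
  r_pos := by simpa using hR
  hasSum := by
    intro y hy
    rw [Metric.eball_ofReal, mem_ball_zero_iff] at hy
    have := (summable_norm_powerSeries hb hy.le).of_norm.hasSum
    simpa [FormalMultilinearSeries.ofScalars_apply_eq, smul_eq_mul, mul_comm] using this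

/-- Cauchy's estimate for the coefficients of a power series. -/
theorem norm_coeff_mul_pow_le {b : ℕ → ℂ} {r R M : ℝ} (hr : 0 < r) (hR : r < R)
    (hb : Summable fun n => ‖b n‖ * R ^ n)
    (hM : ∀ z : ℂ, ‖z‖ ≤ r → ‖∑' n, b n * z ^ n‖ ≤ M) (n : ℕ) : ‖b n‖ * r ^ n ≤ M := by
  have h1 := (hasFPowerSeriesAt_powerSeries (hr.trans hR) hb).factorial_smul 1 n
  rw [FormalMultilinearSeries.ofScalars_apply_eq, ← iteratedDeriv_eq_iteratedFDeriv] at h1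
  have h2 : DiffContOnCl ℂ (fun z => ∑' n, b n * z ^ n) (Metric.ball 0 r) := by
    refine DifferentiableOn.diffContOnCl ?_
    rw [closure_ball _ hr.ne']
    exact (differentiableOn_powerSeries hb).mono (Metric.closedBall_subset_ball hR)
  have h3 := Complex.norm_iteratedDeriv_le_of_forall_mem_sphere_norm_le n hr h2
    (fun z hz => hM z (mem_sphere_zero_iff_norm.1 hz).le)
  rw [← h1] at h3
  simp only [one_pow, smul_eq_mul, mul_one, nsmul_eq_mul, norm_mul, Complex.norm_natCast] at h3
  rw [mul_div_assoc] at h3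
  have h4 := le_of_mul_le_mul_left h3 (by positivity)
  rwa [le_div_iff₀ (by positivity)] at h4

theorem zeroCount_const_mul_pow {c : ℂ} (hc : c ≠ 0) {r : ℝ} (hr : 0 < r) (m : ℕ) :
    zeroCount (fun z => c * z ^ m) r = m := by
  induction m with
  | zero =>
    simp only [pow_zero, mul_one, Nat.cast_zero]
    exact zeroCount_eq_zero_of_ne_zero fun _ _ => hc
  | succ m ih =>
    have h1 : (fun z : ℂ => c * z ^ (m + 1)) = fun z => (z - 0) * (c * z ^ m) := by
      funext z
      ring
    rw [h1, zeroCount_sub_mul (Metric.mem_ball_self hr) (by fun_prop), ih, Nat.cast_add, Nat.cast_one]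

/-- If one term dominates on a circle, the number of zeros inside is its exponent. -/
theorem zeroCount_powerSeries_of_dominant {b : ℕ → ℂ} {r R : ℝ} (hr : 0 < r) (hR : r < R)
    (hb : Summable fun n => ‖b n‖ * R ^ n) (m : ℕ)
    (hdom : ∑' n, (if n = m then 0 else ‖b n‖ * r ^ n) < ‖b m‖ * r ^ m) :
    zeroCount (fun z => ∑' n, b n * z ^ n) r = m := by
  have hbr : Summable fun n => ‖b n‖ * r ^ n := Summable.of_nonneg_of_le (fun n => by positivity)
    (fun n => by gcongr) hb
  have hnn : 0 ≤ ∑' n, (if n = m then 0 else ‖b n‖ * r ^ n) :=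
    tsum_nonneg fun n => by split_ifs <;> positivity
  have hbm : b m ≠ 0 := fun h => by simp [h] at hdom; linarith
  rw [← zeroCount_const_mul_pow hbm hr m]
  refine rouche hr hR (differentiableOn_powerSeries hb) (by fun_prop) fun z hz => ?_
  rw [mem_sphere_zero_iff_norm] at hz
  have hs := summable_norm_powerSeries hbr hz.le
  have h1 := hs.of_norm.tsum_eq_add_tsum_ite m
  rw [h1, add_sub_cancel_left, norm_mul, norm_pow, hz]
  refine lt_of_le_of_lt ?_ hdom
  have heq : (fun n => ‖if n = m then (0 : ℂ) else b n * z ^ n‖)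
      = fun n => if n = m then 0 else ‖b n‖ * r ^ n := by
    funext n
    split_ifs <;> simp [hz]
  have hs2 : Summable fun n => ‖if n = m then (0 : ℂ) else b n * z ^ n‖ := by
    refine Summable.of_nonneg_of_le (fun _ => norm_nonneg _) (fun n => ?_) hs
    split_ifs
    · rw [norm_zero]
      exact norm_nonneg _
    · exact le_rfl
  rw [← heq]
  exact norm_tsum_le_tsum_norm hs2

/-- The Blaschke bound makes the function small on `|z| ≤ r`, and Cauchy's estimate passes this to
every coefficient. This is the deterministic half of the upper bound. -/
theorem norm_coeff_le_of_le_zeroCount {b : ℕ → ℂ} {r ρ R : ℝ} (hr : 0 < r) (hρ : r < ρ) (hR : ρ < R)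
    (hb : Summable fun n => ‖b n‖ * R ^ n) {m : ℕ}
    (hm : (m : ℕ∞) ≤ zeroCount (fun z => ∑' n, b n * z ^ n) r) (n : ℕ) :
    ‖b n‖ * r ^ n ≤ (∑' n, ‖b n‖ * R ^ n) * blaschkeFactor r ρ ^ m :=
  norm_coeff_mul_pow_le hr (hρ.trans hR) hb (fun _ hz =>
    norm_le_of_le_zeroCount hr.le hρ hR (differentiableOn_powerSeries hb)
      (fun _ hz => norm_powerSeries_le hb (hz.le.trans hR.le)) hm hz) n

/-! ### The coefficients `hyperbolicCoeff` -/

theorem hyperbolicCoeff_zero (L : ℝ) : hyperbolicCoeff L 0 = 1 := by simp [hyperbolicCoeff]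

theorem hyperbolicCoeff_succ {L : ℝ} (hL : 0 < L) (n : ℕ) :
    hyperbolicCoeff L (n + 1) = hyperbolicCoeff L n * Real.sqrt ((L + n) / (n + 1)) := by
  rw [hyperbolicCoeff, hyperbolicCoeff, ← Real.sqrt_mul]
  · congr 1
    rw [Finset.prod_range_succ, Nat.factorial_succ]
    push_cast
    field_simp
  · exact div_nonneg (Finset.prod_nonneg fun k _ => by positivity) (by positivity)

theorem hyperbolicCoeff_pos {L : ℝ} (hL : 0 < L) (n : ℕ) : 0 < hyperbolicCoeff L n :=
  Real.sqrt_pos.2 (div_pos (Finset.prod_pos fun k _ => by positivity) (by positivity))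

theorem hyperbolicCoeff_one (n : ℕ) : hyperbolicCoeff 1 n = 1 := by
  induction n with
  | zero => exact hyperbolicCoeff_zero 1
  | succ n ih =>
    rw [hyperbolicCoeff_succ one_pos, ih, one_mul, add_comm (1 : ℝ), div_self (by positivity),
      Real.sqrt_one]

/-- The growth of the coefficients is submultiplicative, up to a shift of the parameter. -/
theorem hyperbolicCoeff_add_le {L : ℝ} (hL : 0 < L) (m j : ℕ) :
    hyperbolicCoeff L (m + j) ≤ hyperbolicCoeff L m * hyperbolicCoeff (L + 1) j := by
  induction j with
  | zero => simp [hyperbolicCoeff_zero]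
  | succ j ih =>
    rw [← add_assoc, hyperbolicCoeff_succ hL, hyperbolicCoeff_succ (by linarith : 0 < L + 1),
      ← mul_assoc]
    refine mul_le_mul ih (Real.sqrt_le_sqrt ?_) (Real.sqrt_nonneg _) (mul_nonneg
      (hyperbolicCoeff_pos hL _).le (hyperbolicCoeff_pos (by linarith) _).le)
    rw [div_le_div_iff₀ (by positivity) (by positivity)]
    push_cast
    have : (0 : ℝ) ≤ m := Nat.cast_nonneg m
    have : (0 : ℝ) ≤ j := Nat.cast_nonneg j
    nlinarith [mul_nonneg hL.le this, mul_nonneg hL.le (Nat.cast_nonneg (α := ℝ) m)]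

theorem tendsto_sqrt_div (L : ℝ) :
    Filter.Tendsto (fun n : ℕ => Real.sqrt ((L + n) / (n + 1))) Filter.atTop (nhds 1) := by
  have h1 : Filter.Tendsto (fun n : ℕ => (L + n) / ((n : ℝ) + 1)) Filter.atTop (nhds 1) := by
    have h2 : Filter.Tendsto (fun n : ℕ => 1 + (L - 1) * (1 / ((n : ℝ) + 1))) Filter.atTop
        (nhds (1 + (L - 1) * 0)) :=
      (tendsto_one_div_add_atTop_nhds_zero_nat.const_mul _).const_add _
    rw [mul_zero, add_zero] at h2
    refine h2.congr fun n => ?_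
    have : (n : ℝ) + 1 ≠ 0 := by positivity
    field_simp
    ring
  simpa using h1.sqrt

theorem summable_hyperbolicCoeff {L q : ℝ} (hL : 0 < L) (hq0 : 0 < q) (hq1 : q < 1) :
    Summable fun n : ℕ => hyperbolicCoeff L n * ((n : ℝ) + 1) * q ^ n := by
  refine summable_of_ratio_test_tendsto_lt_one hq1 (Filter.Eventually.of_forall fun n => ?_) ?_
  · have := hyperbolicCoeff_pos hL n
    positivity
  · have h3 : Filter.Tendsto (fun n : ℕ => Real.sqrt ((L + n) / (n + 1)) *
        (1 + 1 / ((n : ℝ) + 1)) * q) Filter.atTop (nhds (1 * (1 + 0) * q)) :=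
      ((tendsto_sqrt_div L).mul (tendsto_one_div_add_atTop_nhds_zero_nat.const_add 1)).mul_const q
    rw [add_zero, one_mul, one_mul] at h3
    refine h3.congr fun n => ?_
    have hc := hyperbolicCoeff_pos hL n
    rw [hyperbolicCoeff_succ hL, Real.norm_eq_abs, Real.norm_eq_abs, abs_of_pos (by positivity),
      abs_of_nonneg (by positivity)]
    push_cast
    field_simp
    ring

/-- For `L < 1` the coefficients decrease, but `k * hyperbolicCoeff L k` is increasing for every `L
> 0`. Earlier coefficients thus exceed later ones by at most a linear factor; `min 1 L` handles the
index `0`. -/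
theorem hyperbolicCoeff_le_mul {L : ℝ} (hL : 0 < L) {n m : ℕ} (hnm : n ≤ m) (hm : 1 ≤ m) :
    hyperbolicCoeff L n ≤ (m / min 1 L) * hyperbolicCoeff L m := by
  have hl : 0 < min 1 L := lt_min one_pos hL
  have key : ∀ k : ℕ, (min 1 L + k) * hyperbolicCoeff L k ≤ (k + 1 : ℕ) * hyperbolicCoeff L (k + 1) := by
    intro k
    -- A number in `[0, 1]` that is at most `y` is at most `√y`.
    have h1 : (min 1 L + k) / (k + 1) ≤ Real.sqrt ((L + k) / (k + 1)) := by
      have h2 : (min 1 L + k) / (k + 1) ≤ 1 := by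
        rw [div_le_one (by positivity)]
        linarith [min_le_left 1 L]
      have h3 : (min 1 L + k) / (k + 1) ≤ (L + k) / (k + 1) := by
        gcongr
        exact min_le_right _ _
      refine Real.le_sqrt_of_sq_le ?_
      have h4 : 0 ≤ (min 1 L + k) / (k + 1) := by positivity
      nlinarith
    rw [hyperbolicCoeff_succ hL]
    rw [div_le_iff₀ (by positivity)] at h1
    push_cast
    nlinarith [hyperbolicCoeff_pos hL k]
  have hmono : Monotone fun k : ℕ => (k : ℝ) * hyperbolicCoeff L k := by
    refine monotone_nat_of_le_succ fun k => le_trans ?_ (key k)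
    have := hyperbolicCoeff_pos hL k
    gcongr
    linarith
  rw [div_mul_eq_mul_div, le_div_iff₀ hl]
  have hcn := hyperbolicCoeff_pos hL n
  rcases Nat.eq_zero_or_pos n with rfl | hn
  · have h1 := key 0
    have h2 := hmono hm
    simp only [Nat.cast_zero, add_zero, zero_add, Nat.cast_one, one_mul] at h1 h2
    linarith
  · have h1 := hmono hnm
    have h2 : (1 : ℝ) ≤ n := by exact_mod_cast hn
    simp only at h1
    nlinarith [min_le_left 1 L]

/-! ### Gaussian probabilities -/

theorem integral_comp_norm_complex (f : ℝ → ℝ) :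
    ∫ z : ℂ, f ‖z‖ = 2 * Real.pi * ∫ y in Set.Ioi (0 : ℝ), y * f y := by
  rw [integral_fun_norm_addHaar (volume : Measure ℂ) f]
  simp only [Complex.finrank_real_complex, Nat.add_one_sub_one, pow_one, smul_eq_mul, Measure.real,
    Complex.volume_ball]
  simp [NNReal.coe_real_pi]
  ring

theorem integrable_comp_norm_complex {f : ℝ → ℝ} :
    Integrable (fun z : ℂ => f ‖z‖) ↔ IntegrableOn (fun y => y * f y) (Set.Ioi 0) := by
  rw [integrable_fun_norm_addHaar (volume : Measure ℂ)]
  simp [Complex.finrank_real_complex]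

theorem hasDerivAt_neg_exp_neg_sq (y : ℝ) :
    HasDerivAt (fun y : ℝ => -Real.exp (-y ^ 2) / 2) (y * Real.exp (-y ^ 2)) y := by
  have h1 : HasDerivAt (fun y : ℝ => -y ^ 2) (-(2 * y)) y := by
    simpa using (hasDerivAt_pow 2 y).fun_neg
  refine ((h1.exp.neg).div_const 2).congr_deriv ?_
  ring

theorem tendsto_neg_exp_neg_sq :
    Filter.Tendsto (fun y : ℝ => -Real.exp (-y ^ 2) / 2) Filter.atTop (nhds 0) := by
  have h1 : Filter.Tendsto (fun y : ℝ => Real.exp (-y ^ 2)) Filter.atTop (nhds 0) :=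
    Real.tendsto_exp_neg_atTop_nhds_zero.comp (Filter.tendsto_pow_atTop (by norm_num))
  simpa using h1.neg.div_const 2

theorem integrableOn_mul_exp_neg_sq {x : ℝ} (hx : 0 ≤ x) :
    IntegrableOn (fun y : ℝ => y * Real.exp (-y ^ 2)) (Set.Ioi x) :=
  integrableOn_Ioi_deriv_of_nonneg' (fun y _ => hasDerivAt_neg_exp_neg_sq y)
    (fun _ hy => mul_nonneg (hx.trans hy.le) (Real.exp_nonneg _)) tendsto_neg_exp_neg_sq

theorem integral_Ioi_mul_exp_neg_sq {x : ℝ} (hx : 0 ≤ x) :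
    ∫ y in Set.Ioi x, y * Real.exp (-y ^ 2) = Real.exp (-x ^ 2) / 2 := by
  rw [integral_Ioi_of_hasDerivAt_of_tendsto' (fun y _ => hasDerivAt_neg_exp_neg_sq y)
    (integrableOn_mul_exp_neg_sq hx) tendsto_neg_exp_neg_sq]
  ring

/-- In polar coordinates the radial density `2 y exp (-y²)` has an explicit primitive. The case `x =
0` also shows that the law has total mass one. -/
theorem stdComplexGaussian_setOf_le_norm {x : ℝ} (hx : 0 ≤ x) :
    stdComplexGaussian {z | x ≤ ‖z‖} = ENNReal.ofReal (Real.exp (-x ^ 2)) := by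
  have hms : MeasurableSet {z : ℂ | x ≤ ‖z‖} := measurableSet_le measurable_const measurable_norm
  set f : ℝ → ℝ := (Set.Ici x).indicator fun y => Real.pi⁻¹ * Real.exp (-y ^ 2) with hf
  have hf0 : ∀ y, 0 ≤ f y := fun y => Set.indicator_nonneg (fun _ _ => by positivity) y
  have hind : (fun y => y * f y)
      = (Set.Ici x).indicator fun y => Real.pi⁻¹ * (y * Real.exp (-y ^ 2)) := by
    funext y
    simp only [hf, Set.indicator]
    split_ifs <;> ring
  have hae : (Set.Ioi (0 : ℝ) ∩ Set.Ici x : Set ℝ) =ᵐ[volume] (Set.Ioi x : Set ℝ) := by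
    rcases hx.eq_or_lt with rfl | hx
    · rw [Set.inter_eq_left.2 Set.Ioi_subset_Ici_self]
      exact Filter.EventuallyEq.refl _ _
    · rw [Set.inter_eq_right.2 (Set.Ici_subset_Ioi.2 hx)]
      exact Ioi_ae_eq_Ici.symm
  have hint : Integrable (fun z : ℂ => f ‖z‖) := by
    rw [integrable_comp_norm_complex, hind, integrableOn_indicator_iff measurableSet_Ici, Set.inter_comm,
      integrableOn_congr_set_ae hae]
    exact (integrableOn_mul_exp_neg_sq hx).const_mul _
  rw [stdComplexGaussian, withDensity_apply _ hms, ← lintegral_indicator hms]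
  have h1 : ∀ z : ℂ, ({z : ℂ | x ≤ ‖z‖}.indicator
      (fun z : ℂ => ENNReal.ofReal (Real.pi⁻¹ * Real.exp (-‖z‖ ^ 2))) z) = ENNReal.ofReal (f ‖z‖) := by
    intro z
    simp only [hf, Set.indicator, Set.mem_ofPred_eq, Set.mem_Ici]
    split_ifs <;> simp
  simp only [h1]
  rw [← ofReal_integral_eq_lintegral_ofReal hint (Filter.Eventually.of_forall fun z => hf0 _),
    integral_comp_norm_complex, hind, setIntegral_indicator measurableSet_Ici,
    setIntegral_congr_set hae, integral_const_mul, integral_Ioi_mul_exp_neg_sq hx]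
  congr 1
  have := Real.pi_ne_zero
  field_simp

instance isProbabilityMeasure_stdComplexGaussian : IsProbabilityMeasure stdComplexGaussian where
  measure_univ := by
    have := stdComplexGaussian_setOf_le_norm le_rfl
    simpa using this

theorem stdComplexGaussian_real_setOf_le_norm {x : ℝ} (hx : 0 ≤ x) :
    stdComplexGaussian.real {z | x ≤ ‖z‖} = Real.exp (-x ^ 2) := by
  rw [Measure.real, stdComplexGaussian_setOf_le_norm hx, ENNReal.toReal_ofReal (Real.exp_nonneg _)]

theorem stdComplexGaussian_absolutelyContinuous : stdComplexGaussian ≪ volume :=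
  withDensity_absolutelyContinuous _ _

theorem stdComplexGaussian_sphere (x : ℝ) : stdComplexGaussian {z | ‖z‖ = x} = 0 := by
  refine stdComplexGaussian_absolutelyContinuous ?_
  have : {z : ℂ | ‖z‖ = x} = Metric.sphere 0 x := by
    ext z
    simp
  rw [this]
  exact Measure.addHaar_sphere _ _ _

theorem stdComplexGaussian_real_setOf_norm_le {x : ℝ} (hx : 0 ≤ x) :
    stdComplexGaussian.real {z | ‖z‖ ≤ x} = 1 - Real.exp (-x ^ 2) := by
  have h1 : stdComplexGaussian.real {z | ‖z‖ ≤ x} = stdComplexGaussian.real {z | x ≤ ‖z‖}ᶜ := by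
    refine measureReal_congr ?_
    have h2 : ∀ᵐ z ∂stdComplexGaussian, ‖z‖ ≠ x := by
      rw [ae_iff]
      simpa using stdComplexGaussian_sphere x
    filter_upwards [h2] with z hz
    apply propext
    change ‖z‖ ≤ x ↔ ¬ (x ≤ ‖z‖)
    rw [not_le]
    exact ⟨fun h => lt_of_le_of_ne h hz, le_of_lt⟩
  rw [h1, probReal_compl_eq_one_sub (measurableSet_le measurable_const measurable_norm),
    stdComplexGaussian_real_setOf_le_norm hx]

theorem stdComplexGaussian_real_setOf_norm_le_le {x : ℝ} (hx : 0 ≤ x) :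
    stdComplexGaussian.real {z | ‖z‖ ≤ x} ≤ x ^ 2 := by
  rw [stdComplexGaussian_real_setOf_norm_le hx]
  linarith [Real.add_one_le_exp (-x ^ 2)]

theorem half_sq_le_stdComplexGaussian_real {x : ℝ} (hx : 0 ≤ x) (hx1 : x ≤ 1) :
    x ^ 2 / 2 ≤ stdComplexGaussian.real {z | ‖z‖ ≤ x} := by
  rw [stdComplexGaussian_real_setOf_norm_le hx]
  have h1 : Real.exp (-x ^ 2) ≤ 1 / (1 + x ^ 2) := by
    rw [Real.exp_neg, ← one_div]
    exact one_div_le_one_div_of_le (by positivity) (by linarith [Real.add_one_le_exp (x ^ 2)])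
  have h2 : 1 / (1 + x ^ 2) ≤ 1 - x ^ 2 / 2 := by
    rw [div_le_iff₀ (by positivity)]
    nlinarith [pow_le_one₀ hx hx1 (n := 2), sq_nonneg x]
  linarith

/-! ### Gaussian sequences and events in sequence space -/

/-- The law of a sequence of independent standard complex Gaussian variables. -/
noncomputable def gaussianSeq : Measure (ℕ → ℂ) := Measure.infinitePi fun _ => stdComplexGaussian

instance isProbabilityMeasure_gaussianSeq : IsProbabilityMeasure gaussianSeq := by
  unfold gaussianSeq
  infer_instance

theorem IsIIDStdComplexGaussian.hasLaw_gaussianSeq {Ω : Type*} [MeasurableSpace Ω] {P : Measure Ω}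
    {a : ℕ → Ω → ℂ} (h : IsIIDStdComplexGaussian P a) :
    HasLaw (fun ω n => a n ω) gaussianSeq P :=
  h.indep.hasLaw_infinitePi h.hasLaw (aemeasurable_pi_iff.2 fun n => (h.hasLaw n).aemeasurable)

/-- The overcrowding event is not known to be measurable, so its outer probability is compared with
that of a measurable hull in sequence space. This transfers all work from `Ω` to `gaussianSeq`, up
to null sets. -/
theorem overcrowdingProb_le {Ω : Type*} [MeasurableSpace Ω] {P : Measure Ω} [IsProbabilityMeasure P]
    {a : ℕ → Ω → ℂ} (h : IsIIDStdComplexGaussian P a) {L r : ℝ} {m : ℕ} {A : Set (ℕ → ℂ)}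
    (hA : ∀ᵐ x ∂gaussianSeq, (m : ℕ∞) ≤ zeroCount (hyperbolicGAF L x) r → x ∈ A) :
    overcrowdingProb P a L r m ≤ gaussianSeq.real A := by
  have hlaw := h.hasLaw_gaussianSeq
  set B : Set (ℕ → ℂ) := toMeasurable gaussianSeq A with hB
  have hBm : MeasurableSet B := measurableSet_toMeasurable _ _
  have h1 : gaussianSeq.real A = P.real ((fun ω n => a n ω) ⁻¹' B) := by
    rw [Measure.real, Measure.real, ← measure_toMeasurable, ← hB, ← hlaw.map_eq,
      Measure.map_apply_of_aemeasurable hlaw.aemeasurable hBm]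
  rw [h1, overcrowdingProb, Measure.real, Measure.real]
  refine ENNReal.toReal_mono (measure_ne_top _ _) (measure_mono_ae ?_)
  rw [← hlaw.map_eq] at hA
  filter_upwards [ae_of_ae_map hlaw.aemeasurable hA] with ω hω h2
  exact subset_toMeasurable _ _ (hω h2)

theorem le_overcrowdingProb {Ω : Type*} [MeasurableSpace Ω] {P : Measure Ω} [IsProbabilityMeasure P]
    {a : ℕ → Ω → ℂ} (h : IsIIDStdComplexGaussian P a) {L r : ℝ} {m : ℕ} {A : Set (ℕ → ℂ)}
    (hAm : MeasurableSet A)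
    (hA : ∀ᵐ x ∂gaussianSeq, x ∈ A → (m : ℕ∞) ≤ zeroCount (hyperbolicGAF L x) r) :
    gaussianSeq.real A ≤ overcrowdingProb P a L r m := by
  have hlaw := h.hasLaw_gaussianSeq
  have h1 : gaussianSeq.real A = P.real ((fun ω n => a n ω) ⁻¹' A) := by
    rw [Measure.real, Measure.real, ← hlaw.map_eq,
      Measure.map_apply_of_aemeasurable hlaw.aemeasurable hAm]
  rw [h1, overcrowdingProb, Measure.real, Measure.real]
  refine ENNReal.toReal_mono (measure_ne_top _ _) (measure_mono_ae ?_)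
  rw [← hlaw.map_eq] at hA
  filter_upwards [ae_of_ae_map hlaw.aemeasurable hA] with ω hω h2
  exact hω h2

theorem gaussianSeq_real_box (s : Finset ℕ) {t : ℕ → Set ℂ} (ht : ∀ n, MeasurableSet (t n)) :
    gaussianSeq.real {x | ∀ n ∈ s, x n ∈ t n} = ∏ n ∈ s, stdComplexGaussian.real (t n) := by
  have h := Measure.infinitePi_pi (fun _ : ℕ => stdComplexGaussian) (s := s) (t := t) fun n _ => ht n
  rw [Measure.real, gaussianSeq]
  simp only [Measure.real]
  rw [← ENNReal.toReal_prod, ← h]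
  rfl

theorem measurableSet_forall_mem {t : ℕ → Set ℂ} (ht : ∀ n, MeasurableSet (t n)) :
    MeasurableSet {x : ℕ → ℂ | ∀ n, x n ∈ t n} := by
  rw [Set.ofPred_forall]
  exact MeasurableSet.iInter fun n => measurable_pi_apply n (ht n)

/-- An infinite box is the decreasing intersection of finite-dimensional boxes, so continuity from
above applies. -/
theorem le_gaussianSeq_real_box {t : ℕ → Set ℂ} (ht : ∀ n, MeasurableSet (t n)) {c : ℝ} {N₀ : ℕ}
    (hc : ∀ N, N₀ ≤ N → c ≤ ∏ n ∈ Finset.range N, stdComplexGaussian.real (t n)) :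
    c ≤ gaussianSeq.real {x | ∀ n, x n ∈ t n} := by
  have hset : {x : ℕ → ℂ | ∀ n, x n ∈ t n} = ⋂ N : ℕ, {x | ∀ n ∈ Finset.range N, x n ∈ t n} := by
    ext x
    simp only [Set.mem_ofPred_eq, Set.mem_iInter, Finset.mem_range]
    exact ⟨fun h N n _ => h n, fun h n => h (n + 1) n n.lt_succ_self⟩
  have hm : ∀ N : ℕ, MeasurableSet {x : ℕ → ℂ | ∀ n ∈ Finset.range N, x n ∈ t n} := by
    intro N
    simp only [Set.ofPred_forall]
    exact MeasurableSet.iInter fun n => MeasurableSet.iInter fun _ => measurable_pi_apply n (ht n)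
  have hlim := tendsto_measure_iInter_atTop (μ := gaussianSeq) (fun N => (hm N).nullMeasurableSet)
    (fun M N hMN x hx n hn => hx n (Finset.range_mono hMN hn)) ⟨0, measure_ne_top _ _⟩
  rw [← hset] at hlim
  have hlim2 := (ENNReal.tendsto_toReal (measure_ne_top _ _)).comp hlim
  refine ge_of_tendsto hlim2 ?_
  filter_upwards [Filter.eventually_ge_atTop N₀] with N hN
  exact (hc N hN).trans (gaussianSeq_real_box (Finset.range N) ht).ge

/-- Weierstrass's product inequality; with `sum_exp_neg_sq_le_half` it keeps the probability of the
tail constraints above `1 / 2`. -/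
theorem one_sub_sum_le_prod_one_sub {ι : Type*} (s : Finset ι) {e : ι → ℝ} (h0 : ∀ i, 0 ≤ e i)
    (h1 : ∀ i, e i ≤ 1) : 1 - ∑ i ∈ s, e i ≤ ∏ i ∈ s, (1 - e i) := by
  classical
  induction s using Finset.induction with
  | empty => simp
  | insert i s hi ih =>
    rw [Finset.sum_insert hi, Finset.prod_insert hi]
    have h2 : ∏ i ∈ s, (1 - e i) ≤ 1 :=
      Finset.prod_le_one (fun j _ => by linarith [h1 j]) (fun j _ => by linarith [h0 j])
    nlinarith [h0 i, h1 i]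

theorem sum_exp_neg_sq_le_half (J : ℕ) :
    ∑ j ∈ Finset.range J, Real.exp (-((j : ℝ) + 2) ^ 2) ≤ 1 / 2 := by
  have h1 : ∀ j : ℕ, Real.exp (-((j : ℝ) + 2) ^ 2) ≤ (1 / 2) ^ j * (1 / 4) := by
    intro j
    have h2 : Real.exp (-1) ≤ 1 / 2 := by
      rw [Real.exp_neg, ← one_div]
      exact one_div_le_one_div_of_le (by norm_num) (by linarith [Real.add_one_le_exp (1 : ℝ)])
    calc Real.exp (-((j : ℝ) + 2) ^ 2) ≤ Real.exp (((j + 2 : ℕ) : ℝ) * (-1)) := by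
          refine Real.exp_le_exp.2 ?_
          push_cast
          nlinarith [Nat.cast_nonneg (α := ℝ) j]
      _ = Real.exp (-1) ^ (j + 2) := by rw [Real.exp_nat_mul]
      _ ≤ (1 / 2) ^ (j + 2) := by gcongr
      _ = _ := by ring
  calc _ ≤ ∑ j ∈ Finset.range J, (1 / 2 : ℝ) ^ j * (1 / 4) := Finset.sum_le_sum fun j _ => h1 j
    _ = (∑ j ∈ Finset.range J, (1 / 2 : ℝ) ^ j) * (1 / 4) := by rw [Finset.sum_mul]
    _ ≤ 2 * (1 / 4) := by
      gcongr
      have := geom_sum_eq (by norm_num : (1 / 2 : ℝ) ≠ 1) J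
      rw [this]
      have : (0 : ℝ) < (1 / 2) ^ J := by positivity
      norm_num
      linarith
    _ = _ := by norm_num

/-- The Gaussian coefficients are unlikely to exceed a multiple of a linear function. -/
theorem gaussianSeq_real_exists_lt {T : ℝ} (hT : 1 ≤ T) :
    gaussianSeq.real {x | ∃ n : ℕ, T * ((n : ℝ) + 1) < ‖x n‖} ≤ 2 * Real.exp (-T ^ 2) := by
  have h1 : ∀ n : ℕ, gaussianSeq {x | T * ((n : ℝ) + 1) < ‖x n‖}
      ≤ ENNReal.ofReal ((1 / 2) ^ n * Real.exp (-T ^ 2)) := by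
    intro n
    have hms : MeasurableSet {z : ℂ | T * ((n : ℝ) + 1) ≤ ‖z‖} :=
      measurableSet_le measurable_const measurable_norm
    calc gaussianSeq {x | T * ((n : ℝ) + 1) < ‖x n‖}
        ≤ gaussianSeq ((fun x => x n) ⁻¹' {z | T * ((n : ℝ) + 1) ≤ ‖z‖}) :=
          measure_mono fun x hx => by
            simp only [Set.mem_preimage, Set.mem_ofPred_eq] at hx ⊢
            exact hx.le
      _ = stdComplexGaussian {z | T * ((n : ℝ) + 1) ≤ ‖z‖} :=
          (measurePreserving_eval_infinitePi (fun _ : ℕ => stdComplexGaussian) n).measure_preimage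
            hms.nullMeasurableSet
      _ = ENNReal.ofReal (Real.exp (-(T * ((n : ℝ) + 1)) ^ 2)) :=
          stdComplexGaussian_setOf_le_norm (by positivity)
      _ ≤ _ := by
        refine ENNReal.ofReal_le_ofReal ?_
        have h2 : Real.exp (-1) ≤ 1 / 2 := by
          rw [Real.exp_neg, ← one_div]
          exact one_div_le_one_div_of_le (by norm_num) (by linarith [Real.add_one_le_exp (1 : ℝ)])
        calc Real.exp (-(T * ((n : ℝ) + 1)) ^ 2) ≤ Real.exp ((n : ℝ) * (-1) + -T ^ 2) := by
              refine Real.exp_le_exp.2 ?_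
              have hn : (0 : ℝ) ≤ n := Nat.cast_nonneg n
              have hT2 : 1 ≤ T ^ 2 := one_le_pow₀ hT
              have : (T * ((n : ℝ) + 1)) ^ 2 = T ^ 2 + T ^ 2 * (n ^ 2 + 2 * n) := by ring
              nlinarith [mul_nonneg (sub_nonneg.2 hT2) (by positivity : (0 : ℝ) ≤ n ^ 2 + 2 * n)]
          _ = Real.exp (-1) ^ n * Real.exp (-T ^ 2) := by rw [Real.exp_add, Real.exp_nat_mul]
          _ ≤ _ := by gcongr
  have h2 : gaussianSeq {x | ∃ n : ℕ, T * ((n : ℝ) + 1) < ‖x n‖}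
      ≤ ENNReal.ofReal (2 * Real.exp (-T ^ 2)) := by
    rw [Set.ofPred_exists]
    refine (measure_iUnion_le _).trans ((ENNReal.tsum_le_tsum h1).trans (le_of_eq ?_))
    have hs : Summable fun n : ℕ => (1 / 2 : ℝ) ^ n * Real.exp (-T ^ 2) :=
      summable_geometric_two.mul_right _
    rw [← ENNReal.ofReal_tsum_of_nonneg (fun n => by positivity) hs, tsum_mul_right, tsum_geometric_two]
  exact ENNReal.toReal_le_of_le_ofReal (by positivity) h2

/-! ### The lower bound for general `L` -/

theorem summable_hyperbolicGAF {L T R : ℝ} (hL : 0 < L) (hR0 : 0 < R) (hR1 : R < 1) {a : ℕ → ℂ}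
    (ha : ∀ n, ‖a n‖ ≤ T * ((n : ℝ) + 1)) :
    Summable fun n => ‖(hyperbolicCoeff L n : ℂ) * a n‖ * R ^ n := by
  refine Summable.of_nonneg_of_le (fun n => by positivity) (fun n => ?_)
    ((summable_hyperbolicCoeff hL hR0 hR1).mul_left T)
  have hc := hyperbolicCoeff_pos hL n
  rw [norm_mul, Complex.norm_real, Real.norm_eq_abs, abs_of_pos hc]
  calc hyperbolicCoeff L n * ‖a n‖ * R ^ n
      ≤ hyperbolicCoeff L n * (T * ((n : ℝ) + 1)) * R ^ n := by
        gcongr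
        exact ha n
    _ = _ := by ring

theorem prod_pow_two_mul_sub (r : ℝ) (m : ℕ) :
    ∏ n ∈ Finset.range m, r ^ (2 * (m - n)) = r ^ (m * (m + 1)) := by
  induction m with
  | zero => simp
  | succ m ih =>
    rw [Finset.prod_range_succ']
    simp only [Nat.add_sub_add_right, ih, Nat.sub_zero]
    ring

/-- Terms linear in `m` in the exponent are absorbed into `m * log m` by `log m ≥ log 2`. This fails
at `m = 1`, where `log m = 0`; the prefactor `l ^ 2 / 2 * r` makes that case hold. -/
theorem overcrowding_lower_constants {r l : ℝ} (hr0 : 0 < r) (hr1 : r < 1) (hl0 : 0 < l)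
    (hl1 : l ≤ 1) {m : ℕ} (hm : 1 ≤ m) :
    l ^ 2 / 2 * r * Real.exp (-((m : ℝ) ^ 2 * |Real.log r| +
      (4 + (Real.log (2 / l ^ 2) + |Real.log r|) / Real.log 2) * (m * Real.log m)))
      ≤ (l ^ 2 / (2 * (m : ℝ) ^ 4)) ^ m * r ^ (m * (m + 1)) := by
  have hlog2 : 0 < Real.log 2 := Real.log_pos one_lt_two
  have hlog : Real.log r < 0 := Real.log_neg hr0 hr1
  have habs : |Real.log r| = -Real.log r := abs_of_neg hlog
  have hm0 : (0 : ℝ) < m := by exact_mod_cast hm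
  have hr : r ^ (m * (m + 1)) = Real.exp (-((m : ℝ) * (m + 1) * |Real.log r|)) := by
    rw [habs, ← Real.rpow_natCast, Real.rpow_def_of_pos hr0]
    congr 1
    push_cast
    ring
  have hA : 0 ≤ Real.log (2 / l ^ 2) := by
    refine Real.log_nonneg ?_
    rw [le_div_iff₀ (by positivity)]
    nlinarith
  rcases hm.eq_or_lt with rfl | hm2
  · simp only [Nat.cast_one, Real.log_one, one_pow, mul_zero, add_zero, one_mul, mul_one, pow_one,
      Nat.reduceAdd]
    rw [habs, neg_neg, Real.exp_log hr0]
    nlinarith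
  · have h2 : Real.log 2 ≤ Real.log m := Real.log_le_log two_pos (by exact_mod_cast hm2)
    have hc : l ^ 2 / 2 * r ≤ 1 := by
      have : l ^ 2 ≤ 1 := by nlinarith
      nlinarith
    have hpow : (l ^ 2 / (2 * (m : ℝ) ^ 4)) ^ m
        = Real.exp (-(m * (Real.log (2 / l ^ 2) + 4 * Real.log m))) := by
      rw [← Real.rpow_natCast, Real.rpow_def_of_pos (by positivity)]
      congr 1
      have : l ^ 2 / (2 * (m : ℝ) ^ 4) = (2 / l ^ 2)⁻¹ * ((m : ℝ) ^ 4)⁻¹ := by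
        field_simp
      rw [this, Real.log_mul (by positivity) (by positivity), Real.log_inv, Real.log_inv, Real.log_pow]
      push_cast
      ring
    rw [hpow, hr, ← Real.exp_add]
    refine (mul_le_of_le_one_left (Real.exp_nonneg _) hc).trans (Real.exp_le_exp.2 ?_)
    set B := Real.log (2 / l ^ 2) + |Real.log r| with hB
    have hB0 : 0 ≤ B := add_nonneg hA (abs_nonneg _)
    have h3 : B * m ≤ B / Real.log 2 * (m * Real.log m) := by
      rw [div_mul_eq_mul_div, le_div_iff₀ hlog2]
      nlinarith [mul_le_mul_of_nonneg_left h2 (mul_nonneg hB0 hm0.le)]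
    nlinarith

/-- The event `A` is a box in which the `m`-th term of the series dominates on `|z| = r`. Being a
box, it has a product probability. -/
theorem exists_overcrowding_lower {L r : ℝ} (hL : 0 < L) (hr0 : 0 < r) (hr1 : r < 1) :
    ∃ C K : ℝ, 0 < C ∧ 0 ≤ K ∧ ∀ m : ℕ, 1 ≤ m → ∃ A : Set (ℕ → ℂ), MeasurableSet A ∧
      (∀ x ∈ A, (m : ℕ∞) ≤ zeroCount (hyperbolicGAF L x) r) ∧
      C * Real.exp (-((m : ℝ) ^ 2 * |Real.log r| + K * (m * Real.log m))) ≤ gaussianSeq.real A := by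
  have hL' : 0 < L + 1 := by linarith
  set l := min 1 L with hl
  have hl0 : 0 < l := lt_min one_pos hL
  have hl1 : l ≤ 1 := min_le_left _ _
  have hsum := summable_hyperbolicCoeff hL' hr0 hr1
  set S : ℝ := ∑' j : ℕ, hyperbolicCoeff (L + 1) j * ((j : ℝ) + 1) * r ^ j with hS
  have hS0 : 0 ≤ S := tsum_nonneg fun j => by
    have := hyperbolicCoeff_pos hL' j
    positivity
  refine ⟨l ^ 2 / 2 * r * (Real.exp (-(S + 2) ^ 2) * (1 / 2)),
    4 + (Real.log (2 / l ^ 2) + |Real.log r|) / Real.log 2, by positivity, ?_, fun m hm => ?_⟩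
  · have hA : 0 ≤ Real.log (2 / l ^ 2) := by
      refine Real.log_nonneg ?_
      rw [le_div_iff₀ (by positivity)]
      nlinarith
    have hlog2 : 0 < Real.log 2 := Real.log_pos one_lt_two
    positivity
  have hm0 : (0 : ℝ) < m := by exact_mod_cast hm
  have hm1 : (1 : ℝ) ≤ m := by exact_mod_cast hm
  -- One factor `1 / m`, together with `l`, offsets the loss `m / l` in `hyperbolicCoeff_le_mul`;
  -- the other leaves room to add up `m` such terms.
  set X : ℕ → ℝ := fun n => l / (m : ℝ) ^ 2 * r ^ (m - n) with hX
  have hX0 : ∀ n, 0 ≤ X n := fun n => by positivity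
  have hX1 : ∀ n, X n ≤ 1 := by
    intro n
    have h1 : l / (m : ℝ) ^ 2 ≤ 1 := by
      rw [div_le_one (by positivity)]
      exact hl1.trans (one_le_pow₀ hm1)
    exact mul_le_one₀ h1 (by positivity) (pow_le_one₀ hr0.le hr1.le)
  -- Relative to the scale `hyperbolicCoeff L m * r ^ m`, the terms below `m` contribute at most `1`
  -- and those above at most `S`, so `S + 2` secures strict domination. The tail bound `j + 2` makes
  -- the failure probabilities sum to at most `1 / 2`.
  set t : ℕ → Set ℂ := fun n => if n < m then {z | ‖z‖ ≤ X n} else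
    if n = m then {z | S + 2 ≤ ‖z‖} else {z | ‖z‖ ≤ ((n - (m + 1) : ℕ) : ℝ) + 2} with ht
  have htm : ∀ n, MeasurableSet (t n) := by
    intro n
    simp only [ht]
    split_ifs
    · exact measurableSet_le measurable_norm measurable_const
    · exact measurableSet_le measurable_const measurable_norm
    · exact measurableSet_le measurable_norm measurable_const
  refine ⟨{x | ∀ n, x n ∈ t n}, measurableSet_forall_mem htm, ?_, ?_⟩
  · intro x hx
    have hlt : ∀ n, n < m → ‖x n‖ ≤ X n := fun n hn => by
      have := hx n
      simpa [ht, hn] using this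
    have heq : S + 2 ≤ ‖x m‖ := by
      have := hx m
      simpa [ht] using this
    have hgt : ∀ j, ‖x (m + (j + 1))‖ ≤ (j : ℝ) + 2 := fun j => by
      have := hx (m + (j + 1))
      have h1 : ¬ (m + (j + 1) < m) := by omega
      have h2 : ¬ (m + (j + 1) = m) := by omega
      have h3 : m + (j + 1) - (m + 1) = j := by omega
      simp only [ht, h1, h2, if_false, h3, Set.mem_ofPred_eq] at this
      exact this
    have hgrow : ∀ n, ‖x n‖ ≤ (1 + ‖x m‖) * ((n : ℝ) + 1) := by
      intro n
      have hn0 : (0 : ℝ) ≤ n := Nat.cast_nonneg n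
      have hxm := norm_nonneg (x m)
      rcases lt_trichotomy n m with h | h | h
      · have := (hlt n h).trans (hX1 n)
        nlinarith [mul_nonneg hxm hn0]
      · subst h
        nlinarith [mul_nonneg hxm hn0]
      · obtain ⟨j, rfl⟩ : ∃ j, n = m + (j + 1) := ⟨n - m - 1, by omega⟩
        have := hgt j
        push_cast at hn0 ⊢
        nlinarith [mul_nonneg hxm hn0]
    set R := (r + 1) / 2 with hR
    have hrR : r < R := by simp only [hR]; linarith
    have hR1 : R < 1 := by simp only [hR]; linarith
    refine le_of_eq (Eq.symm (zeroCount_powerSeries_of_dominant hr0 hrR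
      (summable_hyperbolicGAF hL (hr0.trans hrR) hR1 hgrow) m ?_))
    have hcm := hyperbolicCoeff_pos hL m
    set G := hyperbolicCoeff L m * r ^ m with hG
    have hG0 : 0 < G := by positivity
    -- The majorant includes an unneeded term at `n = m`, so that its part from `m` on is exactly
    -- `G` times the series defining `S`.
    set u : ℕ → ℝ := fun n => if n < m then G / m else
      G * (hyperbolicCoeff (L + 1) (n - m) * (((n - m : ℕ) : ℝ) + 1) * r ^ (n - m)) with hu
    have hu1 : (fun j => u (j + m)) = fun j =>
        G * (hyperbolicCoeff (L + 1) j * ((j : ℝ) + 1) * r ^ j) := by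
      funext j
      simp [hu]
    have hus : Summable u := by
      rw [← summable_nat_add_iff m, hu1]
      exact hsum.mul_left G
    have htsum : ∑' n, u n = G + G * S := by
      rw [← hus.sum_add_tsum_nat_add m, hu1, tsum_mul_left]
      congr 1
      rw [Finset.sum_congr rfl (g := fun _ => G / m) fun n hn => by simp [hu, Finset.mem_range.1 hn]]
      rw [Finset.sum_const, Finset.card_range, nsmul_eq_mul]
      field_simp
    have hle : ∀ n, (if n = m then 0 else ‖(hyperbolicCoeff L n : ℂ) * x n‖ * r ^ n) ≤ u n := by
      intro n
      have hcn := hyperbolicCoeff_pos hL n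
      rw [norm_mul, Complex.norm_real, Real.norm_eq_abs, abs_of_pos hcn]
      rcases lt_trichotomy n m with h | h | h
      · simp only [hu, h, h.ne, if_true, if_false]
        calc hyperbolicCoeff L n * ‖x n‖ * r ^ n
            ≤ (m / l * hyperbolicCoeff L m) * (l / (m : ℝ) ^ 2 * r ^ (m - n)) * r ^ n := by
              gcongr
              · exact hyperbolicCoeff_le_mul hL h.le hm
              · exact hlt n h
          _ = hyperbolicCoeff L m / m * (r ^ (m - n) * r ^ n) := by field_simp
          _ = G / m := by
            rw [← pow_add, Nat.sub_add_cancel h.le, hG]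
            ring
      · simp only [h, if_true, hu, lt_irrefl, if_false, Nat.sub_self]
        have := hyperbolicCoeff_pos hL' 0
        positivity
      · obtain ⟨j, rfl⟩ : ∃ j, n = m + (j + 1) := ⟨n - m - 1, by omega⟩
        have h1 : ¬ (m + (j + 1) < m) := by omega
        have h2 : ¬ (m + (j + 1) = m) := by omega
        have h3 : m + (j + 1) - m = j + 1 := by omega
        simp only [hu, h1, h2, if_false, h3]
        calc hyperbolicCoeff L (m + (j + 1)) * ‖x (m + (j + 1))‖ * r ^ (m + (j + 1))
            ≤ (hyperbolicCoeff L m * hyperbolicCoeff (L + 1) (j + 1)) * ((j : ℝ) + 2) *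
                r ^ (m + (j + 1)) := by
              have := hyperbolicCoeff_pos hL' (j + 1)
              gcongr
              · exact hyperbolicCoeff_add_le hL m (j + 1)
              · exact hgt j
          _ = _ := by
            rw [hG, pow_add]
            push_cast
            ring
    have hnn : ∀ n, 0 ≤ (if n = m then 0 else ‖(hyperbolicCoeff L n : ℂ) * x n‖ * r ^ n) := by
      intro n
      split_ifs <;> positivity
    calc _ ≤ ∑' n, u n := (Summable.of_nonneg_of_le hnn hle hus).tsum_le_tsum hle hus
      _ = G + G * S := htsum
      _ < G * (S + 2) := by nlinarith
      _ ≤ G * ‖x m‖ := by gcongr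
      _ = _ := by
        rw [norm_mul, Complex.norm_real, Real.norm_eq_abs, abs_of_pos hcm]
        ring
  · refine le_gaussianSeq_real_box htm (N₀ := m + 1) fun N hN => ?_
    obtain ⟨J, rfl⟩ := Nat.exists_eq_add_of_le hN
    rw [Finset.prod_range_add, Finset.prod_range_succ]
    have h1 : (l ^ 2 / (2 * (m : ℝ) ^ 4)) ^ m * r ^ (m * (m + 1))
        ≤ ∏ n ∈ Finset.range m, stdComplexGaussian.real (t n) := by
      have hconst : (l ^ 2 / (2 * (m : ℝ) ^ 4)) ^ m
          = ∏ _n ∈ Finset.range m, l ^ 2 / (2 * (m : ℝ) ^ 4) := by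
        rw [Finset.prod_const, Finset.card_range]
      rw [← prod_pow_two_mul_sub, hconst, ← Finset.prod_mul_distrib]
      refine Finset.prod_le_prod (fun n _ => by positivity) fun n hn => ?_
      simp only [ht, Finset.mem_range.1 hn, if_true]
      refine le_trans (le_of_eq ?_) (half_sq_le_stdComplexGaussian_real (hX0 n) (hX1 n))
      simp only [hX]
      rw [pow_mul']
      ring
    have h2 : stdComplexGaussian.real (t m) = Real.exp (-(S + 2) ^ 2) := by
      simp only [ht, lt_irrefl, if_false, if_true]
      exact stdComplexGaussian_real_setOf_le_norm (by positivity)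
    have h3 : 1 / 2 ≤ ∏ j ∈ Finset.range J, stdComplexGaussian.real (t (m + 1 + j)) := by
      have h4 : ∀ j ∈ Finset.range J, stdComplexGaussian.real (t (m + 1 + j))
          = 1 - Real.exp (-((j : ℝ) + 2) ^ 2) := by
        intro j _
        have h1 : ¬ (m + 1 + j < m) := by omega
        have h2 : ¬ (m + 1 + j = m) := by omega
        have h3 : m + 1 + j - (m + 1) = j := by omega
        simp only [ht, h1, h2, if_false, h3]
        exact stdComplexGaussian_real_setOf_norm_le (by positivity)
      rw [Finset.prod_congr rfl h4]
      refine le_trans ?_ (one_sub_sum_le_prod_one_sub _ (fun j => Real.exp_nonneg _)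
        (fun j => Real.exp_le_one_iff.2 (by nlinarith [sq_nonneg ((j : ℝ) + 2)])))
      linarith [sum_exp_neg_sq_le_half J]
    have h4 := overcrowding_lower_constants hr0 hr1 hl0 hl1 hm
    rw [h2]
    calc _ = l ^ 2 / 2 * r * Real.exp (-((m : ℝ) ^ 2 * |Real.log r| +
          (4 + (Real.log (2 / l ^ 2) + |Real.log r|) / Real.log 2) * (m * Real.log m))) *
          Real.exp (-(S + 2) ^ 2) * (1 / 2) := by ring
      _ ≤ _ := mul_le_mul (mul_le_mul_of_nonneg_right (h4.trans h1) (Real.exp_nonneg _)) h3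
        (by norm_num) (mul_nonneg (Finset.prod_nonneg fun _ _ => measureReal_nonneg)
          (Real.exp_nonneg _))

/-! ### The upper bound for general `L` -/

theorem eventually_quadratic_le_inv_pow {θ : ℝ} (h0 : 0 < θ) (h1 : θ < 1) :
    ∀ᶠ m : ℕ in Filter.atTop, (m : ℝ) ^ 2 ≤ ((θ ^ (4 * m))⁻¹) ^ 2 := by
  have h2 : Filter.Tendsto (fun m : ℕ => (m : ℝ) * (θ ^ 4) ^ m) Filter.atTop (nhds 0) :=
    tendsto_self_mul_const_pow_of_lt_one (by positivity) (pow_lt_one₀ h0.le h1 (by norm_num))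
  filter_upwards [h2.eventually_le_const one_pos] with m hm
  have h3 : (m : ℝ) ≤ (θ ^ (4 * m))⁻¹ := by
    rw [← one_div, le_div_iff₀ (by positivity), pow_mul]
    exact hm
  gcongr

/-- When there are many zeros, one coefficient is very large or many coefficients are small. -/
theorem norm_le_of_le_zeroCount_hyperbolicGAF {L r θ : ℝ} (hL : 0 < L) (hr0 : 0 < r)
    {ρ R : ℝ} (hρ : r < ρ) (hρR : ρ < R) (hR1 : R < 1) (hθ0 : 0 < θ)
    (hθ : blaschkeFactor r ρ = θ ^ 8) {d : ℕ} (hθd : θ ^ d ≤ r) {m : ℕ} (hm : 1 ≤ m)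
    (hbig : (∑' n : ℕ, hyperbolicCoeff L n * ((n : ℝ) + 1) * R ^ n) / min 1 L * (m * θ ^ m) ≤ 1)
    {x : ℕ → ℂ} (hx : ∀ n : ℕ, ‖x n‖ ≤ (θ ^ (4 * m))⁻¹ * ((n : ℝ) + 1))
    (hz : (m : ℕ∞) ≤ zeroCount (hyperbolicGAF L x) r) {n : ℕ} (hn : d * n ≤ m) (hnm : n ≤ m) :
    ‖x n‖ ≤ θ ^ (2 * m) := by
  have hl0 : 0 < min 1 L := lt_min one_pos hL
  have hR0 : 0 < R := hr0.trans (hρ.trans hρR)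
  have hκ := blaschkeFactor_lt_one hr0.le hρ
  have hθ1 : θ < 1 := by
    rw [hθ] at hκ
    by_contra! h
    exact absurd hκ (not_lt.2 (one_le_pow₀ h))
  set S := ∑' n : ℕ, hyperbolicCoeff L n * ((n : ℝ) + 1) * R ^ n with hS
  set T := (θ ^ (4 * m))⁻¹ with hT
  have hT0 : 0 < T := by positivity
  have hsum := summable_hyperbolicGAF hL hR0 hR1 hx
  have h1 := norm_coeff_le_of_le_zeroCount hr0 hρ hρR hsum hz n
  have hM : ∑' n, ‖(hyperbolicCoeff L n : ℂ) * x n‖ * R ^ n ≤ T * S := by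
    rw [hS, ← tsum_mul_left]
    refine hsum.tsum_le_tsum (fun n => ?_) ((summable_hyperbolicCoeff hL hR0 hR1).mul_left T)
    have hc := hyperbolicCoeff_pos hL n
    rw [norm_mul, Complex.norm_real, Real.norm_eq_abs, abs_of_pos hc]
    calc hyperbolicCoeff L n * ‖x n‖ * R ^ n
        ≤ hyperbolicCoeff L n * (T * ((n : ℝ) + 1)) * R ^ n := by
          gcongr
          exact hx n
      _ = _ := by ring
  have hc := hyperbolicCoeff_pos hL n
  rw [norm_mul, Complex.norm_real, Real.norm_eq_abs, abs_of_pos hc, hθ] at h1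
  -- Budget of the gain `θ ^ (8 * m)`: the growth constant `T` takes `4 * m` of the exponent,
  -- dividing by `r ^ n` takes `m`, and the factor `S * m / min 1 L` takes another `m`, leaving `θ ^
  -- (2 * m)`.
  have h2 : hyperbolicCoeff L n * ‖x n‖ * r ^ n ≤ S * θ ^ (4 * m) := by
    refine h1.trans ((mul_le_mul_of_nonneg_right hM (by positivity)).trans (le_of_eq ?_))
    rw [hT, ← pow_mul, show 8 * m = 4 * m + 4 * m by ring, pow_add]
    field_simp
  have h3 : θ ^ m ≤ r ^ n := by
    calc θ ^ m ≤ θ ^ (d * n) := pow_le_pow_of_le_one hθ0.le hθ1.le hn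
      _ = (θ ^ d) ^ n := pow_mul _ _ _
      _ ≤ r ^ n := by gcongr
  have h4 : 1 ≤ m / min 1 L * hyperbolicCoeff L n := by
    rcases Nat.eq_zero_or_pos n with rfl | hn0
    · have := hyperbolicCoeff_le_mul hL (Nat.zero_le 1) le_rfl
      rw [hyperbolicCoeff_zero, mul_one, le_div_iff₀ hl0, one_mul]
      exact (min_le_left _ _).trans (by exact_mod_cast hm)
    · have := hyperbolicCoeff_le_mul hL hn0.le hn0
      rw [hyperbolicCoeff_zero] at this
      refine this.trans ?_
      gcongr
  have hS0 : 0 ≤ S := tsum_nonneg fun n => by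
    have := hyperbolicCoeff_pos hL n
    positivity
  have h5 : ‖x n‖ * θ ^ m ≤ (m / min 1 L) * (S * θ ^ (4 * m)) := by
    calc ‖x n‖ * θ ^ m ≤ ‖x n‖ * r ^ n := by gcongr
      _ ≤ (m / min 1 L * hyperbolicCoeff L n) * (‖x n‖ * r ^ n) :=
        le_mul_of_one_le_left (by positivity) h4
      _ = (m / min 1 L) * (hyperbolicCoeff L n * ‖x n‖ * r ^ n) := by ring
      _ ≤ _ := by gcongr
  have h6 : (m / min 1 L) * (S * θ ^ (4 * m)) ≤ θ ^ (2 * m) * θ ^ m := by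
    calc (m / min 1 L) * (S * θ ^ (4 * m))
        = (S / min 1 L * (m * θ ^ m)) * (θ ^ (2 * m) * θ ^ m) := by
          rw [show 4 * m = m + (2 * m + m) by ring, pow_add, pow_add]
          ring
      _ ≤ 1 * (θ ^ (2 * m) * θ ^ m) := by gcongr
      _ = _ := one_mul _
  exact le_of_mul_le_mul_right (h5.trans h6) (by positivity)

theorem exists_overcrowding_upper {L r : ℝ} (hL : 0 < L) (hr0 : 0 < r) (hr1 : r < 1) :
    ∃ β C : ℝ, 0 < β ∧ 0 < C ∧ ∀ m : ℕ, 1 ≤ m →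
      gaussianSeq.real {x | (m : ℕ∞) ≤ zeroCount (hyperbolicGAF L x) r}
        ≤ C * Real.exp (-(β * (m : ℝ) ^ 2)) := by
  obtain ⟨ρ, hρ, hρ1⟩ := exists_between hr1
  obtain ⟨R, hρR, hR1⟩ := exists_between hρ1
  have hκ0 := blaschkeFactor_pos hr0.le hρ
  have hκ1 := blaschkeFactor_lt_one hr0.le hρ
  set θ := (blaschkeFactor r ρ) ^ ((8 : ℝ)⁻¹) with hθdef
  have hθ0 : 0 < θ := Real.rpow_pos_of_pos hκ0 _
  have hθ1 : θ < 1 := Real.rpow_lt_one hκ0.le hκ1 (by norm_num)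
  have hθ : blaschkeFactor r ρ = θ ^ 8 := by
    rw [hθdef, ← Real.rpow_natCast, ← Real.rpow_mul hκ0.le]
    norm_num
  obtain ⟨d', hd'⟩ := exists_pow_lt_of_lt_one hr0 hθ1
  -- The shift makes `d` positive, so that `m / d` is a genuine division.
  set d := d' + 1 with hd
  have hθd : θ ^ d ≤ r := (pow_le_pow_of_le_one hθ0.le hθ1.le (Nat.le_succ d')).trans hd'.le
  have hd0 : (0 : ℝ) < d := by positivity
  have hlogθ : Real.log θ < 0 := Real.log_neg hθ0 hθ1
  set β := min 1 (-(4 * Real.log θ) / d) with hβ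
  have hβ0 : 0 < β := lt_min one_pos (div_pos (by linarith) hd0)
  set S := ∑' n : ℕ, hyperbolicCoeff L n * ((n : ℝ) + 1) * R ^ n with hS
  have hev1 : ∀ᶠ m : ℕ in Filter.atTop, S / min 1 L * (m * θ ^ m) ≤ 1 := by
    have h2 : Filter.Tendsto (fun m : ℕ => S / min 1 L * ((m : ℝ) * θ ^ m)) Filter.atTop
        (nhds (S / min 1 L * 0)) := (tendsto_self_mul_const_pow_of_lt_one hθ0.le hθ1).const_mul _
    rw [mul_zero] at h2
    exact h2.eventually_le_const one_pos
  obtain ⟨m₀, hm₀⟩ := Filter.eventually_atTop.1 (hev1.and (eventually_quadratic_le_inv_pow hθ0 hθ1))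
  -- The exponential makes the bound trivial for `m < m₀`. The `3` is `2` from the event of a large
  -- coefficient plus `1` from the event of small coefficients.
  refine ⟨β, 3 * Real.exp (β * (m₀ : ℝ) ^ 2), hβ0, by positivity, fun m hm => ?_⟩
  rcases lt_or_ge m m₀ with hlt | hge
  · calc gaussianSeq.real {x | (m : ℕ∞) ≤ zeroCount (hyperbolicGAF L x) r} ≤ 1 := measureReal_le_one
      _ ≤ 3 * Real.exp (β * (m₀ : ℝ) ^ 2 + -(β * (m : ℝ) ^ 2)) := by
        have h1 : (1 : ℝ) ≤ Real.exp (β * (m₀ : ℝ) ^ 2 + -(β * (m : ℝ) ^ 2)) := by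
          refine Real.one_le_exp ?_
          have : (m : ℝ) ^ 2 ≤ (m₀ : ℝ) ^ 2 := by gcongr
          nlinarith
        linarith
      _ = _ := by rw [Real.exp_add, mul_assoc]
  · obtain ⟨hb1, hb2⟩ := hm₀ m hge
    set T := (θ ^ (4 * m))⁻¹ with hT
    have hT1 : 1 ≤ T := (one_le_inv₀ (by positivity)).2 (pow_le_one₀ hθ0.le hθ1.le)
    -- The indices `n ≤ m / d` are those with `d * n ≤ m`; there are `k ≥ m / d` of them, now with
    -- real division.
    set k := m / d + 1 with hk
    have hms : MeasurableSet {z : ℂ | ‖z‖ ≤ θ ^ (2 * m)} :=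
      measurableSet_le measurable_norm measurable_const
    have hsub : {x | (m : ℕ∞) ≤ zeroCount (hyperbolicGAF L x) r} ⊆
        {x : ℕ → ℂ | ∃ n : ℕ, T * ((n : ℝ) + 1) < ‖x n‖} ∪
        {x | ∀ n ∈ Finset.range k, x n ∈ {z : ℂ | ‖z‖ ≤ θ ^ (2 * m)}} := by
      intro x hx
      by_cases h : ∃ n : ℕ, T * ((n : ℝ) + 1) < ‖x n‖
      · exact Or.inl h
      · push Not at h
        refine Or.inr fun n hn => ?_
        have hn1 : n ≤ m / d := Nat.lt_succ_iff.1 (Finset.mem_range.1 hn)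
        exact norm_le_of_le_zeroCount_hyperbolicGAF hL hr0 hρ hρR hR1 hθ0 hθ hθd hm hb1 h hx
          (by rw [mul_comm]; exact (Nat.le_div_iff_mul_le (Nat.succ_pos d')).1 hn1)
          (hn1.trans (Nat.div_le_self _ _))
    have hA := gaussianSeq_real_exists_lt hT1
    have hB : gaussianSeq.real {x | ∀ n ∈ Finset.range k, x n ∈ {z : ℂ | ‖z‖ ≤ θ ^ (2 * m)}}
        ≤ Real.exp (-(β * (m : ℝ) ^ 2)) := by
      rw [gaussianSeq_real_box (Finset.range k) (t := fun _ => {z : ℂ | ‖z‖ ≤ θ ^ (2 * m)}) fun _ => hms,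
        Finset.prod_const, Finset.card_range]
      have h1 := stdComplexGaussian_real_setOf_norm_le_le (x := θ ^ (2 * m)) (by positivity)
      calc _ ≤ ((θ ^ (2 * m)) ^ 2) ^ k := by gcongr
        _ = Real.exp (Real.log θ * (4 * m * k)) := by
          rw [← pow_mul, ← pow_mul, ← Real.rpow_natCast, Real.rpow_def_of_pos hθ0]
          congr 1
          push_cast
          ring
        _ ≤ _ := by
          refine Real.exp_le_exp.2 ?_
          have hkd : (m : ℝ) / d ≤ k := by
            have := Nat.lt_floor_add_one ((m : ℝ) / d)
            rw [Nat.floor_div_eq_div] at this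
            rw [hk]
            push_cast
            exact this.le
          have hβle : β ≤ -(4 * Real.log θ) / d := min_le_right _ _
          have h5 : β * (m : ℝ) ^ 2 ≤ -(4 * Real.log θ) / d * (m : ℝ) ^ 2 := by gcongr
          have h6 : -(4 * Real.log θ) / d * (m : ℝ) ^ 2 = -(4 * Real.log θ) * m * (m / d) := by ring
          have h7 : -(4 * Real.log θ) * m * (m / d) ≤ -(4 * Real.log θ) * m * k := by
            have : 0 ≤ -(4 * Real.log θ) * m := mul_nonneg (by linarith) (Nat.cast_nonneg m)
            gcongr
          nlinarith
    have hA2 : Real.exp (-T ^ 2) ≤ Real.exp (-(β * (m : ℝ) ^ 2)) := by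
      refine Real.exp_le_exp.2 ?_
      have : β * (m : ℝ) ^ 2 ≤ 1 * (m : ℝ) ^ 2 := by
        gcongr
        exact min_le_left _ _
      linarith
    calc _ ≤ _ := measureReal_mono hsub
      _ ≤ _ := measureReal_union_le _ _
      _ ≤ 3 * Real.exp (-(β * (m : ℝ) ^ 2)) := by linarith
      _ ≤ 3 * Real.exp (β * (m₀ : ℝ) ^ 2) * Real.exp (-(β * (m : ℝ) ^ 2)) := by
        have h1 : (1 : ℝ) ≤ Real.exp (β * (m₀ : ℝ) ^ 2) := Real.one_le_exp (by positivity)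
        have h2 := Real.exp_nonneg (-(β * (m : ℝ) ^ 2))
        nlinarith [mul_le_mul_of_nonneg_right h1 h2]

/-! ### Monic polynomials, their reversals and the Szegő recursion -/

/-- The monic polynomial function with lower coefficients `c`. -/
noncomputable def monicEval {N : ℕ} (c : Fin N → ℂ) (z : ℂ) : ℂ := z ^ N + ∑ i, c i * z ^ (i : ℕ)

/-- The conjugate-reversed polynomial function of `monicEval c`. -/
noncomputable def reverseEval {N : ℕ} (c : Fin N → ℂ) (z : ℂ) : ℂ :=
  1 + ∑ i, (starRingEnd ℂ) (c i) * z ^ (N - (i : ℕ))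

/-- The lower coefficients of the monic polynomial with given roots. -/
noncomputable def rootsToCoeff {N : ℕ} (w : Fin N → ℂ) : Fin N → ℂ :=
  fun i => (∏ j, (Polynomial.X - Polynomial.C (w j))).coeff i

theorem monicEval_rootsToCoeff {N : ℕ} (w : Fin N → ℂ) (z : ℂ) :
    monicEval (rootsToCoeff w) z = ∏ j, (z - w j) := by
  have hmon : (∏ j, (Polynomial.X - Polynomial.C (w j))).Monic :=
    Polynomial.monic_prod_of_monic _ _ fun j _ => Polynomial.monic_X_sub_C _
  have hdeg : (∏ j, (Polynomial.X - Polynomial.C (w j))).natDegree = N := by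
    simp
  have h1 : (∏ j, (Polynomial.X - Polynomial.C (w j))).eval z = ∏ j, (z - w j) := by
    simp [Polynomial.eval_prod]
  rw [← h1, Polynomial.eval_eq_sum_range, hdeg, Finset.sum_range_succ]
  have h2 := hmon.coeff_natDegree
  rw [hdeg] at h2
  rw [h2, one_mul, add_comm, monicEval, Finset.sum_range]
  rfl

theorem exists_fin_map_eq {β : Type*} {N : ℕ} (s : Multiset β) (h : s.card = N) :
    ∃ w : Fin N → β, Finset.univ.val.map w = s := by
  subst h
  induction s using Quot.inductionOn with
  | _ l => exact ⟨l.get, (Fin.univ_val_map l.get).trans (by rw [List.ofFn_get]; rfl)⟩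

/-- The fundamental theorem of algebra; it reduces statements about `stableCoeffs` to one linear
factor at a time. -/
theorem exists_rootsToCoeff_eq {N : ℕ} (c : Fin N → ℂ) : ∃ w, rootsToCoeff w = c := by
  classical
  set q : Polynomial ℂ := Polynomial.X ^ N + ∑ i : Fin N, Polynomial.C (c i) * Polynomial.X ^ (i : ℕ) with hq
  have hdeglt : (∑ i : Fin N, Polynomial.C (c i) * Polynomial.X ^ (i : ℕ)).degree < (N : WithBot ℕ) :=
    Polynomial.degree_sum_fin_lt c
  have hmon : q.Monic := Polynomial.monic_X_pow_add hdeglt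
  have hnat : q.natDegree = N := Polynomial.natDegree_eq_of_degree_eq_some
    (by rw [hq, Polynomial.degree_add_eq_left_of_degree_lt, Polynomial.degree_X_pow]
        rwa [Polynomial.degree_X_pow])
  have hsplit := IsAlgClosed.splits q
  have hcard : q.roots.card = N := by rw [← hnat]; exact hsplit.natDegree_eq_card_roots.symm
  have hprod : q = (q.roots.map fun a => Polynomial.X - Polynomial.C a).prod :=
    hsplit.eq_prod_roots_of_monic hmon
  obtain ⟨w, hw⟩ := exists_fin_map_eq q.roots hcard
  refine ⟨w, ?_⟩
  have h1 : ∏ j : Fin N, (Polynomial.X - Polynomial.C (w j)) = q := by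
    rw [hprod, ← hw, Multiset.map_map]
    rfl
  funext i
  rw [rootsToCoeff, h1, hq]
  simp only [Polynomial.coeff_add, Polynomial.coeff_X_pow, Polynomial.finsetSum_coeff,
    Polynomial.coeff_C_mul]
  rw [if_neg i.2.ne, zero_add, Finset.sum_eq_single i]
  · simp
  · intro j _ hj
    rw [if_neg, mul_zero]
    exact fun h => hj (Fin.ext h.symm)
  · simp

theorem reverseEval_eq {N : ℕ} (c : Fin N → ℂ) {z : ℂ} (hz : z ≠ 0) :
    reverseEval c z = z ^ N * (starRingEnd ℂ) (monicEval c ((starRingEnd ℂ) z)⁻¹) := by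
  simp only [reverseEval, monicEval, map_add, map_sum, map_mul, map_pow, map_inv₀,
    Complex.conj_conj, mul_add, Finset.mul_sum]
  congr 1
  · rw [inv_pow, mul_inv_cancel₀ (pow_ne_zero _ hz)]
  · refine Finset.sum_congr rfl fun i _ => ?_
    have h : z ^ N = z ^ (N - (i : ℕ)) * z ^ (i : ℕ) := by
      rw [← pow_add, Nat.sub_add_cancel i.2.le]
    rw [h, inv_pow]
    field_simp

theorem reverseEval_rootsToCoeff {N : ℕ} (w : Fin N → ℂ) (z : ℂ) :
    reverseEval (rootsToCoeff w) z = ∏ j, (1 - (starRingEnd ℂ) (w j) * z) := by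
  rcases eq_or_ne z 0 with rfl | hz
  · simp only [reverseEval, mul_zero, sub_zero, Finset.prod_const_one, add_eq_left]
    refine Finset.sum_eq_zero fun i _ => ?_
    rw [zero_pow (Nat.sub_ne_zero_of_lt i.2), mul_zero]
  · rw [reverseEval_eq _ hz, monicEval_rootsToCoeff, map_prod]
    have : z ^ N = ∏ _j : Fin N, z := by simp
    rw [this, ← Finset.prod_mul_distrib]
    refine Finset.prod_congr rfl fun j _ => ?_
    simp only [map_sub, map_inv₀, Complex.conj_conj]
    field_simp

/-- Coefficients of monic polynomials with all roots in the open unit disk. -/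
def stableCoeffs (N : ℕ) : Set (Fin N → ℂ) := {c | ∀ z : ℂ, 1 ≤ ‖z‖ → monicEval c z ≠ 0}

theorem rootsToCoeff_mem_stableCoeffs_iff {N : ℕ} {w : Fin N → ℂ} :
    rootsToCoeff w ∈ stableCoeffs N ↔ ∀ i, ‖w i‖ < 1 := by
  simp only [stableCoeffs, Set.mem_ofPred_eq, monicEval_rootsToCoeff]
  constructor
  · intro h i
    by_contra! hi
    exact h (w i) hi (Finset.prod_eq_zero (Finset.mem_univ i) (sub_self _))
  · intro h z hz
    refine Finset.prod_ne_zero_iff.2 fun i _ h0 => ?_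
    rw [sub_eq_zero.1 h0] at hz
    exact (h i).not_ge hz

theorem norm_one_sub_conj_mul_le {z w : ℂ} (hz : 1 ≤ ‖z‖) (hw : ‖w‖ ≤ 1) :
    ‖1 - (starRingEnd ℂ) w * z‖ ≤ ‖z - w‖ := by
  refine le_of_sq_le_sq ?_ (norm_nonneg _)
  have hid : ‖z - w‖ ^ 2 - ‖1 - (starRingEnd ℂ) w * z‖ ^ 2 = (‖z‖ ^ 2 - 1) * (1 - ‖w‖ ^ 2) := by
    simp only [← Complex.normSq_eq_norm_sq, Complex.normSq_apply]
    simp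
    ring
  have h1 : 1 ≤ ‖z‖ ^ 2 := one_le_pow₀ hz
  have h2 : ‖w‖ ^ 2 ≤ 1 := pow_le_one₀ (norm_nonneg _) hw
  nlinarith [mul_nonneg (sub_nonneg.2 h1) (sub_nonneg.2 h2)]

theorem norm_reverseEval_le {N : ℕ} {c : Fin N → ℂ} (hc : c ∈ stableCoeffs N) {z : ℂ} (hz : 1 ≤ ‖z‖) :
    ‖reverseEval c z‖ ≤ ‖monicEval c z‖ := by
  obtain ⟨w, rfl⟩ := exists_rootsToCoeff_eq c
  rw [rootsToCoeff_mem_stableCoeffs_iff] at hc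
  rw [reverseEval_rootsToCoeff, monicEval_rootsToCoeff, norm_prod, norm_prod]
  exact Finset.prod_le_prod (fun _ _ => norm_nonneg _)
    fun i _ => norm_one_sub_conj_mul_le hz (hc i).le

/-- The real-linear part of the Szegő recursion. -/
noncomputable def szegoLinear (N : ℕ) (α : ℂ) : (Fin N → ℂ) →ₗ[ℝ] (Fin N → ℂ) where
  toFun c i := c i + α * (starRingEnd ℂ) (c i.rev)
  map_add' c d := by
    funext i
    simp only [Pi.add_apply, map_add]
    ring
  map_smul' t c := by
    funext i
    simp only [Pi.smul_apply, Complex.real_smul, map_mul, Complex.conj_ofReal, RingHom.id_apply]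
    ring

theorem szegoLinear_apply {N : ℕ} (α : ℂ) (c : Fin N → ℂ) (i : Fin N) :
    szegoLinear N α c i = c i + α * (starRingEnd ℂ) (c i.rev) := rfl

/-- This provides both the inverse of the recursion and the product of the determinants for `α` and
`-α`. -/
theorem szegoLinear_neg_apply {N : ℕ} (α : ℂ) (c : Fin N → ℂ) :
    szegoLinear N α (szegoLinear N (-α) c) = (1 - ‖α‖ ^ 2) • c := by
  funext i
  simp only [szegoLinear_apply, map_add, map_mul, map_neg, Complex.conj_conj, Fin.rev_rev,
    Pi.smul_apply, Complex.real_smul, Complex.ofReal_sub, Complex.ofReal_one, Complex.ofReal_pow]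
  rw [← Complex.mul_conj']
  ring

/-- Conjugation by multiplication by `i` turns `szegoLinear N α` into `szegoLinear N (-α)`, because
the second summand is conjugate-linear. The two determinants agree, and their product is `(1 - |α|²)
^ (2 N)`, the real dimension being `2 N`. -/
theorem abs_det_szegoLinear {N : ℕ} {α : ℂ} (hα : ‖α‖ ≤ 1) :
    |LinearMap.det (szegoLinear N α)| = (1 - ‖α‖ ^ 2) ^ N := by
  have hα2 : ‖α‖ ^ 2 ≤ 1 := pow_le_one₀ (norm_nonneg _) hα
  have h1 : szegoLinear N α ∘ₗ szegoLinear N (-α) = (1 - ‖α‖ ^ 2 : ℝ) • LinearMap.id := by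
    refine LinearMap.ext fun c => ?_
    exact szegoLinear_neg_apply α c
  let e : (Fin N → ℂ) ≃ₗ[ℝ] (Fin N → ℂ) :=
    LinearEquiv.ofLinearMap
      ({ toFun := fun c i => Complex.I * c i
         map_add' := fun c d => by funext i; simp [mul_add]
         map_smul' := fun t c => by funext i; simp; ring } : (Fin N → ℂ) →ₗ[ℝ] (Fin N → ℂ))
      ({ toFun := fun c i => -Complex.I * c i
         map_add' := fun c d => by funext i; simp; ring
         map_smul' := fun t c => by funext i; simp; ring } : (Fin N → ℂ) →ₗ[ℝ] (Fin N → ℂ))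
      (by
        refine LinearMap.ext fun c => funext fun i => ?_
        simp [← mul_assoc])
      (by
        refine LinearMap.ext fun c => funext fun i => ?_
        simp [← mul_assoc])
  have h2 : LinearMap.det (szegoLinear N (-α)) = LinearMap.det (szegoLinear N α) := by
    rw [← LinearMap.det_conj (szegoLinear N α) e]
    congr 1
    refine LinearMap.ext fun c => funext fun i => ?_
    change szegoLinear N (-α) c i = Complex.I * (szegoLinear N α (fun i => -Complex.I * c i) i)
    simp only [szegoLinear_apply, map_mul, map_neg, Complex.conj_I]
    linear_combination (c i - α * (starRingEnd ℂ) (c i.rev)) * Complex.I_mul_I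
  have h3 := congrArg LinearMap.det h1
  rw [LinearMap.det_comp, h2, LinearMap.det_smul, LinearMap.det_id, mul_one,
    Module.finrank_pi_fintype] at h3
  simp only [Complex.finrank_real_complex, Finset.sum_const, Finset.card_univ, Fintype.card_fin,
    smul_eq_mul] at h3
  rw [← sq, pow_mul] at h3
  have h4 : 0 ≤ (1 - ‖α‖ ^ 2) ^ N := pow_nonneg (by linarith) _
  rw [← abs_of_nonneg h4]
  exact (sq_eq_sq_iff_abs_eq_abs _ _).1 h3

/-- One step of the Szegő recursion, on coefficients. -/
noncomputable def szegoStep {N : ℕ} (α : ℂ) (c : Fin N → ℂ) : Fin (N + 1) → ℂ :=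
  Fin.cons α (szegoLinear N α c)

/-- The Szegő recursion `Φ ↦ z Φ + α Φ*`: the constant term of the new polynomial is `α`, and its
other lower coefficients are real-linear in those of `Φ`. -/
theorem monicEval_szegoStep {N : ℕ} (α : ℂ) (c : Fin N → ℂ) (z : ℂ) :
    monicEval (szegoStep α c) z = z * monicEval c z + α * reverseEval c z := by
  have hrev : ∑ i : Fin N, (starRingEnd ℂ) (c i.rev) * z ^ ((i : ℕ) + 1)
      = ∑ i : Fin N, (starRingEnd ℂ) (c i) * z ^ (N - (i : ℕ)) := by
    rw [← Equiv.sum_comp Fin.revPerm]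
    refine Finset.sum_congr rfl fun i _ => ?_
    simp only [Fin.revPerm_apply, Fin.rev_rev, Fin.val_rev]
    congr 2
    omega
  simp only [monicEval, szegoStep, Fin.sum_univ_succ, Fin.cons_zero, Fin.cons_succ, Fin.val_zero,
    pow_zero, mul_one, Fin.val_succ, szegoLinear_apply, reverseEval, mul_add, add_mul,
    Finset.sum_add_distrib]
  rw [← hrev, Finset.mul_sum, Finset.mul_sum]
  have h1 : ∀ i : Fin N, z * (c i * z ^ (i : ℕ)) = c i * z ^ ((i : ℕ) + 1) := fun i => by ring
  have h2 : ∀ i : Fin N, α * ((starRingEnd ℂ) (c i.rev) * z ^ ((i : ℕ) + 1))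
      = α * (starRingEnd ℂ) (c i.rev) * z ^ ((i : ℕ) + 1) := fun i => by ring
  simp only [h1, h2]
  ring

theorem reverseEval_szegoStep {N : ℕ} (α : ℂ) (c : Fin N → ℂ) (z : ℂ) :
    reverseEval (szegoStep α c) z = reverseEval c z + (starRingEnd ℂ) α * (z * monicEval c z) := by
  have hrev : ∑ i : Fin N, c i.rev * z ^ (N - (i : ℕ))
      = ∑ i : Fin N, c i * z ^ ((i : ℕ) + 1) := by
    rw [← Equiv.sum_comp Fin.revPerm]
    refine Finset.sum_congr rfl fun i _ => ?_
    simp only [Fin.revPerm_apply, Fin.rev_rev, Fin.val_rev]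
    congr 2
    omega
  simp only [monicEval, szegoStep, Fin.sum_univ_succ, Fin.cons_zero, Fin.cons_succ, Fin.val_zero,
    Nat.sub_zero, Fin.val_succ, szegoLinear_apply, reverseEval, mul_add, add_mul, map_add, map_mul,
    Complex.conj_conj, Finset.sum_add_distrib, Nat.add_sub_add_right]
  have h1 : ∀ i : Fin N, z * (c i * z ^ (i : ℕ)) = c i * z ^ ((i : ℕ) + 1) := fun i => by ring
  have h2 : ∀ i : Fin N, (starRingEnd ℂ) α * c i.rev * z ^ (N - (i : ℕ))
      = (starRingEnd ℂ) α * (c i.rev * z ^ (N - (i : ℕ))) := fun i => by ring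
  simp only [h2]
  rw [Finset.mul_sum, Finset.mul_sum, ← Finset.mul_sum, hrev, Finset.mul_sum]
  simp only [h1]
  rw [← Finset.mul_sum]
  ring

/-- The Schur–Cohn criterion. For a stable polynomial the reversal is dominated outside the open
disk. A root there of either polynomial would express the other as a multiple of a reversal by a
factor too small for this domination. -/
theorem szegoStep_mem_stableCoeffs_iff {N : ℕ} {α : ℂ} (hα : ‖α‖ < 1) {c : Fin N → ℂ} :
    szegoStep α c ∈ stableCoeffs (N + 1) ↔ c ∈ stableCoeffs N := by
  have hα2 : ‖α‖ ^ 2 < 1 := pow_lt_one₀ (norm_nonneg _) hα two_ne_zero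
  constructor
  · intro h z hz h0
    have h1 := norm_reverseEval_le h hz
    have h2 := h z hz
    have h3 : monicEval (szegoStep α c) z = α * reverseEval (szegoStep α c) z := by
      rw [monicEval_szegoStep, reverseEval_szegoStep, h0]
      ring
    rw [h3, norm_mul] at h1
    rw [h3] at h2
    have h4 : 0 < ‖reverseEval (szegoStep α c) z‖ := norm_pos_iff.2 (right_ne_zero_of_mul h2)
    nlinarith
  · intro h z hz h0
    rw [monicEval_szegoStep] at h0
    have h1 := norm_reverseEval_le h hz
    have h2 : 0 < ‖monicEval c z‖ := norm_pos_iff.2 (h z hz)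
    have h3 : ‖z * monicEval c z‖ = ‖α * reverseEval c z‖ := by
      rw [eq_neg_of_add_eq_zero_left h0, norm_neg]
    rw [norm_mul, norm_mul] at h3
    nlinarith [norm_nonneg α, norm_nonneg (reverseEval c z)]

/-- Up to sign the constant term is the product of the roots. Hence every stable polynomial of
positive degree is reached by a Szegő step with `‖α‖ < 1`. -/
theorem norm_zero_lt_of_mem_stableCoeffs {N : ℕ} {c : Fin (N + 1) → ℂ}
    (hc : c ∈ stableCoeffs (N + 1)) : ‖c 0‖ < 1 := by
  have h0 : monicEval c 0 = c 0 := by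
    rw [monicEval, Fin.sum_univ_succ]
    simp
  obtain ⟨w, rfl⟩ := exists_rootsToCoeff_eq c
  rw [rootsToCoeff_mem_stableCoeffs_iff] at hc
  rw [← h0, monicEval_rootsToCoeff, norm_prod, Fin.prod_univ_succ]
  have h1 : ∏ i : Fin N, ‖0 - w i.succ‖ ≤ 1 :=
    Finset.prod_le_one (fun _ _ => norm_nonneg _) fun i _ => by
      rw [zero_sub, norm_neg]
      exact (hc _).le
  have h2 := hc 0
  rw [zero_sub, norm_neg]
  calc _ ≤ ‖w 0‖ * 1 := by gcongr
    _ < 1 := by linarith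

/-! ### The law of the Verblunsky coefficients -/

/-- The density of the `k`-th Verblunsky coefficient of a uniform stable polynomial. -/
noncomputable def verblunskyDensity (k : ℕ) (s : ℝ) : ℝ :=
  if s < 1 then ((k : ℝ) + 1) / Real.pi * (1 - s ^ 2) ^ k else 0

/-- The law on the unit disk with density proportional to `(1 - |α|²)^k`. -/
noncomputable def verblunskyLaw (k : ℕ) : Measure ℂ :=
  (volume : Measure ℂ).withDensity fun α => ENNReal.ofReal (verblunskyDensity k ‖α‖)

/-- The radial part of the transport from the Gaussian law to `verblunskyLaw k`. -/
noncomputable def verblunskyRadius (k : ℕ) (s : ℝ) : ℝ :=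
  Real.sqrt (1 - Real.exp (-s ^ 2 / ((k : ℝ) + 1)))

/-- The radial map transporting the standard Gaussian law to `verblunskyLaw k`. -/
noncomputable def verblunskyMap (k : ℕ) (a : ℂ) : ℂ := ((verblunskyRadius k ‖a‖ / ‖a‖ : ℝ) : ℂ) * a

theorem verblunskyRadius_nonneg (k : ℕ) (s : ℝ) : 0 ≤ verblunskyRadius k s := Real.sqrt_nonneg _

theorem verblunskyRadius_sq (k : ℕ) (s : ℝ) :
    verblunskyRadius k s ^ 2 = 1 - Real.exp (-s ^ 2 / ((k : ℝ) + 1)) := by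
  refine Real.sq_sqrt (sub_nonneg.2 (Real.exp_le_one_iff.2 ?_))
  exact div_nonpos_of_nonpos_of_nonneg (by nlinarith [sq_nonneg s]) (by positivity)

theorem verblunskyRadius_lt_one (k : ℕ) (s : ℝ) : verblunskyRadius k s < 1 := by
  rw [verblunskyRadius, Real.sqrt_lt' one_pos]
  linarith [Real.exp_pos (-s ^ 2 / ((k : ℝ) + 1))]

theorem verblunskyRadius_zero (k : ℕ) : verblunskyRadius k 0 = 0 := by simp [verblunskyRadius]

theorem norm_verblunskyMap (k : ℕ) (a : ℂ) : ‖verblunskyMap k a‖ = verblunskyRadius k ‖a‖ := by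
  rcases eq_or_ne a 0 with rfl | ha
  · simp [verblunskyMap, verblunskyRadius_zero]
  · rw [verblunskyMap, norm_mul, Complex.norm_real, Real.norm_eq_abs,
      abs_of_nonneg (div_nonneg (verblunskyRadius_nonneg _ _) (norm_nonneg _)),
      div_mul_cancel₀ _ (norm_ne_zero_iff.2 ha)]

theorem norm_verblunskyMap_lt_one (k : ℕ) (a : ℂ) : ‖verblunskyMap k a‖ < 1 := by
  rw [norm_verblunskyMap]
  exact verblunskyRadius_lt_one _ _

theorem continuous_verblunskyRadius (k : ℕ) : Continuous (verblunskyRadius k) := by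
  unfold verblunskyRadius
  fun_prop

theorem measurable_verblunskyMap (k : ℕ) : Measurable (verblunskyMap k) := by
  have := (continuous_verblunskyRadius k).measurable
  unfold verblunskyMap
  fun_prop

theorem measurable_verblunskyDensity (k : ℕ) : Measurable (verblunskyDensity k) := by
  unfold verblunskyDensity
  exact Measurable.ite measurableSet_Iio (by fun_prop) measurable_const

theorem exp_lt_one_of_neg {x : ℝ} (hx : x < 0) : Real.exp x < 1 := by
  simpa using Real.exp_lt_exp.2 hx

theorem hasDerivAt_verblunskyRadius (k : ℕ) {s : ℝ} (hs : 0 < s) :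
    HasDerivAt (verblunskyRadius k)
      (s / ((k : ℝ) + 1) * Real.exp (-s ^ 2 / ((k : ℝ) + 1)) / verblunskyRadius k s) s := by
  have hk : (0 : ℝ) < (k : ℝ) + 1 := by positivity
  have hpos : 1 - Real.exp (-s ^ 2 / ((k : ℝ) + 1)) ≠ 0 := by
    refine (sub_pos.2 (exp_lt_one_of_neg ?_)).ne'
    exact div_neg_of_neg_of_pos (by nlinarith [sq_pos_of_pos hs]) hk
  have h1 : HasDerivAt (fun s : ℝ => -s ^ 2 / ((k : ℝ) + 1)) (-(2 * s) / ((k : ℝ) + 1)) s := by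
    simpa using ((hasDerivAt_pow 2 s).fun_neg).div_const ((k : ℝ) + 1)
  have h2 := (h1.exp.const_sub 1).sqrt hpos
  refine h2.congr_deriv ?_
  rw [verblunskyRadius]
  have : Real.sqrt (1 - Real.exp (-s ^ 2 / ((k : ℝ) + 1))) ≠ 0 := by
    rw [Real.sqrt_ne_zero']
    exact lt_of_le_of_ne (sub_nonneg.2 (Real.exp_le_one_iff.2
      (div_nonpos_of_nonpos_of_nonneg (by nlinarith [sq_nonneg s]) hk.le))) hpos.symm
  field_simp

theorem verblunskyRadius_pos (k : ℕ) {s : ℝ} (hs : 0 < s) : 0 < verblunskyRadius k s := by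
  refine Real.sqrt_pos.2 (sub_pos.2 (exp_lt_one_of_neg ?_))
  exact div_neg_of_neg_of_pos (by nlinarith [sq_pos_of_pos hs]) (by positivity)

theorem verblunskyRadius_strictMonoOn (k : ℕ) : StrictMonoOn (verblunskyRadius k) (Set.Ioi 0) := by
  intro s hs t _ hst
  have hs0 : (0 : ℝ) < s := hs
  refine Real.sqrt_lt_sqrt (sub_nonneg.2 (Real.exp_le_one_iff.2 ?_)) ?_
  · exact div_nonpos_of_nonpos_of_nonneg (by nlinarith [sq_nonneg s]) (by positivity)
  · refine sub_lt_sub_left (Real.exp_lt_exp.2 ?_) 1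
    gcongr

theorem image_verblunskyRadius (k : ℕ) : verblunskyRadius k '' Set.Ioi 0 = Set.Ioo 0 1 := by
  ext y
  constructor
  · rintro ⟨s, hs, rfl⟩
    exact ⟨verblunskyRadius_pos k hs, verblunskyRadius_lt_one k s⟩
  · rintro ⟨hy0, hy1⟩
    have hk : (0 : ℝ) < (k : ℝ) + 1 := by positivity
    have hy2 : 0 < 1 - y ^ 2 := by nlinarith
    have hlog : Real.log (1 - y ^ 2) < 0 := Real.log_neg hy2 (by nlinarith)
    have hpos : 0 < -(((k : ℝ) + 1) * Real.log (1 - y ^ 2)) := by nlinarith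
    refine ⟨Real.sqrt (-(((k : ℝ) + 1) * Real.log (1 - y ^ 2))), Real.sqrt_pos.2 hpos, ?_⟩
    rw [verblunskyRadius, Real.sq_sqrt hpos.le, neg_neg, mul_div_cancel_left₀ _ hk.ne',
      Real.exp_log hy2, sub_sub_cancel, Real.sqrt_sq hy0.le]

/-- The radius is chosen so that `(1 - R(s)²) ^ (k + 1) = exp (-s²)`, which matches the tail of the
target law with the Gaussian tail. Substituting `R` matches the densities. -/
theorem lintegral_radial_verblunsky (k : ℕ) (F : ℝ → ℝ≥0∞) :
    ∫⁻ s in Set.Ioi 0, ENNReal.ofReal s * (ENNReal.ofReal (verblunskyDensity k s) * F s)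
      = ∫⁻ s in Set.Ioi 0, ENNReal.ofReal s * (ENNReal.ofReal (Real.pi⁻¹ * Real.exp (-s ^ 2)) *
          F (verblunskyRadius k s)) := by
  have h1 : ∫⁻ s in Set.Ioi 0, ENNReal.ofReal s * (ENNReal.ofReal (verblunskyDensity k s) * F s)
      = ∫⁻ s in Set.Ioo 0 1, ENNReal.ofReal s * (ENNReal.ofReal (verblunskyDensity k s) * F s) := by
    rw [← lintegral_indicator measurableSet_Ioi, ← lintegral_indicator measurableSet_Ioo]
    congr 1
    funext s
    simp only [Set.indicator, Set.mem_Ioi, Set.mem_Ioo, verblunskyDensity]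
    by_cases h0 : 0 < s <;> by_cases h1 : s < 1 <;> simp [h0, h1]
  rw [h1, ← image_verblunskyRadius k, lintegral_image_eq_lintegral_abs_deriv_mul measurableSet_Ioi
    (fun s hs => (hasDerivAt_verblunskyRadius k hs).hasDerivWithinAt)
    (verblunskyRadius_strictMonoOn k).injOn]
  refine setLIntegral_congr_fun measurableSet_Ioi fun s hs => ?_
  have hs0 : (0 : ℝ) < s := hs
  have hk : (0 : ℝ) < (k : ℝ) + 1 := by positivity
  have hR := verblunskyRadius_pos k hs0
  rw [← mul_assoc, ← mul_assoc, ← mul_assoc, ← ENNReal.ofReal_mul (abs_nonneg _),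
    ← ENNReal.ofReal_mul (by positivity), ← ENNReal.ofReal_mul hs0.le]
  congr 2
  rw [abs_of_pos (by positivity), verblunskyDensity, if_pos (verblunskyRadius_lt_one k s),
    verblunskyRadius_sq, sub_sub_cancel]
  have h2 : Real.exp (-s ^ 2 / ((k : ℝ) + 1)) * Real.exp (-s ^ 2 / ((k : ℝ) + 1)) ^ k
      = Real.exp (-s ^ 2) := by
    rw [← pow_succ', ← Real.exp_nat_mul]
    congr 1
    push_cast
    field_simp
  rw [← h2]
  have := Real.pi_ne_zero
  field_simp

theorem lintegral_polar {F : ℂ → ℝ≥0∞} (hF : Measurable F) :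
    ∫⁻ z, F z = ∫⁻ θ in Set.Ioo (-Real.pi) Real.pi, ∫⁻ s in Set.Ioi (0 : ℝ),
      ENNReal.ofReal s * F (s * Complex.exp (θ * Complex.I)) := by
  have hm : Measurable fun p : ℝ × ℝ => ENNReal.ofReal p.1 * F (p.1 * Complex.exp (p.2 * Complex.I)) := by
    fun_prop
  rw [← Complex.lintegral_comp_polarCoord_symm, polarCoord_target, Measure.volume_eq_prod,
    ← Measure.prod_restrict]
  simp only [Complex.polarCoord_symm_apply, smul_eq_mul]
  have : ∀ p : ℝ × ℝ, (p.1 : ℂ) * ((Real.cos p.2 : ℂ) + (Real.sin p.2 : ℂ) * Complex.I)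
      = p.1 * Complex.exp (p.2 * Complex.I) := by
    intro p
    rw [Complex.exp_mul_I]
    push_cast
    rfl
  simp only [this]
  exact lintegral_prod_symm _ hm.aemeasurable

/-- Both laws are rotation invariant and the map preserves the angle, so the radial identity
suffices in polar coordinates. -/
theorem map_verblunskyMap (k : ℕ) : stdComplexGaussian.map (verblunskyMap k) = verblunskyLaw k := by
  refine Measure.ext_of_lintegral _ fun F hF => ?_
  have hd1 : Measurable fun z : ℂ => ENNReal.ofReal (Real.pi⁻¹ * Real.exp (-‖z‖ ^ 2)) := by fun_prop
  have hd2 : Measurable fun z : ℂ => ENNReal.ofReal (verblunskyDensity k ‖z‖) :=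
    ((measurable_verblunskyDensity k).comp measurable_norm).ennreal_ofReal
  have hFv : Measurable fun z => F (verblunskyMap k z) := hF.comp (measurable_verblunskyMap k)
  rw [lintegral_map hF (measurable_verblunskyMap k), stdComplexGaussian, verblunskyLaw,
    lintegral_withDensity_eq_lintegral_mul _ hd1 hFv, lintegral_withDensity_eq_lintegral_mul _ hd2 hF,
    lintegral_polar (hd1.mul hFv), lintegral_polar (hd2.mul hF)]
  refine lintegral_congr fun θ => ?_
  have hnorm : ∀ s : ℝ, 0 < s → ‖(s : ℂ) * Complex.exp (θ * Complex.I)‖ = s := fun s hs => by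
    rw [norm_mul, Complex.norm_exp_ofReal_mul_I, mul_one, Complex.norm_real, Real.norm_eq_abs,
      abs_of_pos hs]
  have h := lintegral_radial_verblunsky k fun s => F (s * Complex.exp (θ * Complex.I))
  refine Eq.trans ?_ (h.symm.trans ?_)
  · refine setLIntegral_congr_fun measurableSet_Ioi fun s hs => ?_
    have hs0 : (0 : ℝ) < s := hs
    simp only [Pi.mul_apply, verblunskyMap, hnorm s hs0]
    congr 3
    push_cast
    have : (s : ℂ) ≠ 0 := Complex.ofReal_ne_zero.2 hs0.ne'
    field_simp
  · refine setLIntegral_congr_fun measurableSet_Ioi fun s hs => ?_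
    simp only [Pi.mul_apply, hnorm s hs]

instance isProbabilityMeasure_verblunskyLaw (k : ℕ) : IsProbabilityMeasure (verblunskyLaw k) := by
  rw [← map_verblunskyMap k]
  exact Measure.isProbabilityMeasure_map (measurable_verblunskyMap k).aemeasurable

/-! ### The uniform law on stable polynomials -/

theorem measurable_szegoLinear {N : ℕ} :
    Measurable fun p : ℂ × (Fin N → ℂ) => szegoLinear N p.1 p.2 := by
  refine measurable_pi_lambda _ fun i => ?_
  simp only [szegoLinear_apply]
  have : Measurable (starRingEnd ℂ) := Complex.continuous_conj.measurable
  fun_prop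

theorem measurable_szegoStep {N : ℕ} :
    Measurable fun p : ℂ × (Fin N → ℂ) => (szegoStep p.1 p.2 : Fin (N + 1) → ℂ) := by
  refine measurable_pi_lambda _ fun i => ?_
  refine Fin.cases ?_ (fun j => ?_) i
  · simpa [szegoStep] using measurable_fst
  · simp only [szegoStep, Fin.cons_succ]
    exact (measurable_pi_apply j).comp measurable_szegoLinear

theorem szegoStep_inverse {N : ℕ} (c : Fin (N + 1) → ℂ) (hc : ‖c 0‖ < 1) :
    szegoStep (c 0) ((1 - ‖c 0‖ ^ 2)⁻¹ • szegoLinear N (-(c 0)) (Fin.tail c)) = c := by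
  have hα2 : ‖c 0‖ ^ 2 < 1 := pow_lt_one₀ (norm_nonneg _) hc two_ne_zero
  rw [szegoStep, map_smul, szegoLinear_neg_apply, smul_smul, inv_mul_cancel₀ (by linarith), one_smul,
    Fin.cons_self_tail]

/-- Inverting the Szegő step describes stability in degree `N + 1` as a measurable condition on the
constant term and stability in degree `N`. -/
theorem measurableSet_stableCoeffs (N : ℕ) : MeasurableSet (stableCoeffs N) := by
  induction N with
  | zero => exact Subsingleton.measurableSet
  | succ N ih =>
    have h : stableCoeffs (N + 1) = {c | ‖c 0‖ < 1} ∩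
        (fun c : Fin (N + 1) → ℂ => (1 - ‖c 0‖ ^ 2)⁻¹ • szegoLinear N (-(c 0)) (Fin.tail c)) ⁻¹'
          stableCoeffs N := by
      ext c
      simp only [Set.mem_inter_iff, Set.mem_ofPred_eq, Set.mem_preimage]
      constructor
      · intro hc
        have h0 := norm_zero_lt_of_mem_stableCoeffs hc
        refine ⟨h0, ?_⟩
        rw [← szegoStep_mem_stableCoeffs_iff h0, szegoStep_inverse c h0]
        exact hc
      · rintro ⟨h0, hc⟩
        rw [← szegoStep_mem_stableCoeffs_iff h0, szegoStep_inverse c h0] at hc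
        exact hc
    rw [h]
    refine MeasurableSet.inter ?_ ?_
    · exact measurableSet_lt (by fun_prop) measurable_const
    · refine measurableSet_preimage ?_ ih
      have h1 : Measurable fun c : Fin (N + 1) → ℂ => (-(c 0), (Fin.tail c : Fin N → ℂ)) := by
        refine Measurable.prodMk (by fun_prop) (measurable_pi_lambda _ fun i => ?_)
        simp only [Fin.tail]
        fun_prop
      have h2 : Measurable fun c : Fin (N + 1) → ℂ => (1 - ‖c 0‖ ^ 2)⁻¹ := by fun_prop
      exact h2.smul (measurable_szegoLinear.comp h1)

/-- The uniform probability law on stable monic polynomials. -/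
noncomputable def stableLaw (N : ℕ) : Measure (Fin N → ℂ) :=
  ENNReal.ofReal ((N.factorial : ℝ) / Real.pi ^ N) • volume.restrict (stableCoeffs N)

instance sfinite_stableLaw (N : ℕ) : SFinite (stableLaw N) := by
  unfold stableLaw
  infer_instance

theorem lintegral_szegoLinear {N : ℕ} {α : ℂ} (hα : ‖α‖ < 1) {G : (Fin N → ℂ) → ℝ≥0∞}
    (hG : Measurable G) :
    ENNReal.ofReal ((1 - ‖α‖ ^ 2) ^ N) * ∫⁻ c, G (szegoLinear N α c) = ∫⁻ c, G c := by
  have hα2 : ‖α‖ ^ 2 < 1 := pow_lt_one₀ (norm_nonneg _) hα two_ne_zero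
  have hpos : 0 < (1 - ‖α‖ ^ 2) ^ N := pow_pos (by linarith) _
  have hdet : LinearMap.det (szegoLinear N α) ≠ 0 := by
    intro h
    have := abs_det_szegoLinear (N := N) hα.le
    rw [h, abs_zero] at this
    exact hpos.ne this
  have hmap := Measure.map_linearMap_addHaar_eq_smul_addHaar (volume : Measure (Fin N → ℂ)) hdet
  have hm : Measurable (szegoLinear N α) :=
    measurable_szegoLinear.comp (measurable_const.prodMk measurable_id)
  rw [← lintegral_map hG hm, hmap, lintegral_smul_measure, abs_inv, abs_det_szegoLinear hα.le,
    smul_eq_mul, ← mul_assoc, ← ENNReal.ofReal_mul hpos.le, mul_inv_cancel₀ hpos.ne',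
    ENNReal.ofReal_one, one_mul]

/-- Over a fixed constant term `α`, the stable coefficients of degree `N + 1` are the image of those
of degree `N` under a linear map of Jacobian `(1 - |α|²) ^ N`. So `α` has density proportional to
this power and is independent of the rest. The constants agree because `(N + 1) / π * (N! / π ^ N) =
(N + 1)! / π ^ (N + 1)`. -/
theorem map_szegoStep (N : ℕ) :
    ((verblunskyLaw N).prod (stableLaw N)).map (fun p => szegoStep p.1 p.2) = stableLaw (N + 1) := by
  refine Measure.ext_of_lintegral _ fun F hF => ?_
  have hS := measurableSet_stableCoeffs N
  have hS1 := measurableSet_stableCoeffs (N + 1)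
  set G : (Fin (N + 1) → ℂ) → ℝ≥0∞ := (stableCoeffs (N + 1)).indicator F with hG
  have hGm : Measurable G := hF.indicator hS1
  have hcons : Measurable fun p : ℂ × (Fin N → ℂ) => (Fin.cons p.1 p.2 : Fin (N + 1) → ℂ) := by
    refine measurable_pi_lambda _ fun i => ?_
    refine Fin.cases ?_ (fun j => ?_) i
    · simpa using measurable_fst
    · simp only [Fin.cons_succ]
      fun_prop
  have hd2 : Measurable fun z : ℂ => ENNReal.ofReal (verblunskyDensity N ‖z‖) :=
    ((measurable_verblunskyDensity N).comp measurable_norm).ennreal_ofReal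
  have hpi : (0 : ℝ) < Real.pi := Real.pi_pos
  have hFs : Measurable fun p : ℂ × (Fin N → ℂ) => F (szegoStep p.1 p.2) := hF.comp measurable_szegoStep
  rw [lintegral_map hF measurable_szegoStep, lintegral_prod _ hFs.aemeasurable, verblunskyLaw,
    lintegral_withDensity_eq_lintegral_mul _ hd2 hFs.lintegral_prod_right']
  have hinner : ∀ α : ℂ, ENNReal.ofReal (verblunskyDensity N ‖α‖) *
      ∫⁻ c, F (szegoStep α c) ∂(stableLaw N)
      = ENNReal.ofReal (((N + 1).factorial : ℝ) / Real.pi ^ (N + 1)) * ∫⁻ c, G (Fin.cons α c) := by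
    intro α
    by_cases hα : ‖α‖ < 1
    · have hα2 : ‖α‖ ^ 2 < 1 := pow_lt_one₀ (norm_nonneg _) hα two_ne_zero
      have h1 : ∫⁻ c, F (szegoStep α c) ∂(stableLaw N)
          = ENNReal.ofReal ((N.factorial : ℝ) / Real.pi ^ N) *
            ∫⁻ c, G (Fin.cons α (szegoLinear N α c)) := by
        rw [stableLaw, lintegral_smul_measure, ← lintegral_indicator hS, smul_eq_mul]
        congr 2
        funext c
        change _ = G (szegoStep α c)
        by_cases hc : c ∈ stableCoeffs N
        · rw [Set.indicator_of_mem hc, hG,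
            Set.indicator_of_mem ((szegoStep_mem_stableCoeffs_iff hα).2 hc)]
        · rw [Set.indicator_of_notMem hc, hG,
            Set.indicator_of_notMem fun h => hc ((szegoStep_mem_stableCoeffs_iff hα).1 h)]
      have hGc : Measurable fun c : Fin N → ℂ => G (Fin.cons α c) :=
        hGm.comp (hcons.comp (measurable_const.prodMk measurable_id))
      rw [h1, ← lintegral_szegoLinear hα hGc, verblunskyDensity, if_pos hα, ← mul_assoc, ← mul_assoc,
        ← ENNReal.ofReal_mul (by positivity), ← ENNReal.ofReal_mul (by positivity)]
      congr 2
      rw [Nat.factorial_succ]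
      push_cast
      field_simp
      ring
    · have h0 : ∀ c : Fin N → ℂ, G (Fin.cons α c) = 0 := by
        intro c
        simp only [hG]
        refine Set.indicator_of_notMem (fun h => hα ?_) _
        simpa using norm_zero_lt_of_mem_stableCoeffs h
      simp [h0, verblunskyDensity, hα]
  have hstep : ∀ α : ℂ, ((fun α : ℂ => ENNReal.ofReal (verblunskyDensity N ‖α‖)) *
      fun α => ∫⁻ c, F (szegoStep α c) ∂(stableLaw N)) α
      = ENNReal.ofReal (((N + 1).factorial : ℝ) / Real.pi ^ (N + 1)) * ∫⁻ c, G (Fin.cons α c) := hinner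
  have hGp : Measurable fun p : ℂ × (Fin N → ℂ) => G (Fin.cons p.1 p.2) := hGm.comp hcons
  rw [lintegral_congr hstep, lintegral_const_mul _ hGp.lintegral_prod_right', stableLaw,
    lintegral_smul_measure, ← lintegral_indicator hS1, smul_eq_mul]
  congr 1
  rw [← lintegral_prod _ hGp.aemeasurable]
  have hvp := (volume_preserving_piFinSuccAbove (fun _ : Fin (N + 1) => ℂ) 0).symm
  rw [← hvp.lintegral_comp_emb (MeasurableEquiv.measurableEmbedding _)]
  refine lintegral_congr fun p => ?_
  simp [hG, MeasurableEquiv.piFinSuccAbove, Fin.insertNth_zero', Fin.insertNthEquiv]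

theorem stableLaw_zero : stableLaw 0 = Measure.dirac Fin.elim0 := by
  have h : stableCoeffs 0 = Set.univ := by
    refine Set.eq_univ_of_forall fun c z _ => ?_
    simp [monicEval]
  rw [stableLaw, h, Measure.restrict_univ]
  simp only [Nat.factorial_zero, Nat.cast_one, pow_zero, div_one, ENNReal.ofReal_one, one_smul]
  exact (Measure.volume_pi_eq_dirac _)

/-! ### From roots to coefficients -/

theorem differentiable_coeff_prod {N : ℕ} (s : Finset (Fin N)) (k : ℕ) :
    Differentiable ℂ fun w : Fin N → ℂ => (∏ j ∈ s, (Polynomial.X - Polynomial.C (w j))).coeff k := by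
  classical
  induction s using Finset.induction generalizing k with
  | empty => simp
  | insert a s ha ih =>
    have hp : Differentiable ℂ fun w : Fin N → ℂ => w a := by fun_prop
    rcases k with _ | k
    · simp only [Finset.prod_insert ha, Polynomial.mul_coeff_zero, Polynomial.coeff_sub,
        Polynomial.coeff_X_zero, Polynomial.coeff_C_zero, zero_sub]
      exact hp.neg.mul (ih 0)
    · simp only [Finset.prod_insert ha, sub_mul, Polynomial.coeff_sub, Polynomial.coeff_X_mul,
        Polynomial.coeff_C_mul]
      exact (ih k).sub (hp.mul (ih (k + 1)))

theorem differentiable_rootsToCoeff {N : ℕ} :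
    Differentiable ℂ (rootsToCoeff : (Fin N → ℂ) → (Fin N → ℂ)) :=
  differentiable_pi.2 fun i => differentiable_coeff_prod Finset.univ i

/-- Differentiate `u ↦ ∏ (w_l - u_j)` at `u = w` with the evaluation point `w_l` frozen: only the
factor `j = l` vanishes, so only its derivative survives. -/
theorem vandermonde_mulVec_fderiv_rootsToCoeff {N : ℕ} (w v : Fin N → ℂ) (l : Fin N) :
    ∑ i : Fin N, w l ^ (i : ℕ) * fderiv ℂ rootsToCoeff w v i = -(∏ k ∈ {l}ᶜ, (w l - w k)) * v l := by
  classical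
  have h1 : HasFDerivAt rootsToCoeff (fderiv ℂ rootsToCoeff w) w :=
    (differentiable_rootsToCoeff w).hasFDerivAt
  have h2 : HasFDerivAt (fun u : Fin N → ℂ => monicEval (rootsToCoeff u) (w l))
      (∑ i : Fin N, (w l ^ (i : ℕ)) • (ContinuousLinearMap.proj i ∘L fderiv ℂ rootsToCoeff w)) w := by
    simp only [monicEval]
    refine HasFDerivAt.const_add _ (HasFDerivAt.fun_sum fun i _ => ?_)
    exact ((hasFDerivAt_pi'.1 h1) i).mul_const _
  have h3 : HasFDerivAt (fun u : Fin N → ℂ => ∏ j, (w l - u j))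
      (∑ i, (∏ j ∈ Finset.univ.erase i, (w l - w j)) •
        (-(ContinuousLinearMap.proj i : (Fin N → ℂ) →L[ℂ] ℂ))) w := by
    refine HasFDerivAt.finsetProd (g := fun i (u : Fin N → ℂ) => w l - u i) fun i _ => ?_
    exact (ContinuousLinearMap.proj (R := ℂ) (φ := fun _ : Fin N => ℂ) i).hasFDerivAt.const_sub _
  have h4 : (fun u : Fin N → ℂ => monicEval (rootsToCoeff u) (w l)) = fun u => ∏ j, (w l - u j) := by
    funext u
    exact monicEval_rootsToCoeff u (w l)
  rw [h4] at h2
  have h5 := congrArg (fun f : (Fin N → ℂ) →L[ℂ] ℂ => f v) (h2.unique h3)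
  simp only [_root_.sum_apply, _root_.smul_apply, ContinuousLinearMap.comp_apply,
    ContinuousLinearMap.proj_apply, _root_.neg_apply, smul_eq_mul] at h5
  rw [h5, Finset.sum_eq_single l]
  · rw [Finset.compl_singleton]
    ring
  · intro i _ hi
    rw [Finset.prod_eq_zero (i := l) (by simp [hi.symm]) (sub_self _), zero_mul]
  · simp

theorem norm_det_vandermonde_sq {N : ℕ} (w : Fin N → ℂ) :
    ‖(Matrix.vandermonde w).det‖ ^ 2 = ∏ l, ∏ k ∈ {l}ᶜ, ‖w l - w k‖ := by
  have h := Finset.prod_prod_Ioi_mul_eq_prod_prod_off_diag (fun j i => ‖w i - w j‖)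
  rw [← h, Matrix.det_vandermonde, sq, norm_prod, ← Finset.prod_mul_distrib]
  refine Finset.prod_congr rfl fun i _ => ?_
  rw [norm_prod, ← Finset.prod_mul_distrib]
  refine Finset.prod_congr rfl fun j _ => ?_
  rw [norm_sub_rev (w i)]

/-- The Vandermonde matrix times the Jacobian is diagonal, and the diagonal has a product of modulus
`|det V|²`; one factor `det V` cancels. The real Jacobian is the square of this complex one. -/
theorem norm_det_fderiv_rootsToCoeff {N : ℕ} {w : Fin N → ℂ} (hw : Function.Injective w) :
    ‖LinearMap.det (fderiv ℂ rootsToCoeff w : (Fin N → ℂ) →ₗ[ℂ] (Fin N → ℂ))‖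
      = ‖(Matrix.vandermonde w).det‖ := by
  set M := LinearMap.toMatrix' (fderiv ℂ rootsToCoeff w : (Fin N → ℂ) →ₗ[ℂ] (Fin N → ℂ)) with hM
  have h1 : Matrix.vandermonde w * M = Matrix.diagonal fun l => -(∏ k ∈ {l}ᶜ, (w l - w k)) := by
    ext l j
    have := vandermonde_mulVec_fderiv_rootsToCoeff w (Pi.single j 1) l
    rw [Matrix.mul_apply, Matrix.diagonal_apply]
    simp only [Matrix.vandermonde_apply, hM, LinearMap.toMatrix'_apply]
    refine this.trans ?_
    rw [Pi.single_apply]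
    split_ifs <;> simp
  have h2 := congrArg (fun A : Matrix (Fin N) (Fin N) ℂ => ‖A.det‖) h1
  -- The signs on the diagonal disappear in the norm.
  simp only [Matrix.det_mul, norm_mul, Matrix.det_diagonal, norm_prod, norm_neg] at h2
  rw [← norm_det_vandermonde_sq, sq, hM, LinearMap.det_toMatrix'] at h2
  exact mul_left_cancel₀ (norm_ne_zero_iff.2 (Matrix.det_vandermonde_ne_zero_iff.2 hw)) h2

/-- Tuples in the unit disk with strictly increasing real parts. -/
def orderedTuples (N : ℕ) : Set (Fin N → ℂ) := {w | (∀ i, ‖w i‖ < 1) ∧ StrictMono fun i => (w i).re}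

/-- Tuples in the unit disk. -/
def diskTuples (N : ℕ) : Set (Fin N → ℂ) := {w | ∀ i, ‖w i‖ < 1}

theorem measurableSet_diskTuples (N : ℕ) : MeasurableSet (diskTuples N) := by
  rw [diskTuples, Set.ofPred_forall]
  exact MeasurableSet.iInter fun i => measurableSet_lt (by fun_prop) measurable_const

theorem measurableSet_orderedTuples (N : ℕ) : MeasurableSet (orderedTuples N) := by
  have h : orderedTuples N = diskTuples N ∩
      ⋂ (i : Fin N), ⋂ (j : Fin N), ⋂ (_ : i < j), {w : Fin N → ℂ | (w i).re < (w j).re} := by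
    ext w
    simp only [orderedTuples, diskTuples, StrictMono, Set.mem_ofPred_eq, Set.mem_inter_iff, Set.mem_iInter]
  rw [h]
  refine (measurableSet_diskTuples N).inter ?_
  exact MeasurableSet.iInter fun i => MeasurableSet.iInter fun j => MeasurableSet.iInter fun _ =>
    measurableSet_lt (Complex.measurable_re.comp (measurable_pi_apply i))
      (Complex.measurable_re.comp (measurable_pi_apply j))

theorem range_eq_of_rootsToCoeff_eq {N : ℕ} {w w' : Fin N → ℂ} (h : rootsToCoeff w = rootsToCoeff w') :
    Set.range w ⊆ Set.range w' := by
  rintro _ ⟨i, rfl⟩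
  have h1 := monicEval_rootsToCoeff w (w i)
  rw [h, monicEval_rootsToCoeff, Finset.prod_eq_zero (f := fun j => w i - w j) (Finset.mem_univ i)
    (sub_self _), Finset.prod_eq_zero_iff] at h1
  obtain ⟨j, -, hj⟩ := h1
  exact ⟨j, (sub_eq_zero.1 hj).symm⟩

/-- The coefficients determine the set of roots, and the strict order of the real parts determines
their labelling. So `orderedTuples` is a fundamental domain for permuting roots, up to tuples with
equal real parts. -/
theorem injOn_rootsToCoeff (N : ℕ) : Set.InjOn rootsToCoeff (orderedTuples N) := by
  intro w hw w' hw' h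
  have hr : Set.range w = Set.range w' :=
    (range_eq_of_rootsToCoeff_eq h).antisymm (range_eq_of_rootsToCoeff_eq h.symm)
  have hre : (fun i => (w i).re) = fun i => (w' i).re := by
    refine (StrictMono.range_inj hw.2 hw'.2).1 ?_
    have h1 : Set.range (fun i => (w i).re) = Complex.re '' Set.range w := by
      rw [← Set.range_comp]; rfl
    have h2 : Set.range (fun i => (w' i).re) = Complex.re '' Set.range w' := by
      rw [← Set.range_comp]; rfl
    rw [h1, h2, hr]
  funext i
  obtain ⟨j, hj⟩ : w i ∈ Set.range w' := hr ▸ Set.mem_range_self i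
  have h3 : (w' j).re = (w' i).re := by rw [hj, ← congrFun hre i]
  rw [← hj, hw'.2.injective h3]

/-- Tuples with two equal real parts. -/
def degenerateTuples (N : ℕ) : Set (Fin N → ℂ) := {w | ∃ i j, i ≠ j ∧ (w i).re = (w j).re}

theorem volume_degenerateTuples (N : ℕ) : volume (degenerateTuples N) = 0 := by
  have h : degenerateTuples N = ⋃ (i : Fin N), ⋃ (j : Fin N), ⋃ (_ : i ≠ j),
      {w : Fin N → ℂ | (w i).re = (w j).re} := by
    ext w
    simp [degenerateTuples]
  rw [h]
  simp only [measure_iUnion_null_iff]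
  intro i j hij
  let f : (Fin N → ℂ) →ₗ[ℝ] ℝ :=
    Complex.reLm ∘ₗ ((LinearMap.proj i : (Fin N → ℂ) →ₗ[ℝ] ℂ) - (LinearMap.proj j : (Fin N → ℂ) →ₗ[ℝ] ℂ))
  have h1 : {w : Fin N → ℂ | (w i).re = (w j).re} = (LinearMap.ker f : Set (Fin N → ℂ)) := by
    ext w
    simp [f, sub_eq_zero]
  rw [h1]
  refine Measure.addHaar_submodule _ _ fun htop => ?_
  have h2 : f (Pi.single i 1) = 0 := by
    rw [← LinearMap.mem_ker, htop]
    exact Submodule.mem_top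
  simp [f, hij.symm] at h2

theorem rootsToCoeff_comp_perm {N : ℕ} (w : Fin N → ℂ) (σ : Equiv.Perm (Fin N)) :
    rootsToCoeff (w ∘ σ) = rootsToCoeff w := by
  funext i
  simp only [rootsToCoeff, Function.comp_apply]
  rw [Equiv.prod_comp σ fun j => Polynomial.X - Polynomial.C (w j)]

theorem strictMono_comp_sort {N : ℕ} {w : Fin N → ℂ} (hw : w ∉ degenerateTuples N) :
    StrictMono fun i => ((w ∘ Tuple.sort fun i => (w i).re) i).re := by
  have hmono := Tuple.monotone_sort fun i => (w i).re
  refine hmono.strictMono_of_injective fun i j hij => ?_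
  by_contra hne
  exact hw ⟨_, _, fun h => hne ((Tuple.sort fun i => (w i).re).injective h), hij⟩

theorem image_rootsToCoeff_ae_eq (N : ℕ) :
    rootsToCoeff '' orderedTuples N =ᵐ[volume] stableCoeffs N := by
  have hnull : volume (rootsToCoeff '' degenerateTuples N : Set (Fin N → ℂ)) = 0 :=
    addHaar_image_eq_zero_of_differentiableOn_of_addHaar_eq_zero volume
      ((differentiable_rootsToCoeff.restrictScalars ℝ).differentiableOn) (volume_degenerateTuples N)
  have hae : ∀ᵐ c : Fin N → ℂ, c ∉ rootsToCoeff '' degenerateTuples N := measure_eq_zero_iff_ae_notMem.1 hnull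
  filter_upwards [hae] with c hc
  apply propext
  change c ∈ rootsToCoeff '' orderedTuples N ↔ c ∈ stableCoeffs N
  constructor
  · rintro ⟨w, hw, rfl⟩
    exact rootsToCoeff_mem_stableCoeffs_iff.2 hw.1
  · intro hcs
    obtain ⟨w, rfl⟩ := exists_rootsToCoeff_eq c
    have hw : w ∉ degenerateTuples N := fun h => hc ⟨w, h, rfl⟩
    rw [rootsToCoeff_mem_stableCoeffs_iff] at hcs
    exact ⟨w ∘ Tuple.sort fun i => (w i).re, ⟨fun i => hcs _, strictMono_comp_sort hw⟩,
      rootsToCoeff_comp_perm w _⟩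

theorem lintegral_stableCoeffs_eq_orderedTuples {N : ℕ} (F : (Fin N → ℂ) → ℝ≥0∞) :
    ∫⁻ c in stableCoeffs N, F c = ∫⁻ w in orderedTuples N,
      ENNReal.ofReal (‖(Matrix.vandermonde w).det‖ ^ 2) * F (rootsToCoeff w) := by
  rw [← setLIntegral_congr (image_rootsToCoeff_ae_eq N),
    lintegral_image_eq_lintegral_abs_det_fderiv_mul volume (measurableSet_orderedTuples N)
      (f' := fun w => (fderiv ℂ rootsToCoeff w).restrictScalars ℝ)
      (fun w _ => ((differentiable_rootsToCoeff w).hasFDerivAt.restrictScalars ℝ).hasFDerivWithinAt)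
      (injOn_rootsToCoeff N)]
  refine setLIntegral_congr_fun (measurableSet_orderedTuples N) fun w hw => ?_
  have hinj : Function.Injective w := fun i j hij => hw.2.injective (congrArg Complex.re hij)
  congr 2
  have h1 : ((fderiv ℂ rootsToCoeff w).restrictScalars ℝ).det
      = LinearMap.det ((fderiv ℂ rootsToCoeff w : (Fin N → ℂ) →ₗ[ℂ] (Fin N → ℂ)).restrictScalars ℝ) := rfl
  rw [h1, LinearMap.det_restrictScalars, Algebra.norm_complex_apply, Complex.normSq_eq_norm_sq,
    norm_det_fderiv_rootsToCoeff hinj, abs_of_nonneg (by positivity)]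

/-- Up to a null set the disk tuples split into `N!` disjoint copies of the ordered ones, with equal
integrals by symmetry. This cancels the `N!` in `stableLaw`. -/
theorem lintegral_diskTuples_eq {N : ℕ} {h : (Fin N → ℂ) → ℝ≥0∞}
    (hsymm : ∀ (σ : Equiv.Perm (Fin N)) w, h (w ∘ σ) = h w) :
    ∫⁻ w in diskTuples N, h w = N.factorial * ∫⁻ w in orderedTuples N, h w := by
  classical
  set O : Equiv.Perm (Fin N) → Set (Fin N → ℂ) := fun σ => (fun w => w ∘ σ) ⁻¹' orderedTuples N with hO
  have hmp : ∀ σ : Equiv.Perm (Fin N), MeasurePreserving (fun w : Fin N → ℂ => w ∘ σ) volume volume := by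
    intro σ
    have := volume_measurePreserving_piCongrLeft (fun _ : Fin N => ℂ) σ.symm
    convert this using 1
    funext w i
    simpa using (MeasurableEquiv.piCongrLeft_apply_apply (β := fun _ : Fin N => ℂ) σ.symm w (σ i)).symm
  have hemb : ∀ σ : Equiv.Perm (Fin N), MeasurableEmbedding (fun w : Fin N → ℂ => w ∘ σ) := by
    intro σ
    have := (MeasurableEquiv.piCongrLeft (fun _ : Fin N => ℂ) σ.symm).measurableEmbedding
    convert this using 1
    funext w i
    simpa using (MeasurableEquiv.piCongrLeft_apply_apply (β := fun _ : Fin N => ℂ) σ.symm w (σ i)).symm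
  have hOm : ∀ σ, MeasurableSet (O σ) := fun σ =>
    (hmp σ).measurable (measurableSet_orderedTuples N)
  have hdisj : Pairwise (Function.onFun Disjoint O) := by
    intro σ τ hne
    refine Set.disjoint_left.2 fun w hσ hτ => hne ?_
    have h1 : StrictMono fun i => (w (σ i)).re := hσ.2
    have h2 : StrictMono fun i => (w (τ i)).re := hτ.2
    have h3 : (fun i => (w (σ i)).re) = fun i => (w (τ i)).re := by
      refine (StrictMono.range_inj h1 h2).1 ?_
      have e : ∀ σ : Equiv.Perm (Fin N), Set.range (fun i => (w (σ i)).re)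
          = Set.range fun i => (w i).re := fun σ => σ.surjective.range_comp fun i => (w i).re
      rw [e σ, e τ]
    have hinj : Function.Injective fun i => (w i).re := by
      intro i j hij
      obtain ⟨i, rfl⟩ := σ.surjective i
      obtain ⟨j, rfl⟩ := σ.surjective j
      rw [h1.injective hij]
    exact Equiv.ext fun i => hinj (congrFun h3 i)
  have hunion : diskTuples N =ᵐ[volume] (⋃ σ, O σ) := by
    have hae : ∀ᵐ w : Fin N → ℂ, w ∉ degenerateTuples N :=
      measure_eq_zero_iff_ae_notMem.1 (volume_degenerateTuples N)
    filter_upwards [hae] with w hw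
    apply propext
    change w ∈ diskTuples N ↔ w ∈ ⋃ σ, O σ
    rw [Set.mem_iUnion]
    constructor
    · intro hd
      exact ⟨Tuple.sort fun i => (w i).re, fun i => hd _, strictMono_comp_sort hw⟩
    · rintro ⟨σ, hσ⟩ i
      simpa using hσ.1 (σ.symm i)
  rw [setLIntegral_congr hunion, lintegral_iUnion hOm hdisj, tsum_fintype]
  have hterm : ∀ σ, ∫⁻ w in O σ, h w = ∫⁻ w in orderedTuples N, h w := by
    intro σ
    rw [← (hmp σ).setLIntegral_comp_preimage_emb (hemb σ) h (orderedTuples N)]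
    exact lintegral_congr fun w => (hsymm σ w).symm
  rw [Finset.sum_congr rfl fun σ _ => hterm σ, Finset.sum_const, Finset.card_univ, Fintype.card_perm,
    Fintype.card_fin, nsmul_eq_mul]

theorem norm_det_vandermonde_comp_perm {N : ℕ} (w : Fin N → ℂ) (σ : Equiv.Perm (Fin N)) :
    ‖(Matrix.vandermonde (w ∘ σ)).det‖ = ‖(Matrix.vandermonde w).det‖ := by
  have : Matrix.vandermonde (w ∘ σ) = (Matrix.vandermonde w).submatrix σ id := by
    ext i j
    simp [Matrix.vandermonde_apply]
  rw [this, Matrix.det_permute, norm_mul]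
  rcases Int.units_eq_one_or (Equiv.Perm.sign σ) with h | h <;> simp [h]

/-- The uniform law on stable polynomials in terms of the roots. -/
theorem stableLaw_apply {N : ℕ} {A : Set (Fin N → ℂ)} (hA : MeasurableSet A) :
    stableLaw N A = ENNReal.ofReal (1 / Real.pi ^ N) * ∫⁻ w in diskTuples N,
      (rootsToCoeff ⁻¹' A).indicator (fun w => ENNReal.ofReal (‖(Matrix.vandermonde w).det‖ ^ 2)) w := by
  have h1 : (stableLaw N) A = ENNReal.ofReal ((N.factorial : ℝ) / Real.pi ^ N) *
      ∫⁻ c in stableCoeffs N, A.indicator 1 c := by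
    rw [lintegral_indicator_one hA, stableLaw]
    rfl
  rw [h1, lintegral_stableCoeffs_eq_orderedTuples, lintegral_diskTuples_eq]
  · rw [← mul_assoc, ← ENNReal.ofReal_natCast, ← ENNReal.ofReal_mul (by positivity),
      one_div_mul_eq_div]
    congr 2
    funext w
    by_cases hw : rootsToCoeff w ∈ A
    · rw [Set.indicator_of_mem hw, Set.indicator_of_mem (Set.mem_preimage.2 hw), Pi.one_apply, mul_one]
    · rw [Set.indicator_of_notMem hw, Set.indicator_of_notMem (fun h => hw (Set.mem_preimage.1 h)), mul_zero]
  · intro σ w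
    by_cases hw : rootsToCoeff w ∈ A
    · rw [Set.indicator_of_mem (Set.mem_preimage.2 hw), Set.indicator_of_mem,
        norm_det_vandermonde_comp_perm]
      rwa [Set.mem_preimage, rootsToCoeff_comp_perm]
    · rw [Set.indicator_of_notMem (fun h => hw (Set.mem_preimage.1 h)), Set.indicator_of_notMem]
      rwa [Set.mem_preimage, rootsToCoeff_comp_perm]

/-! ### Root counts of the uniform law on stable polynomials -/

/-- The number of entries of a tuple in the open disk of radius `r`. -/
noncomputable def countInDisk {N : ℕ} (r : ℝ) (w : Fin N → ℂ) : ℕ := by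
  classical exact (Finset.univ.filter fun i => ‖w i‖ < r).card

theorem zeroCount_prod_sub {ι : Type*} (s : Finset ι) (w : ι → ℂ) {r : ℝ} [DecidablePred fun i => ‖w i‖ < r] :
    zeroCount (fun z => ∏ j ∈ s, (z - w j)) r = (s.filter fun i => ‖w i‖ < r).card := by
  classical
  induction s using Finset.induction with
  | empty =>
    simp only [Finset.prod_empty, Finset.filter_empty, Finset.card_empty, Nat.cast_zero]
    exact zeroCount_eq_zero_of_ne_zero fun _ _ => one_ne_zero
  | insert i s hi ih =>
    have hd : DifferentiableOn ℂ (fun z => ∏ j ∈ s, (z - w j)) (Metric.ball 0 r) := by fun_prop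
    simp only [Finset.prod_insert hi, Finset.filter_insert]
    split_ifs with h
    · rw [zeroCount_sub_mul (by simpa using h) hd, ih, Finset.card_insert_of_notMem (by simp [hi])]
      push_cast
      rfl
    · rw [zeroCount_mul_of_ne_zero (by fun_prop) hd, ih]
      intro z hz h0
      rw [sub_eq_zero.1 h0] at hz
      exact h (by simpa using hz)

theorem zeroCount_monicEval_rootsToCoeff {N : ℕ} (w : Fin N → ℂ) (r : ℝ) :
    zeroCount (monicEval (rootsToCoeff w)) r = countInDisk r w := by
  classical
  have : monicEval (rootsToCoeff w) = fun z => ∏ j, (z - w j) :=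
    funext fun z => monicEval_rootsToCoeff w z
  rw [this, zeroCount_prod_sub]
  rfl

/-! ### The generating function of the root count -/

/-- The radial weight with value `x` on `[0, r)` and `1` on `[r, 1)`. -/
noncomputable def stepWeight (r x y : ℝ) : ℝ := if y < r then x else if y < 1 then 1 else 0

theorem measurable_stepWeight (r x : ℝ) : Measurable (stepWeight r x) := by
  unfold stepWeight
  exact Measurable.ite measurableSet_Iio measurable_const
    (Measurable.ite measurableSet_Iio measurable_const measurable_const)

theorem integrable_monomial_stepWeight (r x : ℝ) (hr1 : r < 1) (a b : ℕ) :
    Integrable fun z : ℂ => z ^ a * (starRingEnd ℂ z) ^ b * (stepWeight r x ‖z‖ : ℂ) := by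
  have h1 : Integrable ((Metric.ball (0 : ℂ) 1).indicator fun _ => |x| + 1) :=
    (integrable_indicator_iff measurableSet_ball).2 (integrableOn_const measure_ball_lt_top.ne)
  refine h1.mono' ?_ (Filter.Eventually.of_forall fun z => ?_)
  · refine (Measurable.mul (by fun_prop) ?_).aestronglyMeasurable
    exact Complex.measurable_ofReal.comp ((measurable_stepWeight r x).comp measurable_norm)
  · rw [norm_mul, norm_mul, norm_pow, norm_pow, RCLike.norm_conj, Complex.norm_real]
    by_cases hz : ‖z‖ < 1
    · rw [Set.indicator_of_mem (by simpa using hz)]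
      have h2 : ‖z‖ ^ a * ‖z‖ ^ b ≤ 1 :=
        mul_le_one₀ (pow_le_one₀ (norm_nonneg _) hz.le) (by positivity) (pow_le_one₀ (norm_nonneg _) hz.le)
      have h3 : ‖stepWeight r x ‖z‖‖ ≤ |x| + 1 := by
        unfold stepWeight
        split_ifs <;> simp [abs_nonneg]
      calc _ ≤ 1 * ‖stepWeight r x ‖z‖‖ := by gcongr
        _ ≤ _ := by rwa [one_mul]
    · have h4 : stepWeight r x ‖z‖ = 0 := by
        unfold stepWeight
        rw [if_neg (by linarith), if_neg hz]
      rw [h4, norm_zero, mul_zero]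
      exact Set.indicator_nonneg (fun _ _ => by positivity) _

/-- Rotation by the angle `π / (a - b)` multiplies the integrand by `-1` and preserves the measure.
-/
theorem integral_monomial_radial_of_ne (g : ℝ → ℝ) {a b : ℕ} (hab : a ≠ b) :
    ∫ z : ℂ, z ^ a * (starRingEnd ℂ z) ^ b * (g ‖z‖ : ℂ) = 0 := by
  set θ : ℝ := Real.pi / ((a : ℝ) - b) with hθ
  have hab' : ((a : ℝ) - b) ≠ 0 := sub_ne_zero.2 (by exact_mod_cast hab)
  have hu : (Circle.exp θ : ℂ) ^ a * (starRingEnd ℂ (Circle.exp θ : ℂ)) ^ b = -1 := by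
    rw [← Circle.coe_inv_eq_conj, ← Circle.exp_neg, Circle.coe_exp, Circle.coe_exp, ← Complex.exp_nat_mul,
      ← Complex.exp_nat_mul, ← Complex.exp_add, ← Complex.exp_pi_mul_I]
    congr 1
    have : (Real.pi : ℂ) = ((a : ℂ) - b) * θ := by
      rw [hθ]
      push_cast
      have : ((a : ℂ) - b) ≠ 0 := by exact_mod_cast hab'
      field_simp
    rw [this]
    push_cast
    ring
  have h1 := (rotation (Circle.exp θ)).measurePreserving.integral_comp'
    (f := (rotation (Circle.exp θ)).toMeasurableEquiv)
    (fun z : ℂ => z ^ a * (starRingEnd ℂ z) ^ b * (g ‖z‖ : ℂ))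
  have h2 : ∀ z : ℂ, (fun z : ℂ => z ^ a * (starRingEnd ℂ z) ^ b * (g ‖z‖ : ℂ))
      ((rotation (Circle.exp θ)).toMeasurableEquiv z) = -(z ^ a * (starRingEnd ℂ z) ^ b * (g ‖z‖ : ℂ)) := by
    intro z
    have e : (rotation (Circle.exp θ)).toMeasurableEquiv z = (Circle.exp θ : ℂ) * z := rotation_apply _ _
    simp only [e, norm_mul, Circle.norm_coe, one_mul, map_mul, mul_pow]
    linear_combination z ^ a * (starRingEnd ℂ z) ^ b * (g ‖z‖ : ℂ) * hu
  rw [integral_congr_ae (Filter.Eventually.of_forall h2), integral_neg] at h1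
  exact self_eq_neg.1 h1.symm

theorem integral_Ico_pow {s t : ℝ} (hst : s ≤ t) (n : ℕ) :
    ∫ y in Set.Ico s t, y ^ n = (t ^ (n + 1) - s ^ (n + 1)) / (n + 1) := by
  rw [integral_Ico_eq_integral_Ioc, ← intervalIntegral.integral_of_le hst, integral_pow]

theorem integral_monomial_stepWeight {r x : ℝ} (hr0 : 0 < r) (hr1 : r < 1) (k : ℕ) :
    ∫ z : ℂ, z ^ k * (starRingEnd ℂ z) ^ k * (stepWeight r x ‖z‖ : ℂ)
      = ((Real.pi / (k + 1) * (1 - r ^ (2 * (k + 1)) + r ^ (2 * (k + 1)) * x) : ℝ) : ℂ) := by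
  have h1 : ∀ z : ℂ, z ^ k * (starRingEnd ℂ z) ^ k * (stepWeight r x ‖z‖ : ℂ)
      = ((‖z‖ ^ (2 * k) * stepWeight r x ‖z‖ : ℝ) : ℂ) := by
    intro z
    rw [← mul_pow, Complex.mul_conj, Complex.normSq_eq_norm_sq]
    push_cast
    rw [pow_mul]
  rw [integral_congr_ae (Filter.Eventually.of_forall h1), integral_complex_ofReal,
    integral_comp_norm_complex fun y => y ^ (2 * k) * stepWeight r x y]
  congr 1
  have h2 : ∫ y in Set.Ioi (0 : ℝ), y * (y ^ (2 * k) * stepWeight r x y)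
      = ∫ y : ℝ, (Set.Ico 0 r).indicator (fun y => x * y ^ (2 * k + 1)) y
          + (Set.Ico r 1).indicator (fun y => y ^ (2 * k + 1)) y := by
    rw [← integral_indicator measurableSet_Ioi]
    refine integral_congr_ae ?_
    filter_upwards [Measure.ae_ne volume (0 : ℝ)] with y hy0
    simp only [Set.indicator_apply, Set.mem_Ioi, Set.mem_Ico, stepWeight]
    by_cases hy : 0 < y
    · by_cases hyr : y < r
      · simp [hy, hyr, hy.le, not_le.2 hyr]; ring
      · by_cases hy1 : y < 1
        · simp [hy, hyr, hy1, not_lt.1 hyr]; ring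
        · simp [hy, hyr, hy1]
    · have : y < 0 := lt_of_le_of_ne (not_lt.1 hy) hy0
      simp [hy, not_le.2 this, not_le.2 (this.trans hr0)]
  have hi : ∀ s t : ℝ, IntegrableOn (fun y : ℝ => y ^ (2 * k + 1)) (Set.Ico s t) := fun s t =>
    ((continuous_pow _).continuousOn.integrableOn_compact isCompact_Icc).mono_set Set.Ico_subset_Icc_self
  rw [h2, integral_add, integral_indicator measurableSet_Ico, integral_indicator measurableSet_Ico,
    integral_const_mul, integral_Ico_pow hr0.le, integral_Ico_pow hr1.le]
  · push_cast
    have : ((k : ℝ) + 1) ≠ 0 := by positivity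
    have h3 : (2 * (k : ℝ) + 1 + 1) ≠ 0 := by positivity
    field_simp
    ring
  · exact (integrable_indicator_iff measurableSet_Ico).2 ((hi 0 r).const_mul x)
  · exact (integrable_indicator_iff measurableSet_Ico).2 (hi r 1)

/-- Expanding both determinants over permutations, orthogonality of monomials for a radial weight
leaves only `σ = τ`. The `N!` equal terms cancel the `∏ 1 / (k + 1)` from the radial integrals,
leaving a product of Bernoulli generating functions. -/
theorem integral_norm_det_vandermonde_sq_mul_prod {N : ℕ} {r x : ℝ} (hr0 : 0 < r) (hr1 : r < 1) :
    (Integrable fun w : Fin N → ℂ => ‖(Matrix.vandermonde w).det‖ ^ 2 * ∏ i, stepWeight r x ‖w i‖) ∧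
    ∫ w : Fin N → ℂ, ‖(Matrix.vandermonde w).det‖ ^ 2 * ∏ i, stepWeight r x ‖w i‖
      = Real.pi ^ N * ∏ k : Fin N, (1 - r ^ (2 * ((k : ℕ) + 1)) + r ^ (2 * ((k : ℕ) + 1)) * x) := by
  classical
  have hdet : ∀ w : Fin N → ℂ, (Matrix.vandermonde w).det
      = ∑ σ : Equiv.Perm (Fin N), ((Equiv.Perm.sign σ : ℤ) : ℂ) * ∏ i, w i ^ (σ i : ℕ) := by
    intro w
    rw [← Matrix.det_transpose, Matrix.det_apply']
    simp [Matrix.vandermonde_apply]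
  have hexp : ∀ w : Fin N → ℂ, ((‖(Matrix.vandermonde w).det‖ ^ 2 * ∏ i, stepWeight r x ‖w i‖ : ℝ) : ℂ)
      = ∑ σ : Equiv.Perm (Fin N), ∑ τ : Equiv.Perm (Fin N),
        ((Equiv.Perm.sign σ : ℤ) : ℂ) * ((Equiv.Perm.sign τ : ℤ) : ℂ) *
          ∏ i, (w i ^ (σ i : ℕ) * (starRingEnd ℂ (w i)) ^ (τ i : ℕ) * (stepWeight r x ‖w i‖ : ℂ)) := by
    intro w
    rw [Complex.ofReal_mul, Complex.ofReal_pow, ← Complex.mul_conj', hdet w, map_sum, Finset.sum_mul_sum,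
      Finset.sum_mul]
    refine Finset.sum_congr rfl fun σ _ => ?_
    rw [Finset.sum_mul]
    refine Finset.sum_congr rfl fun τ _ => ?_
    simp only [Finset.prod_mul_distrib, map_mul, map_prod, map_pow, map_intCast, Complex.ofReal_prod]
    ring
  have hint : ∀ σ τ : Equiv.Perm (Fin N), Integrable fun w : Fin N → ℂ =>
      ((Equiv.Perm.sign σ : ℤ) : ℂ) * ((Equiv.Perm.sign τ : ℤ) : ℂ) *
          ∏ i, (w i ^ (σ i : ℕ) * (starRingEnd ℂ (w i)) ^ (τ i : ℕ) * (stepWeight r x ‖w i‖ : ℂ)) := by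
    intro σ τ
    refine Integrable.const_mul ?_ _
    exact Integrable.fintype_prod (f := fun i z => z ^ (σ i : ℕ) * (starRingEnd ℂ z) ^ (τ i : ℕ) *
      (stepWeight r x ‖z‖ : ℂ)) fun i => integrable_monomial_stepWeight r x hr1 _ _
  have hval : ∀ σ τ : Equiv.Perm (Fin N), ∫ w : Fin N → ℂ,
      ((Equiv.Perm.sign σ : ℤ) : ℂ) * ((Equiv.Perm.sign τ : ℤ) : ℂ) *
          ∏ i, (w i ^ (σ i : ℕ) * (starRingEnd ℂ (w i)) ^ (τ i : ℕ) * (stepWeight r x ‖w i‖ : ℂ))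
      = if σ = τ then ((∏ k : Fin N, (Real.pi / ((k : ℕ) + 1) *
          (1 - r ^ (2 * ((k : ℕ) + 1)) + r ^ (2 * ((k : ℕ) + 1)) * x)) : ℝ) : ℂ) else 0 := by
    intro σ τ
    rw [integral_const_mul, integral_fintype_prod_volume_eq_prod (fun (i : Fin N) (z : ℂ) =>
      z ^ (σ i : ℕ) * (starRingEnd ℂ z) ^ (τ i : ℕ) * (stepWeight r x ‖z‖ : ℂ))]
    split_ifs with h
    · subst h
      simp only [integral_monomial_stepWeight hr0 hr1]
      rw [Equiv.prod_comp σ fun k : Fin N => ((Real.pi / ((k : ℕ) + 1) *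
          (1 - r ^ (2 * ((k : ℕ) + 1)) + r ^ (2 * ((k : ℕ) + 1)) * x) : ℝ) : ℂ), ← Complex.ofReal_prod]
      rcases Int.units_eq_one_or (Equiv.Perm.sign σ) with h | h <;> simp [h]
    · obtain ⟨i, hi⟩ : ∃ i, σ i ≠ τ i := by
        by_contra! hne
        exact h (Equiv.ext hne)
      rw [Finset.prod_eq_zero (Finset.mem_univ i), mul_zero]
      exact integral_monomial_radial_of_ne _ fun h => hi (Fin.ext h)
  have hI : Integrable fun w : Fin N → ℂ =>
      ((‖(Matrix.vandermonde w).det‖ ^ 2 * ∏ i, stepWeight r x ‖w i‖ : ℝ) : ℂ) := by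
    simp only [hexp]
    exact integrable_finsetSum _ fun σ _ => integrable_finsetSum _ fun τ _ => hint σ τ
  refine ⟨by simpa only [RCLike.re_eq_complex_re, Complex.ofReal_re] using hI.re, ?_⟩
  have h5 : (∫ w : Fin N → ℂ, ((‖(Matrix.vandermonde w).det‖ ^ 2 * ∏ i, stepWeight r x ‖w i‖ : ℝ) : ℂ))
      = ((Real.pi ^ N * ∏ k : Fin N, (1 - r ^ (2 * ((k : ℕ) + 1)) + r ^ (2 * ((k : ℕ) + 1)) * x) : ℝ) : ℂ) := by
    simp only [hexp]
    rw [integral_finsetSum _ fun σ _ => integrable_finsetSum _ fun τ _ => hint σ τ]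
    simp only [integral_finsetSum _ fun τ _ => hint _ τ, hval, Finset.sum_ite_eq, Finset.mem_univ, if_true,
      Finset.sum_const, Finset.card_univ, Fintype.card_perm, Fintype.card_fin, nsmul_eq_mul]
    rw [Finset.prod_mul_distrib, Finset.prod_div_distrib, Finset.prod_const, Finset.card_univ, Fintype.card_fin,
      Fin.prod_univ_eq_prod_range (fun k => (k : ℝ) + 1) N]
    have hf : (∏ k ∈ Finset.range N, ((k : ℝ) + 1)) = N.factorial := by
      rw [← Finset.prod_range_add_one_eq_factorial]
      push_cast
      rfl
    have hN : (N.factorial : ℝ) ≠ 0 := by positivity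
    rw [hf, ← Complex.ofReal_natCast, ← Complex.ofReal_mul]
    congr 1
    field_simp
    exact Finset.prod_congr rfl fun _ _ => by ring
  rw [integral_complex_ofReal] at h5
  exact_mod_cast h5

theorem differentiable_monicEval {N : ℕ} (c : Fin N → ℂ) : Differentiable ℂ (monicEval c) := by
  unfold monicEval
  fun_prop

theorem exists_monicEval_ne_zero {N : ℕ} (c : Fin N → ℂ) {R : ℝ} (hR : 0 < R) :
    ∃ z ∈ Metric.ball (0 : ℂ) R, monicEval c z ≠ 0 := by
  obtain ⟨w, rfl⟩ := exists_rootsToCoeff_eq c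
  have h1 : (Metric.ball (0 : ℂ) R).Infinite := infinite_of_mem_nhds 0 (Metric.ball_mem_nhds 0 hR)
  obtain ⟨z, hz, hzw⟩ := h1.exists_notMem_finset (Finset.univ.image w)
  refine ⟨z, hz, ?_⟩
  rw [monicEval_rootsToCoeff, Finset.prod_ne_zero_iff]
  intro j _ h0
  exact hzw (Finset.mem_image.2 ⟨j, Finset.mem_univ j, (sub_eq_zero.1 h0).symm⟩)

/-- Lower semicontinuity from Hurwitz's theorem; its purpose is measurability of the event. -/
theorem isOpen_le_zeroCount_monicEval {N : ℕ} {r : ℝ} (hr : 0 < r) (m : ℕ) :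
    IsOpen {c : Fin N → ℂ | (m : ℕ∞) ≤ zeroCount (monicEval c) r} := by
  rw [isOpen_iff_eventually]
  intro c hc
  simp only [Set.mem_ofPred_eq] at hc ⊢
  refine eventually_le_zeroCount (R := r + 1) hr (by linarith)
    (Filter.Eventually.of_forall fun c' => (differentiable_monicEval c').differentiableOn)
    (differentiable_monicEval c).differentiableOn ?_ (exists_monicEval_ne_zero c (by linarith)) hc
  rw [Metric.tendstoUniformlyOn_iff]
  intro ε hε
  have h1 : Filter.Tendsto (fun c' : Fin N → ℂ => ∑ i, ‖c i - c' i‖ * r ^ (i : ℕ)) (nhds c) (nhds 0) := by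
    have : Continuous fun c' : Fin N → ℂ => ∑ i, ‖c i - c' i‖ * r ^ (i : ℕ) := by fun_prop
    simpa using this.tendsto c
  filter_upwards [h1.eventually_lt_const hε] with c' hc' z hz
  refine lt_of_le_of_lt ?_ hc'
  rw [dist_eq_norm, monicEval, monicEval, add_sub_add_left_eq_sub, ← Finset.sum_sub_distrib]
  refine norm_sum_le_of_le _ fun i _ => ?_
  rw [← sub_mul, norm_mul, norm_pow]
  have : ‖z‖ ≤ r := by simpa using hz
  gcongr

theorem measurable_countInDisk {N : ℕ} (r : ℝ) : Measurable (countInDisk r : (Fin N → ℂ) → ℕ) := by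
  classical
  have h : (countInDisk r : (Fin N → ℂ) → ℕ) = fun w => ∑ i, if ‖w i‖ < r then 1 else 0 := by
    funext w
    rw [countInDisk, Finset.card_filter]
  rw [h]
  exact Finset.measurable_sum _ fun i _ =>
    Measurable.ite (measurableSet_lt (by fun_prop) measurable_const) measurable_const measurable_const

theorem countInDisk_le {N : ℕ} (r : ℝ) (w : Fin N → ℂ) : countInDisk r w ≤ N := by
  classical
  rw [countInDisk]
  exact (Finset.card_le_univ _).trans (by simp)

theorem prod_stepWeight {N : ℕ} {r : ℝ} (hr1 : r < 1) (x : ℝ) (w : Fin N → ℂ) :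
    ∏ i, stepWeight r x ‖w i‖ = (diskTuples N).indicator (fun w => x ^ countInDisk r w) w := by
  classical
  by_cases hw : w ∈ diskTuples N
  · rw [Set.indicator_of_mem hw]
    have h1 : ∀ i, stepWeight r x ‖w i‖ = if ‖w i‖ < r then x else 1 := by
      intro i
      unfold stepWeight
      rw [if_pos (hw i)]
    rw [Finset.prod_congr rfl fun i _ => h1 i, Finset.prod_ite, Finset.prod_const, Finset.prod_const_one, mul_one,
      countInDisk]
  · rw [Set.indicator_of_notMem hw]
    obtain ⟨i, hi⟩ : ∃ i, ¬ ‖w i‖ < 1 := by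
      by_contra! h
      exact hw h
    refine Finset.prod_eq_zero (Finset.mem_univ i) ?_
    unfold stepWeight
    rw [if_neg (by linarith [not_lt.1 hi]), if_neg hi]

/-- The probability that a uniform stable polynomial of degree `N` has `j` roots in the disk. -/
noncomputable def rootCountWeight (N : ℕ) (r : ℝ) (j : ℕ) : ℝ :=
  (1 / Real.pi ^ N) * ∫ w : Fin N → ℂ, (diskTuples N ∩ {w | countInDisk r w = j}).indicator
    (fun w => ‖(Matrix.vandermonde w).det‖ ^ 2) w

theorem integrable_indicator_vandermonde {N : ℕ} {r : ℝ} (hr0 : 0 < r) (hr1 : r < 1) (j : ℕ) :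
    Integrable ((diskTuples N ∩ {w | countInDisk r w = j}).indicator
      (fun w : Fin N → ℂ => ‖(Matrix.vandermonde w).det‖ ^ 2)) := by
  have h1 := (integral_norm_det_vandermonde_sq_mul_prod (N := N) (x := 1) hr0 hr1).1
  have h2 := h1.indicator (measurable_countInDisk (N := N) r (measurableSet_singleton j))
  refine h2.congr (Filter.Eventually.of_forall fun w => ?_)
  by_cases hj : countInDisk r w = j
  · rw [Set.indicator_of_mem (by simpa using hj), prod_stepWeight hr1]
    by_cases hw : w ∈ diskTuples N
    · rw [Set.indicator_of_mem hw, Set.indicator_of_mem (Set.mem_inter hw (show w ∈ {w | countInDisk r w = j} from hj))]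
      simp
    · rw [Set.indicator_of_notMem hw, Set.indicator_of_notMem fun h => hw h.1, mul_zero]
  · rw [Set.indicator_of_notMem (by simpa using hj), Set.indicator_of_notMem fun h => hj h.2]

theorem rootCountWeight_nonneg (N : ℕ) (r : ℝ) (j : ℕ) : 0 ≤ rootCountWeight N r j :=
  mul_nonneg (by positivity) (integral_nonneg fun _ => Set.indicator_nonneg (fun _ _ => by positivity) _)

/-- The step weights multiply to `x` to the number of roots in the small disk, so the previous
integral is sorted by that number. -/
theorem sum_rootCountWeight_mul_pow {N : ℕ} {r : ℝ} (hr0 : 0 < r) (hr1 : r < 1) (x : ℝ) :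
    ∑ j ∈ Finset.range (N + 1), rootCountWeight N r j * x ^ j
      = ∏ k ∈ Finset.range N, (1 - r ^ (2 * (k + 1)) + r ^ (2 * (k + 1)) * x) := by
  have h1 := (integral_norm_det_vandermonde_sq_mul_prod (N := N) (x := x) hr0 hr1).2
  have h2 : ∀ w : Fin N → ℂ, ‖(Matrix.vandermonde w).det‖ ^ 2 * ∏ i, stepWeight r x ‖w i‖
      = ∑ j ∈ Finset.range (N + 1), (diskTuples N ∩ {w | countInDisk r w = j}).indicator
          (fun w => ‖(Matrix.vandermonde w).det‖ ^ 2) w * x ^ j := by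
    intro w
    rw [prod_stepWeight hr1, Finset.sum_eq_single (countInDisk r w)]
    · by_cases hw : w ∈ diskTuples N
      · rw [Set.indicator_of_mem hw, Set.indicator_of_mem
          (Set.mem_inter hw (show w ∈ {w' | countInDisk r w' = countInDisk r w} from rfl))]
      · rw [Set.indicator_of_notMem hw, Set.indicator_of_notMem fun h => hw h.1, mul_zero, zero_mul]
    · intro j _ hj
      rw [Set.indicator_of_notMem fun h => hj h.2.symm, zero_mul]
    · intro h
      exact absurd (Finset.mem_range.2 (Nat.lt_succ_of_le (countInDisk_le r w))) h
  rw [integral_congr_ae (Filter.Eventually.of_forall h2), integral_finsetSum _ fun j _ =>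
    (integrable_indicator_vandermonde hr0 hr1 j).mul_const _] at h1
  simp only [integral_mul_const] at h1
  rw [← Fin.prod_univ_eq_prod_range (fun k => (1 - r ^ (2 * (k + 1)) + r ^ (2 * (k + 1)) * x)) N]
  have hpi : Real.pi ^ N ≠ 0 := by positivity
  rw [← mul_right_inj' hpi, ← h1, Finset.mul_sum]
  refine Finset.sum_congr rfl fun j _ => ?_
  rw [rootCountWeight]
  field_simp

theorem stableLaw_le_zeroCount {N : ℕ} {r : ℝ} (hr0 : 0 < r) (hr1 : r < 1) (m : ℕ) :
    stableLaw N {c | (m : ℕ∞) ≤ zeroCount (monicEval c) r}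
      = ENNReal.ofReal (∑ j ∈ Finset.range (N + 1) with m ≤ j, rootCountWeight N r j) := by
  rw [stableLaw_apply (isOpen_le_zeroCount_monicEval hr0 m).measurableSet,
    ← lintegral_indicator (measurableSet_diskTuples N)]
  simp only [rootCountWeight]
  rw [← Finset.mul_sum, ENNReal.ofReal_mul (by positivity)]
  congr 1
  rw [← integral_finsetSum _ fun j _ => integrable_indicator_vandermonde hr0 hr1 j,
    ofReal_integral_eq_lintegral_ofReal
      (integrable_finsetSum _ fun j _ => integrable_indicator_vandermonde hr0 hr1 j)
      (Filter.Eventually.of_forall fun w => Finset.sum_nonneg fun j _ =>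
        Set.indicator_nonneg (fun _ _ => by positivity) _)]
  refine lintegral_congr fun w => ?_
  by_cases hw : w ∈ diskTuples N
  · rw [Set.indicator_of_mem hw]
    by_cases hm : m ≤ countInDisk r w
    · rw [Set.indicator_of_mem, Finset.sum_eq_single (countInDisk r w),
        Set.indicator_of_mem
          (Set.mem_inter hw (show w ∈ {w' | countInDisk r w' = countInDisk r w} from rfl))]
      · intro j _ hj
        rw [Set.indicator_of_notMem fun h => hj h.2.symm]
      · intro h
        exact absurd (Finset.mem_filter.2
          ⟨Finset.mem_range.2 (Nat.lt_succ_of_le (countInDisk_le r w)), hm⟩) h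
      · simp only [Set.mem_preimage, Set.mem_ofPred_eq, zeroCount_monicEval_rootsToCoeff]
        exact_mod_cast hm
    · rw [Set.indicator_of_notMem, Finset.sum_eq_zero, ENNReal.ofReal_zero]
      · intro j hj
        rw [Set.indicator_of_notMem]
        rintro ⟨-, h⟩
        simp only [Set.mem_ofPred_eq] at h
        exact hm (h ▸ (Finset.mem_filter.1 hj).2)
      · simp only [Set.mem_preimage, Set.mem_ofPred_eq, zeroCount_monicEval_rootsToCoeff]
        exact_mod_cast hm
  · rw [Set.indicator_of_notMem hw, Finset.sum_eq_zero, ENNReal.ofReal_zero]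
    intro j _
    rw [Set.indicator_of_notMem fun h => hw h.1]

/-! ### Tails of Bernoulli sums -/

/-- The probability generating polynomial of a sum of independent Bernoulli variables. -/
noncomputable def bernoulliSumPoly (p : ℕ → ℝ) (N : ℕ) : Polynomial ℝ :=
  ∏ k ∈ Finset.range N, (Polynomial.C (1 - p k) + Polynomial.C (p k) * Polynomial.X)

theorem bernoulliSumPoly_succ (p : ℕ → ℝ) (N : ℕ) :
    bernoulliSumPoly p (N + 1) = Polynomial.C (1 - p N) * bernoulliSumPoly p N
      + Polynomial.C (p N) * (Polynomial.X * bernoulliSumPoly p N) := by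
  rw [bernoulliSumPoly, Finset.prod_range_succ, bernoulliSumPoly]
  ring

theorem coeff_bernoulliSumPoly_nonneg {p : ℕ → ℝ} (hp0 : ∀ k, 0 ≤ p k) (hp1 : ∀ k, p k ≤ 1) (N j : ℕ) :
    0 ≤ (bernoulliSumPoly p N).coeff j := by
  induction N generalizing j with
  | zero =>
    rw [bernoulliSumPoly, Finset.prod_range_zero, Polynomial.coeff_one]
    split_ifs <;> norm_num
  | succ N ih =>
    rw [bernoulliSumPoly_succ, Polynomial.coeff_add, Polynomial.coeff_C_mul, Polynomial.coeff_C_mul]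
    refine add_nonneg (mul_nonneg (sub_nonneg.2 (hp1 N)) (ih j)) (mul_nonneg (hp0 N) ?_)
    rcases j with _ | j
    · simp
    · rw [Polynomial.coeff_X_mul]
      exact ih j

theorem natDegree_bernoulliSumPoly_le (p : ℕ → ℝ) (N : ℕ) : (bernoulliSumPoly p N).natDegree ≤ N := by
  refine (Polynomial.natDegree_prod_le _ _).trans ?_
  refine (Finset.sum_le_card_nsmul _ _ 1 fun k _ => ?_).trans (by simp)
  rw [add_comm]
  exact Polynomial.natDegree_linear_le

theorem coeff_self_bernoulliSumPoly (p : ℕ → ℝ) (N : ℕ) :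
    (bernoulliSumPoly p N).coeff N = ∏ k ∈ Finset.range N, p k := by
  induction N with
  | zero => simp [bernoulliSumPoly]
  | succ N ih =>
    rw [bernoulliSumPoly_succ, Polynomial.coeff_add, Polynomial.coeff_C_mul, Polynomial.coeff_C_mul,
      Polynomial.coeff_X_mul, ih, Polynomial.coeff_eq_zero_of_natDegree_lt
        (Nat.lt_succ_of_le (natDegree_bernoulliSumPoly_le p N)), Finset.prod_range_succ]
    ring

theorem sum_coeff_bernoulliSumPoly (p : ℕ → ℝ) (N : ℕ) :
    ∑ j ∈ Finset.range (N + 1), (bernoulliSumPoly p N).coeff j = 1 := by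
  have h := Polynomial.eval_eq_sum_range' (Nat.lt_succ_of_le (natDegree_bernoulliSumPoly_le p N)) 1
  simp only [one_pow, mul_one] at h
  rw [← h, bernoulliSumPoly, Polynomial.eval_prod]
  simp

theorem sum_coeff_bernoulliSumPoly_succ_le {p : ℕ → ℝ} (hp0 : ∀ k, 0 ≤ p k) (hp1 : ∀ k, p k ≤ 1) (N m : ℕ) :
    ∑ j ∈ Finset.range m, (bernoulliSumPoly p (N + 1)).coeff j
      ≤ ∑ j ∈ Finset.range m, (bernoulliSumPoly p N).coeff j := by
  have h1 : ∑ j ∈ Finset.range m, (Polynomial.X * bernoulliSumPoly p N).coeff j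
      ≤ ∑ j ∈ Finset.range m, (bernoulliSumPoly p N).coeff j := by
    rcases m with _ | m
    · simp
    · rw [Finset.sum_range_succ', Finset.sum_range_succ]
      simp only [Polynomial.coeff_X_mul, Polynomial.mul_coeff_zero, Polynomial.coeff_X_zero, zero_mul, add_zero]
      exact le_add_of_nonneg_right (coeff_bernoulliSumPoly_nonneg hp0 hp1 N m)
  simp only [bernoulliSumPoly_succ, Polynomial.coeff_add, Polynomial.coeff_C_mul, Finset.sum_add_distrib,
    ← Finset.mul_sum]
  nlinarith [mul_le_mul_of_nonneg_left h1 (hp0 N)]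

/-- Extra Bernoulli variables only decrease the probability of fewer than `m` successes. With
exactly `m` variables, its complement is that all of them succeed. -/
theorem sum_coeff_bernoulliSumPoly_le {p : ℕ → ℝ} (hp0 : ∀ k, 0 ≤ p k) (hp1 : ∀ k, p k ≤ 1) {N m : ℕ}
    (hmN : m ≤ N) :
    ∑ j ∈ Finset.range m, (bernoulliSumPoly p N).coeff j ≤ 1 - ∏ k ∈ Finset.range m, p k := by
  induction N, hmN using Nat.le_induction with
  | base =>
    have h := sum_coeff_bernoulliSumPoly p m
    rw [Finset.sum_range_succ, coeff_self_bernoulliSumPoly] at h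
    linarith
  | succ N _ ih => exact (sum_coeff_bernoulliSumPoly_succ_le hp0 hp1 N m).trans ih

theorem rootCountWeight_eq_coeff {N : ℕ} {r : ℝ} (hr0 : 0 < r) (hr1 : r < 1) {j : ℕ} (hj : j ≤ N) :
    rootCountWeight N r j = (bernoulliSumPoly (fun k => r ^ (2 * (k + 1))) N).coeff j := by
  have h : ∑ j ∈ Finset.range (N + 1), Polynomial.C (rootCountWeight N r j) * Polynomial.X ^ j
      = bernoulliSumPoly (fun k => r ^ (2 * (k + 1))) N := by
    refine Polynomial.funext fun x => ?_
    rw [bernoulliSumPoly, Polynomial.eval_prod, Polynomial.eval_finsetSum]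
    simp only [Polynomial.eval_mul, Polynomial.eval_C, Polynomial.eval_pow, Polynomial.eval_X,
      Polynomial.eval_add]
    exact sum_rootCountWeight_mul_pow hr0 hr1 x
  rw [← h, Polynomial.finsetSum_coeff, Finset.sum_eq_single j]
  · simp
  · intro i _ hi
    simp [Polynomial.coeff_X_pow, hi.symm]
  · intro h
    exact absurd (Finset.mem_range.2 (Nat.lt_succ_of_le hj)) h

theorem prod_range_pow_two_mul_succ (r : ℝ) (m : ℕ) :
    ∏ k ∈ Finset.range m, r ^ (2 * (k + 1)) = r ^ (m * (m + 1)) := by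
  induction m with
  | zero => simp
  | succ m ih =>
    rw [Finset.prod_range_succ, ih, ← pow_add]
    congr 1
    ring

/-- Lower bound for the root counts of the uniform law on stable polynomials. -/
theorem le_stableLaw_le_zeroCount {N m : ℕ} {r : ℝ} (hr0 : 0 < r) (hr1 : r < 1) (hm : m ≤ N) :
    ENNReal.ofReal (r ^ (m * (m + 1))) ≤ stableLaw N {c | (m : ℕ∞) ≤ zeroCount (monicEval c) r} := by
  rw [stableLaw_le_zeroCount hr0 hr1]
  refine ENNReal.ofReal_le_ofReal ?_
  have h1 := sum_coeff_bernoulliSumPoly (fun k => r ^ (2 * (k + 1))) N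
  have h2 := sum_coeff_bernoulliSumPoly_le (p := fun k => r ^ (2 * (k + 1))) (fun k => by positivity)
    (fun k => pow_le_one₀ hr0.le hr1.le) hm
  rw [prod_range_pow_two_mul_succ] at h2
  rw [← Finset.sum_filter_add_sum_filter_not _ (fun j => m ≤ j)] at h1
  have h3 : (Finset.range (N + 1)).filter (fun j => ¬ m ≤ j) = Finset.range m := by
    ext j
    simp only [Finset.mem_filter, Finset.mem_range]
    omega
  rw [h3] at h1
  rw [Finset.sum_congr rfl fun j hj => rootCountWeight_eq_coeff (N := N) hr0 hr1
    (Nat.lt_succ_iff.1 (Finset.mem_range.1 (Finset.mem_filter.1 hj).1))]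
  linarith

theorem prod_one_add_pow_le {q : ℝ} (hq0 : 0 ≤ q) (hq1 : q < 1) (n : ℕ) :
    ∏ k ∈ Finset.range n, (1 + q ^ k) ≤ Real.exp (1 / (1 - q)) := by
  calc ∏ k ∈ Finset.range n, (1 + q ^ k) ≤ ∏ k ∈ Finset.range n, Real.exp (q ^ k) :=
        Finset.prod_le_prod (fun _ _ => by positivity) fun k _ => by
          rw [add_comm]; exact Real.add_one_le_exp _
    _ = Real.exp (∑ k ∈ Finset.range n, q ^ k) := (Real.exp_sum _ _).symm
    _ ≤ _ := by
      refine Real.exp_le_exp.2 ?_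
      rw [one_div, ← tsum_geometric_of_lt_one hq0 hq1]
      exact (summable_geometric_of_lt_one hq0 hq1).sum_le_tsum _ fun _ _ => by positivity

/-- Upper bound for the root counts of the uniform law on stable polynomials. -/
theorem stableLaw_le_zeroCount_le {N m : ℕ} {r : ℝ} (hr0 : 0 < r) (hr1 : r < 1) (hm : m ≤ N) :
    stableLaw N {c | (m : ℕ∞) ≤ zeroCount (monicEval c) r}
      ≤ ENNReal.ofReal (Real.exp (2 / (1 - r ^ 2)) * r ^ (m * (m + 1))) := by
  rw [stableLaw_le_zeroCount hr0 hr1]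
  refine ENNReal.ofReal_le_ofReal ?_
  set q := r ^ 2 with hq
  have hq0 : 0 < q := by positivity
  have hq1 : q < 1 := pow_lt_one₀ hr0.le hr1 two_ne_zero
  -- Exponential Markov inequality at `x = q ^ (-m)`, which balances the product at index `m`. For
  -- `k < m` the factor `q ^ (k + 1) * x` is taken out, giving `x ^ m * r ^ (m * (m + 1))`. What
  -- remains on either side is a product of terms `1 + q ^ i`, bounded independently of `N` and `m`.
  set x : ℝ := (q ^ m)⁻¹ with hx
  have hx1 : 1 ≤ x := (one_le_inv₀ (by positivity)).2 (pow_le_one₀ hq0.le hq1.le)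
  have hmarkov : (∑ j ∈ Finset.range (N + 1) with m ≤ j, rootCountWeight N r j) * x ^ m
      ≤ ∏ k ∈ Finset.range N, (1 - r ^ (2 * (k + 1)) + r ^ (2 * (k + 1)) * x) := by
    rw [← sum_rootCountWeight_mul_pow hr0 hr1, Finset.sum_mul]
    calc _ ≤ ∑ j ∈ Finset.range (N + 1) with m ≤ j, rootCountWeight N r j * x ^ j :=
          Finset.sum_le_sum fun j hj => mul_le_mul_of_nonneg_left
            (pow_le_pow_right₀ hx1 (Finset.mem_filter.1 hj).2) (rootCountWeight_nonneg _ _ _)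
      _ ≤ _ := Finset.sum_le_sum_of_subset_of_nonneg (Finset.filter_subset _ _) fun j _ _ =>
          mul_nonneg (rootCountWeight_nonneg _ _ _) (by positivity)
  have hprod : ∏ k ∈ Finset.range N, (1 - r ^ (2 * (k + 1)) + r ^ (2 * (k + 1)) * x)
      ≤ ∏ k ∈ Finset.range N, (1 + q ^ (k + 1) * x) := by
    refine Finset.prod_le_prod (fun k _ => ?_) fun k _ => ?_
    · rw [pow_mul, ← hq]
      have : q ^ (k + 1) ≤ 1 := pow_le_one₀ hq0.le hq1.le
      have : 0 ≤ q ^ (k + 1) * x := by positivity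
      linarith
    · rw [pow_mul, ← hq]
      have : 0 ≤ q ^ (k + 1) := by positivity
      linarith
  have hsplit : ∏ k ∈ Finset.range N, (1 + q ^ (k + 1) * x)
      = (∏ k ∈ Finset.range m, (1 + q ^ (k + 1) * x)) * ∏ k ∈ Finset.range (N - m), (1 + q ^ (k + 1)) := by
    obtain ⟨d, rfl⟩ := Nat.exists_eq_add_of_le hm
    rw [Finset.prod_range_add, Nat.add_sub_cancel_left]
    congr 1
    refine Finset.prod_congr rfl fun k _ => ?_
    rw [hx, add_assoc, pow_add]
    field_simp
  have hfirst : (∏ k ∈ Finset.range m, (1 + q ^ (k + 1) * x))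
      = x ^ m * (r ^ (m * (m + 1)) * ∏ k ∈ Finset.range m, (1 + q ^ k)) := by
    rw [← prod_range_pow_two_mul_succ, ← Finset.prod_range_reflect (fun k => 1 + q ^ k),
      ← Finset.prod_mul_distrib]
    nth_rewrite 2 [← Finset.card_range m]
    rw [← Finset.prod_const, ← Finset.prod_mul_distrib]
    refine Finset.prod_congr rfl fun k hk => ?_
    have hk' := Finset.mem_range.1 hk
    have e : q ^ m = q ^ (k + 1) * q ^ (m - 1 - k) := by
      rw [← pow_add]
      congr 1
      omega
    rw [pow_mul, ← hq, hx, e]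
    field_simp
    ring
  have hsecond : ∏ k ∈ Finset.range (N - m), (1 + q ^ (k + 1)) ≤ Real.exp (1 / (1 - q)) := by
    refine le_trans (Finset.prod_le_prod (fun _ _ => by positivity) fun k _ => ?_)
      (prod_one_add_pow_le hq0.le hq1 (N - m))
    gcongr 1 + ?_
    exact pow_le_pow_of_le_one hq0.le hq1.le (Nat.le_succ k)
  have hxm : 0 < x ^ m := by positivity
  refine le_of_mul_le_mul_right ((hmarkov.trans hprod).trans ?_) hxm
  rw [hsplit, hfirst]
  have hE : Real.exp (2 / (1 - q)) = Real.exp (1 / (1 - q)) * Real.exp (1 / (1 - q)) := by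
    rw [← Real.exp_add]
    congr 1
    ring
  rw [hE]
  calc _ ≤ x ^ m * (r ^ (m * (m + 1)) * Real.exp (1 / (1 - q))) * Real.exp (1 / (1 - q)) := by
        gcongr
        exact prod_one_add_pow_le hq0.le hq1 m
    _ = _ := by ring

/-! ### Random stable polynomials from a Gaussian sequence -/

/-- The sequence with head `z` and tail `x`. -/
def consSeq (p : ℂ × (ℕ → ℂ)) : ℕ → ℂ
  | 0 => p.1
  | n + 1 => p.2 n

/-- The tail of a sequence. -/
def tailSeq (x : ℕ → ℂ) : ℕ → ℂ := fun n => x (n + 1)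

theorem measurable_tailSeq : Measurable tailSeq :=
  measurable_pi_lambda _ fun n => measurable_pi_apply (n + 1)

theorem measurable_consSeq : Measurable consSeq := by
  refine measurable_pi_lambda _ fun n => ?_
  rcases n with _ | n
  · exact measurable_fst
  · exact (measurable_pi_apply n).comp measurable_snd

/-- An infinite product splits off its first factor. This matches the recursion, which uses `x 0` in
the outermost step and the tail in the earlier ones. -/
theorem map_consSeq : (stdComplexGaussian.prod gaussianSeq).map consSeq = gaussianSeq := by
  classical
  refine Measure.eq_infinitePi _ fun s t ht => ?_
  obtain ⟨N, hN⟩ : ∃ N, s ⊆ Finset.range (N + 1) := by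
    refine ⟨s.sup id, fun i hi => Finset.mem_range.2 (Nat.lt_succ_of_le ?_)⟩
    exact Finset.le_sup (f := id) hi
  set u : ℕ → Set ℂ := fun i => if i ∈ s then t i else Set.univ with hu
  have hum : ∀ i, MeasurableSet (u i) := by
    intro i
    simp only [hu]
    split_ifs
    exacts [ht i, MeasurableSet.univ]
  have h1 : Set.pi (s : Set ℕ) t = Set.pi (Finset.range (N + 1) : Set ℕ) u := by
    ext x
    simp only [Set.mem_pi, Finset.mem_coe, hu]
    constructor
    · intro h i _
      split_ifs with hi
      exacts [h i hi, Set.mem_univ _]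
    · intro h i hi
      simpa [hi] using h i (hN hi)
  have h2 : ∏ i ∈ s, stdComplexGaussian (t i) = ∏ i ∈ Finset.range (N + 1), stdComplexGaussian (u i) := by
    rw [← Finset.prod_subset hN]
    · exact Finset.prod_congr rfl fun i hi => by simp [hu, hi]
    · intro i _ hi
      simp [hu, hi]
  have h3 : consSeq ⁻¹' Set.pi (Finset.range (N + 1) : Set ℕ) u
      = u 0 ×ˢ Set.pi (Finset.range N : Set ℕ) fun i => u (i + 1) := by
    ext p
    simp only [Set.mem_preimage, Set.mem_pi, Finset.mem_coe, Finset.mem_range, Set.mem_prod]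
    constructor
    · intro h
      exact ⟨h 0 (Nat.succ_pos N), fun i hi => h (i + 1) (Nat.succ_lt_succ hi)⟩
    · rintro ⟨h0, hs⟩ (_ | i) hi
      · exact h0
      · exact hs i (Nat.lt_of_succ_lt_succ hi)
  rw [h1, h2, Measure.map_apply measurable_consSeq
    (MeasurableSet.pi (Finset.countable_toSet _) fun i _ => hum i), h3, Measure.prod_prod, gaussianSeq,
    Measure.infinitePi_pi _ fun i _ => hum (i + 1), Finset.prod_range_succ', mul_comm]

theorem map_head_tail :
    gaussianSeq.map (fun x => (x 0, tailSeq x)) = stdComplexGaussian.prod gaussianSeq := by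
  have hm : Measurable fun x : ℕ → ℂ => (x 0, tailSeq x) :=
    (measurable_pi_apply 0).prodMk measurable_tailSeq
  conv_lhs => rw [← map_consSeq]
  rw [Measure.map_map hm measurable_consSeq]
  exact Measure.map_id

/-- The lower coefficients of the monic orthogonal polynomial with Verblunsky coefficients
obtained from `x`. -/
noncomputable def szegoCoeffs : (N : ℕ) → (ℕ → ℂ) → (Fin N → ℂ)
  | 0, _ => Fin.elim0
  | N + 1, x => szegoStep (verblunskyMap N (x 0)) (szegoCoeffs N (tailSeq x))

theorem measurable_szegoCoeffs (N : ℕ) : Measurable (szegoCoeffs N) := by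
  induction N with
  | zero => exact measurable_const
  | succ N ih =>
    exact measurable_szegoStep.comp (((measurable_verblunskyMap N).comp (measurable_pi_apply 0)).prodMk
      (ih.comp measurable_tailSeq))

/-- All degrees are driven by a single Gaussian sequence: `x j` always enters `j` steps before the
last. The index is reversed for this reason, since it allows pointwise convergence as `N` grows. -/
theorem map_szegoCoeffs (N : ℕ) : gaussianSeq.map (szegoCoeffs N) = stableLaw N := by
  induction N with
  | zero =>
    rw [stableLaw_zero]
    have : szegoCoeffs 0 = fun _ => Fin.elim0 := rfl
    rw [this, Measure.map_const, measure_univ, one_smul]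
  | succ N ih =>
    have hV := measurable_verblunskyMap N
    have hC := measurable_szegoCoeffs N
    have h1 : szegoCoeffs (N + 1) = (fun p : ℂ × (Fin N → ℂ) => szegoStep p.1 p.2) ∘
        (Prod.map (verblunskyMap N) (szegoCoeffs N)) ∘ fun x => (x 0, tailSeq x) := rfl
    have hm : Measurable fun x : ℕ → ℂ => (x 0, tailSeq x) :=
      (measurable_pi_apply 0).prodMk measurable_tailSeq
    rw [h1, ← Measure.map_map measurable_szegoStep ((hV.prodMap hC).comp hm), ← Measure.map_map (hV.prodMap hC) hm,
      map_head_tail, ← Measure.map_prod_map _ _ hV hC, ih, map_verblunskyMap, map_szegoStep]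

/-! ### Convergence of the Schur iterates -/

/-- The Schur iterates with Verblunsky coefficients obtained from `x`. -/
noncomputable def schurIterate : ℕ → (ℕ → ℂ) → ℂ → ℂ
  | 0, _, _ => 1
  | N + 1, x, z => (z * schurIterate N (tailSeq x) z + verblunskyMap N (x 0)) /
      (1 + starRingEnd ℂ (verblunskyMap N (x 0)) * (z * schurIterate N (tailSeq x) z))

theorem one_add_conj_mul_ne_zero {g w : ℂ} (hg : ‖g‖ < 1) (hw : ‖w‖ ≤ 1) : 1 + starRingEnd ℂ g * w ≠ 0 := by
  intro h
  have h1 : ‖starRingEnd ℂ g * w‖ = 1 := by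
    rw [eq_neg_of_add_eq_zero_right h, norm_neg, norm_one]
  rw [norm_mul, RCLike.norm_conj] at h1
  nlinarith [norm_nonneg g, norm_nonneg w]

theorem norm_mobius_le_one {g w : ℂ} (hg : ‖g‖ < 1) (hw : ‖w‖ ≤ 1) :
    ‖(w + g) / (1 + starRingEnd ℂ g * w)‖ ≤ 1 := by
  rw [norm_div, div_le_one (norm_pos_iff.2 (one_add_conj_mul_ne_zero hg hw))]
  refine le_of_sq_le_sq ?_ (norm_nonneg _)
  rw [← Complex.normSq_eq_norm_sq, ← Complex.normSq_eq_norm_sq]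
  have hg2 : Complex.normSq g ≤ 1 := by
    rw [Complex.normSq_eq_norm_sq]; exact pow_le_one₀ (norm_nonneg _) hg.le
  have hw2 : Complex.normSq w ≤ 1 := by
    rw [Complex.normSq_eq_norm_sq]; exact pow_le_one₀ (norm_nonneg _) hw
  have : Complex.normSq (1 + starRingEnd ℂ g * w) - Complex.normSq (w + g)
      = (1 - Complex.normSq g) * (1 - Complex.normSq w) := by
    simp only [Complex.normSq_apply, Complex.add_re, Complex.add_im, Complex.mul_re, Complex.mul_im,
      Complex.conj_re, Complex.conj_im, Complex.one_re, Complex.one_im]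
    ring
  nlinarith [mul_nonneg (sub_nonneg.2 hg2) (sub_nonneg.2 hw2)]

theorem norm_schurIterate_le_one (N : ℕ) (x : ℕ → ℂ) {z : ℂ} (hz : ‖z‖ ≤ 1) : ‖schurIterate N x z‖ ≤ 1 := by
  induction N generalizing x with
  | zero => simp [schurIterate]
  | succ N ih =>
    refine norm_mobius_le_one (norm_verblunskyMap_lt_one _ _) ?_
    rw [norm_mul]
    exact mul_le_one₀ hz (norm_nonneg _) (ih _)

/-- The Szegő recursion acts on the ratio `Φ / Φ*` by a disk automorphism after multiplication by
`z`; the Schur iterates are these ratios. -/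
theorem monicEval_szegoCoeffs (N : ℕ) (x : ℕ → ℂ) {z : ℂ} (hz : ‖z‖ ≤ 1) :
    reverseEval (szegoCoeffs N x) z ≠ 0 ∧
      monicEval (szegoCoeffs N x) z = schurIterate N x z * reverseEval (szegoCoeffs N x) z := by
  induction N generalizing x with
  | zero => simp [monicEval, reverseEval, schurIterate]
  | succ N ih =>
    obtain ⟨h1, h2⟩ := ih (tailSeq x)
    have hw : ‖z * schurIterate N (tailSeq x) z‖ ≤ 1 := by
      rw [norm_mul]
      exact mul_le_one₀ hz (norm_nonneg _) (norm_schurIterate_le_one _ _ hz)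
    have h3 := one_add_conj_mul_ne_zero (norm_verblunskyMap_lt_one N (x 0)) hw
    have h4 : reverseEval (szegoCoeffs (N + 1) x) z = reverseEval (szegoCoeffs N (tailSeq x)) z *
        (1 + starRingEnd ℂ (verblunskyMap N (x 0)) * (z * schurIterate N (tailSeq x) z)) := by
      rw [szegoCoeffs, reverseEval_szegoStep, h2]
      ring
    refine ⟨h4 ▸ mul_ne_zero h1 h3, ?_⟩
    rw [h4, szegoCoeffs, monicEval_szegoStep, h2, schurIterate,
      mul_comm (reverseEval (szegoCoeffs N (tailSeq x)) z) (1 + _), ← mul_assoc (_ / _), div_mul_cancel₀ _ h3]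
    ring

/-- The increment of the Schur iterates. -/
noncomputable def schurIncrement (N : ℕ) (x : ℕ → ℂ) (z : ℂ) : ℂ :=
  schurIterate (N + 1) x z - z * schurIterate N (tailSeq x) z

theorem schurIncrement_eq (N : ℕ) (x : ℕ → ℂ) {z : ℂ} (hz : ‖z‖ ≤ 1) :
    schurIncrement N x z = verblunskyMap N (x 0) - schurIterate (N + 1) x z *
      (starRingEnd ℂ (verblunskyMap N (x 0)) * (z * schurIterate N (tailSeq x) z)) := by
  have hw : ‖z * schurIterate N (tailSeq x) z‖ ≤ 1 := by
    rw [norm_mul]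
    exact mul_le_one₀ hz (norm_nonneg _) (norm_schurIterate_le_one _ _ hz)
  have h3 := one_add_conj_mul_ne_zero (norm_verblunskyMap_lt_one N (x 0)) hw
  have h4 : schurIterate (N + 1) x z *
      (1 + starRingEnd ℂ (verblunskyMap N (x 0)) * (z * schurIterate N (tailSeq x) z))
      = z * schurIterate N (tailSeq x) z + verblunskyMap N (x 0) := by
    rw [schurIterate, div_mul_cancel₀ _ h3]
  rw [schurIncrement]
  linear_combination h4

/-- To first order the increment is the Verblunsky coefficient. The error carries an extra factor
from the Schur iterate, which is itself small for large `N`. -/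
theorem norm_schurIncrement_sub_le (N : ℕ) (x : ℕ → ℂ) {z : ℂ} (hz : ‖z‖ ≤ 1) :
    ‖schurIncrement N x z - verblunskyMap N (x 0)‖ ≤ ‖schurIterate (N + 1) x z‖ * ‖verblunskyMap N (x 0)‖ := by
  rw [schurIncrement_eq N x hz, sub_sub_cancel_left, norm_neg, norm_mul, norm_mul, norm_mul, RCLike.norm_conj]
  have h1 : ‖z‖ * ‖schurIterate N (tailSeq x) z‖ ≤ 1 :=
    mul_le_one₀ hz (norm_nonneg _) (norm_schurIterate_le_one _ _ hz)
  calc _ ≤ ‖schurIterate (N + 1) x z‖ * (‖verblunskyMap N (x 0)‖ * 1) := by gcongr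
    _ = _ := by rw [mul_one]

theorem norm_schurIncrement_le (N : ℕ) (x : ℕ → ℂ) {z : ℂ} (hz : ‖z‖ ≤ 1) :
    ‖schurIncrement N x z‖ ≤ 2 * ‖verblunskyMap N (x 0)‖ := by
  have h1 := norm_schurIncrement_sub_le N x hz
  have h2 := mul_le_mul_of_nonneg_right (norm_schurIterate_le_one (N + 1) x hz)
    (norm_nonneg (verblunskyMap N (x 0)))
  have h3 := norm_le_norm_sub_add (schurIncrement N x z) (verblunskyMap N (x 0))
  linarith

/-- Unrolling the recursion gives a finite power-series-like sum whose `j`-th increment is close to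
`x j / √N`. -/
theorem schurIterate_eq_sum (N : ℕ) (x : ℕ → ℂ) (z : ℂ) :
    schurIterate N x z = ∑ j ∈ Finset.range N, z ^ j * schurIncrement (N - 1 - j) (fun n => x (n + j)) z
      + z ^ N := by
  induction N generalizing x with
  | zero => simp [schurIterate]
  | succ N ih =>
    have h1 : schurIterate (N + 1) x z = schurIncrement N x z + z * schurIterate N (tailSeq x) z := by
      rw [schurIncrement]
      ring
    rw [h1, ih, Finset.sum_range_succ', mul_add, Finset.mul_sum]
    have h2 : ∀ j ∈ Finset.range N,
        z * (z ^ j * schurIncrement (N - 1 - j) (fun n => tailSeq x (n + j)) z)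
        = z ^ (j + 1) * schurIncrement (N + 1 - 1 - (j + 1)) (fun n => x (n + (j + 1))) z := by
      intro j _
      have e1 : N - 1 - j = N + 1 - 1 - (j + 1) := by omega
      have e2 : (fun n => tailSeq x (n + j)) = fun n => x (n + (j + 1)) := rfl
      rw [e1, e2]
      ring
    rw [Finset.sum_congr rfl h2]
    simp only [pow_zero, one_mul, add_zero, Nat.add_sub_cancel, Nat.sub_zero]
    ring

theorem norm_verblunskyMap_le (k : ℕ) (a : ℂ) : Real.sqrt (k + 1) * ‖verblunskyMap k a‖ ≤ ‖a‖ := by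
  have hk : (0 : ℝ) < (k : ℝ) + 1 := by positivity
  refine le_of_sq_le_sq ?_ (norm_nonneg _)
  rw [mul_pow, Real.sq_sqrt hk.le, norm_verblunskyMap, verblunskyRadius_sq]
  have h1 := Real.add_one_le_exp (-‖a‖ ^ 2 / ((k : ℝ) + 1))
  have h2 : ((k : ℝ) + 1) * (-‖a‖ ^ 2 / ((k : ℝ) + 1)) = -‖a‖ ^ 2 := mul_div_cancel₀ _ hk.ne'
  nlinarith

/-- Since `N ≤ (j + 1)² (N - j)` for `j < N`, the shifted index costs only a factor `j + 1`, which
is summable against `ρ ^ j`. -/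
theorem sqrt_mul_norm_verblunskyMap_le {N j : ℕ} (hj : j < N) (a : ℂ) :
    Real.sqrt N * ‖verblunskyMap (N - 1 - j) a‖ ≤ (j + 1) * ‖a‖ := by
  have h1 := norm_verblunskyMap_le (N - 1 - j) a
  have h2 : Real.sqrt N ≤ (j + 1) * Real.sqrt ((N - 1 - j : ℕ) + 1) := by
    rw [Real.sqrt_le_left (by positivity), mul_pow, Real.sq_sqrt (by positivity)]
    obtain ⟨d, rfl⟩ := Nat.exists_eq_add_of_lt hj
    have : j + d + 1 - 1 - j = d := by omega
    rw [this]
    push_cast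
    have : (0 : ℝ) ≤ j := Nat.cast_nonneg _
    have : (0 : ℝ) ≤ d := Nat.cast_nonneg _
    nlinarith [mul_nonneg (Nat.cast_nonneg (α := ℝ) j) (Nat.cast_nonneg (α := ℝ) d), mul_nonneg (mul_nonneg (Nat.cast_nonneg (α := ℝ) j) (Nat.cast_nonneg (α := ℝ) j)) (Nat.cast_nonneg (α := ℝ) d)]
  calc _ ≤ (j + 1) * Real.sqrt ((N - 1 - j : ℕ) + 1) * ‖verblunskyMap (N - 1 - j) a‖ := by gcongr
    _ ≤ _ := by rw [mul_assoc]; gcongr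

/-- The squeeze `y / (1 + y) ≤ 1 - exp (-y) ≤ y` with `y = |a|² / (n + 1)` gives the limit of the
squared radius. -/
theorem tendsto_sqrt_mul_verblunskyMap (j : ℕ) (a : ℂ) :
    Filter.Tendsto (fun N : ℕ => (Real.sqrt N : ℂ) * verblunskyMap (N - 1 - j) a) Filter.atTop (nhds a) := by
  rcases eq_or_ne a 0 with rfl | ha
  · simp [verblunskyMap]
  have hs : 0 < ‖a‖ := norm_pos_iff.2 ha
  have h0 : Filter.Tendsto (fun n : ℕ => ((n : ℝ) + 1) * (1 - Real.exp (-‖a‖ ^ 2 / ((n : ℝ) + 1))))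
      Filter.atTop (nhds (‖a‖ ^ 2)) := by
    have hl : Filter.Tendsto (fun n : ℕ => ‖a‖ ^ 2 / (1 + ‖a‖ ^ 2 * (1 / ((n : ℝ) + 1))))
        Filter.atTop (nhds (‖a‖ ^ 2 / (1 + ‖a‖ ^ 2 * 0))) :=
      Filter.Tendsto.div tendsto_const_nhds
        ((tendsto_one_div_add_atTop_nhds_zero_nat.const_mul _).const_add _) (by simp)
    rw [mul_zero, add_zero, div_one] at hl
    refine tendsto_of_tendsto_of_tendsto_of_le_of_le hl tendsto_const_nhds (fun n => ?_) fun n => ?_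
    · have hn : (0 : ℝ) < (n : ℝ) + 1 := by positivity
      set y := ‖a‖ ^ 2 / ((n : ℝ) + 1) with hy
      have hy0 : 0 < y := by positivity
      have e1 : -‖a‖ ^ 2 / ((n : ℝ) + 1) = -y := by rw [hy]; ring
      have e2 : ‖a‖ ^ 2 = ((n : ℝ) + 1) * y := by rw [hy]; field_simp
      have e3 : ‖a‖ ^ 2 * (1 / ((n : ℝ) + 1)) = y := by rw [hy]; ring
      simp only [e1, e3]
      rw [e2, mul_div_assoc]
      refine mul_le_mul_of_nonneg_left ?_ hn.le
      rw [div_le_iff₀ (by linarith), Real.exp_neg]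
      have h := Real.add_one_le_exp y
      have h2 : (Real.exp y)⁻¹ * (1 + y) ≤ 1 := by
        rw [inv_mul_le_iff₀ (Real.exp_pos _)]
        linarith
      linarith
    · have hn : (0 : ℝ) < (n : ℝ) + 1 := by positivity
      have h1 := Real.add_one_le_exp (-‖a‖ ^ 2 / ((n : ℝ) + 1))
      have h2 : ((n : ℝ) + 1) * (-‖a‖ ^ 2 / ((n : ℝ) + 1)) = -‖a‖ ^ 2 := mul_div_cancel₀ _ hn.ne'
      nlinarith
  have h1 : Filter.Tendsto (fun n : ℕ => (((n : ℝ) + 1 + j) / ((n : ℝ) + 1)) *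
      (((n : ℝ) + 1) * (1 - Real.exp (-‖a‖ ^ 2 / ((n : ℝ) + 1))))) Filter.atTop (nhds ((1 + j * 0) * ‖a‖ ^ 2)) := by
    refine Filter.Tendsto.mul ?_ h0
    have h2 := (tendsto_one_div_add_atTop_nhds_zero_nat (𝕜 := ℝ)).const_mul (j : ℝ) |>.const_add 1
    refine h2.congr fun n => ?_
    have hn : ((n : ℝ) + 1) ≠ 0 := by positivity
    field_simp
  rw [mul_zero, add_zero, one_mul] at h1
  have h2 : Filter.Tendsto (fun n : ℕ => Real.sqrt (n + 1 + j) * verblunskyRadius n ‖a‖) Filter.atTop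
      (nhds ‖a‖) := by
    have h3 := h1.sqrt
    rw [Real.sqrt_sq hs.le] at h3
    refine h3.congr fun n => ?_
    have hn : ((n : ℝ) + 1) ≠ 0 := by positivity
    rw [verblunskyRadius, ← Real.sqrt_mul (by positivity), ← mul_assoc, div_mul_cancel₀ _ hn]
  rw [← Filter.tendsto_add_atTop_iff_nat (j + 1)]
  have h4 := (Complex.continuous_ofReal.tendsto _).comp ((h2.div_const ‖a‖)) |>.mul_const a
  rw [div_self hs.ne', Complex.ofReal_one, one_mul] at h4
  refine h4.congr fun n => ?_
  have e : n + (j + 1) - 1 - j = n := by omega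
  rw [e, verblunskyMap, Function.comp_apply, ← mul_assoc, ← Complex.ofReal_mul, mul_div_assoc]
  congr 5
  push_cast
  ring

theorem summable_add_one_sq_mul_pow {ρ : ℝ} (hρ0 : 0 < ρ) (hρ1 : ρ < 1) :
    Summable fun j : ℕ => ((j : ℝ) + 1) ^ 2 * ρ ^ j := by
  have h1 := summable_pow_mul_geometric_of_norm_lt_one (R := ℝ) 2 (r := ρ)
    (by rwa [Real.norm_eq_abs, abs_of_pos hρ0])
  have h2 := ((summable_nat_add_iff 1).2 h1).mul_right ρ⁻¹
  refine h2.congr fun j => ?_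
  push_cast
  field_simp
  ring

theorem sqrt_le_natCast (N : ℕ) : Real.sqrt N ≤ N := by
  rcases Nat.eq_zero_or_pos N with rfl | hN
  · simp
  · have h1 : (1 : ℝ) ≤ N := by exact_mod_cast hN
    rw [Real.sqrt_le_left (by positivity)]
    nlinarith

/-- An a priori bound, uniform over `N` and over all sequences of the given growth. The uniformity
allows its use for the shifted sequences in `tendsto_schurIncrement`. -/
theorem exists_sqrt_mul_norm_schurIterate_le {ρ : ℝ} (hρ0 : 0 < ρ) (hρ1 : ρ < 1) {T : ℝ} (hT : 0 ≤ T) :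
    ∃ M : ℝ, ∀ x : ℕ → ℂ, (∀ n, ‖x n‖ ≤ T * ((n : ℝ) + 1)) → ∀ N : ℕ, ∀ z : ℂ, ‖z‖ ≤ ρ →
      Real.sqrt N * ‖schurIterate N x z‖ ≤ M := by
  have hs := summable_add_one_sq_mul_pow hρ0 hρ1
  refine ⟨(2 * T + 1) * ∑' j : ℕ, ((j : ℝ) + 1) ^ 2 * ρ ^ j, fun x hx N z hz => ?_⟩
  have hz1 : ‖z‖ ≤ 1 := hz.trans hρ1.le
  have h1 : Real.sqrt N * ‖∑ j ∈ Finset.range N, z ^ j * schurIncrement (N - 1 - j) (fun n => x (n + j)) z‖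
      ≤ 2 * T * ∑' j : ℕ, ((j : ℝ) + 1) ^ 2 * ρ ^ j := by
    calc _ ≤ Real.sqrt N * ∑ j ∈ Finset.range N,
          ‖z ^ j * schurIncrement (N - 1 - j) (fun n => x (n + j)) z‖ := by
          gcongr; exact norm_sum_le _ _
      _ ≤ ∑ j ∈ Finset.range N, 2 * T * (((j : ℝ) + 1) ^ 2 * ρ ^ j) := by
          rw [Finset.mul_sum]
          refine Finset.sum_le_sum fun j hj => ?_
          have h2 := norm_schurIncrement_le (N - 1 - j) (fun n => x (n + j)) hz1
          have h3 := sqrt_mul_norm_verblunskyMap_le (Finset.mem_range.1 hj) (x j)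
          simp only [zero_add] at h2
          rw [norm_mul, norm_pow]
          calc Real.sqrt N * (‖z‖ ^ j * ‖schurIncrement (N - 1 - j) (fun n => x (n + j)) z‖)
              ≤ Real.sqrt N * (ρ ^ j * (2 * ‖verblunskyMap (N - 1 - j) (x j)‖)) := by gcongr
            _ = 2 * ρ ^ j * (Real.sqrt N * ‖verblunskyMap (N - 1 - j) (x j)‖) := by ring
            _ ≤ 2 * ρ ^ j * (((j : ℝ) + 1) * (T * ((j : ℝ) + 1))) := by
                refine mul_le_mul_of_nonneg_left ?_ (by positivity)
                exact h3.trans (mul_le_mul_of_nonneg_left (hx j) (by positivity))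
            _ = _ := by ring
      _ ≤ _ := by
          rw [← Finset.mul_sum]
          gcongr
          exact hs.sum_le_tsum _ fun _ _ => by positivity
  have h4 : Real.sqrt N * ‖z ^ N‖ ≤ ∑' j : ℕ, ((j : ℝ) + 1) ^ 2 * ρ ^ j := by
    have h5 : ((N : ℝ) + 1) ^ 2 * ρ ^ N ≤ ∑' j : ℕ, ((j : ℝ) + 1) ^ 2 * ρ ^ j :=
      hs.le_tsum N fun _ _ => by positivity
    refine le_trans ?_ h5
    rw [norm_pow]
    have : Real.sqrt N ≤ ((N : ℝ) + 1) ^ 2 := by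
      have := sqrt_le_natCast N
      nlinarith [Nat.cast_nonneg (α := ℝ) N]
    gcongr
  rw [schurIterate_eq_sum]
  calc _ ≤ Real.sqrt N * (‖∑ j ∈ Finset.range N,
        z ^ j * schurIncrement (N - 1 - j) (fun n => x (n + j)) z‖ + ‖z ^ N‖) := by
        gcongr; exact norm_add_le _ _
    _ ≤ _ := by rw [mul_add]; linarith

theorem tendsto_schurIncrement {ρ : ℝ} (hρ0 : 0 < ρ) (hρ1 : ρ < 1) {T : ℝ} (hT : 0 ≤ T) {x : ℕ → ℂ}
    (hx : ∀ n, ‖x n‖ ≤ T * ((n : ℝ) + 1)) (j : ℕ) :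
    Filter.Tendsto (fun q : ℕ × ℂ => (Real.sqrt q.1 : ℂ) *
        schurIncrement (q.1 - 1 - j) (fun n => x (n + j)) q.2 - x j)
      (Filter.atTop ×ˢ Filter.principal (Metric.closedBall 0 ρ)) (nhds 0) := by
  obtain ⟨M, hM⟩ := exists_sqrt_mul_norm_schurIterate_le hρ0 hρ1 (T := T * (j + 1)) (by positivity)
  have hxj : ∀ n, ‖x (n + j)‖ ≤ T * (j + 1) * ((n : ℝ) + 1) := by
    intro n
    refine (hx _).trans ?_
    rw [mul_assoc]
    gcongr
    push_cast
    nlinarith [mul_nonneg (Nat.cast_nonneg (α := ℝ) n) (Nat.cast_nonneg (α := ℝ) j)]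
  have hlim : Filter.Tendsto (fun N : ℕ => ‖(Real.sqrt N : ℂ) * verblunskyMap (N - 1 - j) (x j) - x j‖
      + (j + 1) * ‖x j‖ * (M / Real.sqrt (N - 1 - j + 1 : ℕ))) Filter.atTop (nhds 0) := by
    have h1 := ((tendsto_sqrt_mul_verblunskyMap j (x j)).sub_const (x j)).norm
    rw [sub_self, norm_zero] at h1
    have h2 : Filter.Tendsto (fun N : ℕ => Real.sqrt (N - 1 - j + 1 : ℕ)) Filter.atTop Filter.atTop := by
      refine Real.tendsto_sqrt_atTop.comp (tendsto_natCast_atTop_atTop.comp ?_)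
      refine Filter.tendsto_atTop_mono (fun N => ?_) (Filter.tendsto_sub_atTop_nat j)
      omega
    have h3 := (h2.const_div_atTop M).const_mul ((j + 1) * ‖x j‖)
    simpa using h1.add h3
  refine squeeze_zero_norm' ?_ (hlim.comp Filter.tendsto_fst)
  filter_upwards [(Filter.eventually_gt_atTop j).prod_mk (Filter.mem_principal_self
    (Metric.closedBall (0 : ℂ) ρ))] with q hq
  obtain ⟨hjq, hz⟩ := hq
  obtain ⟨N, z⟩ := q
  simp only at hjq hz ⊢
  have hzρ : ‖z‖ ≤ ρ := by simpa using hz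
  have hz1 : ‖z‖ ≤ 1 := hzρ.trans hρ1.le
  have e : (Real.sqrt N : ℂ) * schurIncrement (N - 1 - j) (fun n => x (n + j)) z - x j
      = ((Real.sqrt N : ℂ) * verblunskyMap (N - 1 - j) (x j) - x j) + (Real.sqrt N : ℂ) *
        (schurIncrement (N - 1 - j) (fun n => x (n + j)) z - verblunskyMap (N - 1 - j) (x j)) := by ring
  have h1 := norm_schurIncrement_sub_le (N - 1 - j) (fun n => x (n + j)) hz1
  simp only [zero_add] at h1
  have h2 := sqrt_mul_norm_verblunskyMap_le hjq (x j)
  have h3 := hM _ hxj (N - 1 - j + 1) z hzρ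
  have hpos : 0 < Real.sqrt (N - 1 - j + 1 : ℕ) := Real.sqrt_pos.2 (by positivity)
  have h4 : ‖schurIterate (N - 1 - j + 1) (fun n => x (n + j)) z‖ ≤ M / Real.sqrt (N - 1 - j + 1 : ℕ) := by
    rw [le_div_iff₀ hpos, mul_comm]
    exact h3
  rw [e]
  refine (norm_add_le _ _).trans (add_le_add le_rfl ?_)
  rw [norm_mul, Complex.norm_real, Real.norm_eq_abs, abs_of_nonneg (Real.sqrt_nonneg _)]
  calc _ ≤ Real.sqrt N * (‖schurIterate (N - 1 - j + 1) (fun n => x (n + j)) z‖ *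
        ‖verblunskyMap (N - 1 - j) (x j)‖) := by gcongr
    _ = (Real.sqrt N * ‖verblunskyMap (N - 1 - j) (x j)‖) *
        ‖schurIterate (N - 1 - j + 1) (fun n => x (n + j)) z‖ := by ring
    _ ≤ _ := by gcongr

/-- The rescaled Schur iterates converge to the power series with Gaussian coefficients. -/
theorem tendstoUniformlyOn_schurIterate {ρ : ℝ} (hρ0 : 0 < ρ) (hρ1 : ρ < 1) {T : ℝ} (hT : 0 ≤ T) {x : ℕ → ℂ}
    (hx : ∀ n, ‖x n‖ ≤ T * ((n : ℝ) + 1)) :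
    TendstoUniformlyOn (fun (N : ℕ) z => (Real.sqrt N : ℂ) * schurIterate N x z)
      (fun z => ∑' n, x n * z ^ n) Filter.atTop (Metric.closedBall 0 ρ) := by
  have hs := summable_add_one_sq_mul_pow hρ0 hρ1
  set 𝓕 : Filter (ℕ × ℂ) := Filter.atTop ×ˢ Filter.principal (Metric.closedBall 0 ρ) with hF
  have hmem : ∀ᶠ q in 𝓕, ‖q.2‖ ≤ ρ := by
    have h : Filter.Tendsto Prod.snd 𝓕 (Filter.principal (Metric.closedBall (0 : ℂ) ρ)) := Filter.tendsto_snd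
    filter_upwards [h (Filter.mem_principal_self _)] with q hq
    simpa using hq
  -- Termwise difference from the limit series, with the finite sum extended by zero. Dominated
  -- convergence for series applies along the product filter, which encodes uniformity in `z`.
  set D : ℕ × ℂ → ℕ → ℂ := fun q j => (if j < q.1 then q.2 ^ j * ((Real.sqrt q.1 : ℂ) *
    schurIncrement (q.1 - 1 - j) (fun n => x (n + j)) q.2) else 0) - x j * q.2 ^ j with hD
  have hDlim : ∀ j, Filter.Tendsto (D · j) 𝓕 (nhds 0) := by
    intro j
    have h1 := (tendsto_schurIncrement hρ0 hρ1 hT hx j).norm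
    rw [norm_zero] at h1
    refine squeeze_zero_norm' ?_ h1
    have hj : ∀ᶠ q : ℕ × ℂ in 𝓕, j < q.1 := Filter.tendsto_fst.eventually (Filter.eventually_gt_atTop j)
    filter_upwards [hmem, hj] with q hq hjq
    have e : D q j = q.2 ^ j * ((Real.sqrt q.1 : ℂ) *
        schurIncrement (q.1 - 1 - j) (fun n => x (n + j)) q.2 - x j) := by
      simp only [hD, if_pos hjq]
      ring
    rw [e, norm_mul, norm_pow]
    exact mul_le_of_le_one_left (norm_nonneg _) (pow_le_one₀ (norm_nonneg _) (hq.trans hρ1.le))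
  have hterm : ∀ q : ℕ × ℂ, ‖q.2‖ ≤ ρ → ∀ j, ‖x j * q.2 ^ j‖ ≤ T * (((j : ℝ) + 1) ^ 2 * ρ ^ j) := by
    intro q hq j
    rw [norm_mul, norm_pow]
    calc ‖x j‖ * ‖q.2‖ ^ j ≤ (T * ((j : ℝ) + 1)) * ρ ^ j := by gcongr; exact hx j
      _ ≤ (T * ((j : ℝ) + 1) ^ 2) * ρ ^ j := by
        gcongr
        nlinarith [Nat.cast_nonneg (α := ℝ) j]
      _ = _ := by ring
  have hDbound : ∀ᶠ q in 𝓕, ∀ j, ‖D q j‖ ≤ 3 * T * (((j : ℝ) + 1) ^ 2 * ρ ^ j) := by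
    filter_upwards [hmem] with q hq j
    refine (norm_sub_le _ _).trans ?_
    have h1 := hterm q hq j
    have h2 : ‖(if j < q.1 then q.2 ^ j * ((Real.sqrt q.1 : ℂ) *
        schurIncrement (q.1 - 1 - j) (fun n => x (n + j)) q.2) else 0)‖ ≤ 2 * T * (((j : ℝ) + 1) ^ 2 * ρ ^ j) := by
      split_ifs with hj
      · have h3 := norm_schurIncrement_le (q.1 - 1 - j) (fun n => x (n + j)) (hq.trans hρ1.le)
        simp only [zero_add] at h3
        have h4 := sqrt_mul_norm_verblunskyMap_le hj (x j)
        rw [norm_mul, norm_mul, norm_pow, Complex.norm_real, Real.norm_eq_abs, abs_of_nonneg (Real.sqrt_nonneg _)]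
        calc _ ≤ ρ ^ j * (Real.sqrt q.1 * (2 * ‖verblunskyMap (q.1 - 1 - j) (x j)‖)) := by gcongr
          _ = 2 * ρ ^ j * (Real.sqrt q.1 * ‖verblunskyMap (q.1 - 1 - j) (x j)‖) := by ring
          _ ≤ 2 * ρ ^ j * (((j : ℝ) + 1) * (T * ((j : ℝ) + 1))) := by
              refine mul_le_mul_of_nonneg_left ?_ (by positivity)
              exact h4.trans (mul_le_mul_of_nonneg_left (hx j) (by positivity))
          _ = _ := by ring
      · rw [norm_zero]
        positivity
    linarith
  have h0 := tendsto_tsum_of_dominated_convergence (hs.mul_left (3 * T)) hDlim hDbound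
  rw [tsum_zero] at h0
  have hpow : Filter.Tendsto (fun q : ℕ × ℂ => (Real.sqrt q.1 : ℂ) * q.2 ^ q.1) 𝓕 (nhds 0) := by
    refine squeeze_zero_norm' ?_
      ((tendsto_self_mul_const_pow_of_lt_one hρ0.le hρ1).comp Filter.tendsto_fst)
    filter_upwards [hmem] with q hq
    rw [norm_mul, norm_pow, Complex.norm_real, Real.norm_eq_abs, abs_of_nonneg (Real.sqrt_nonneg _)]
    simp only [Function.comp_apply]
    gcongr
    exact sqrt_le_natCast _
  have hfin : Filter.Tendsto (fun q : ℕ × ℂ => (Real.sqrt q.1 : ℂ) * schurIterate q.1 x q.2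
      - ∑' n, x n * q.2 ^ n) 𝓕 (nhds 0) := by
    have h1 := h0.add hpow
    rw [add_zero] at h1
    refine h1.congr' ?_
    filter_upwards [hmem] with q hq
    have hsum1 : Summable fun j => x j * q.2 ^ j :=
      Summable.of_norm_bounded (hs.mul_left T) (hterm q hq)
    have hsupp : ∀ j ∉ Finset.range q.1, (if j < q.1 then q.2 ^ j * ((Real.sqrt q.1 : ℂ) *
        schurIncrement (q.1 - 1 - j) (fun n => x (n + j)) q.2) else 0) = 0 := fun j hj =>
      if_neg (by simpa using hj)
    simp only [hD]
    rw [(summable_of_ne_finset_zero hsupp).tsum_sub hsum1, tsum_eq_sum hsupp, schurIterate_eq_sum, mul_add,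
      Finset.mul_sum, Finset.sum_congr rfl fun j hj => if_pos (Finset.mem_range.1 hj)]
    rw [Finset.sum_congr rfl fun j _ => mul_left_comm _ _ _]
    ring
  rw [Metric.tendstoUniformlyOn_iff]
  intro ε hε
  have h2 := (Metric.tendsto_nhds.1 hfin) ε hε
  rw [hF, Filter.eventually_prod_principal_iff] at h2
  filter_upwards [h2] with N hN z hz
  have := hN z hz
  rwa [dist_zero_right, ← dist_eq_norm, dist_comm] at this

/-! ### Root counts of the Gaussian power series -/

theorem measure_setOf_eventually_le {α : Type*} [MeasurableSpace α] {μ : Measure α} {A : ℕ → Set α} {c : ℝ≥0∞}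
    (h : ∀ᶠ N in Filter.atTop, μ (A N) ≤ c) : μ {x | ∀ᶠ N in Filter.atTop, x ∈ A N} ≤ c := by
  obtain ⟨N₀, hN₀⟩ := Filter.eventually_atTop.1 h
  have h1 : {x | ∀ᶠ N in Filter.atTop, x ∈ A N} = ⋃ n, ⋂ N, ⋂ (_ : n ≤ N), A N := by
    ext x
    simp only [Set.mem_ofPred_eq, Filter.eventually_atTop, Set.mem_iUnion, Set.mem_iInter]
  have hmono : Monotone fun n => ⋂ N, ⋂ (_ : n ≤ N), A N := fun i j hij =>
    Set.iInter_mono fun N => Set.iInter_mono' fun hj => ⟨hij.trans hj, le_rfl⟩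
  rw [h1, hmono.measure_iUnion]
  refine iSup_le fun n => ?_
  refine (measure_mono ?_).trans (hN₀ (max n N₀) (le_max_right _ _))
  exact Set.iInter₂_subset (max n N₀) (le_max_left _ _)

theorem setOf_frequently_eq {α : Type*} (A : ℕ → Set α) :
    {x | ∃ᶠ N in Filter.atTop, x ∈ A N} = ⋂ n, ⋃ N, ⋃ (_ : n ≤ N), A N := by
  ext x
  simp only [Set.mem_ofPred_eq, Filter.frequently_atTop, Set.mem_iUnion, Set.mem_iInter, exists_prop]

theorem measurableSet_setOf_frequently {α : Type*} [MeasurableSpace α] {A : ℕ → Set α}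
    (hA : ∀ N, MeasurableSet (A N)) : MeasurableSet {x | ∃ᶠ N in Filter.atTop, x ∈ A N} := by
  rw [setOf_frequently_eq]
  exact MeasurableSet.iInter fun n => MeasurableSet.iUnion fun N => MeasurableSet.iUnion fun _ => hA N

/-- The reverse Fatou inequality for sets. The limsup event serves the lower bound, and the liminf
event of `measure_setOf_eventually_le` the upper one. -/
theorem le_measure_setOf_frequently {α : Type*} [MeasurableSpace α] {μ : Measure α} [IsFiniteMeasure μ]
    {A : ℕ → Set α} (hA : ∀ N, MeasurableSet (A N)) {c : ℝ≥0∞}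
    (h : ∀ᶠ N in Filter.atTop, c ≤ μ (A N)) : c ≤ μ {x | ∃ᶠ N in Filter.atTop, x ∈ A N} := by
  obtain ⟨N₀, hN₀⟩ := Filter.eventually_atTop.1 h
  have hanti : Antitone fun n => ⋃ N, ⋃ (_ : n ≤ N), A N := fun i j hij =>
    Set.iUnion_mono fun N => Set.iUnion_mono' fun hj => ⟨hij.trans hj, le_rfl⟩
  rw [setOf_frequently_eq, hanti.measure_iInter (fun n => (MeasurableSet.iUnion fun N =>
    MeasurableSet.iUnion fun _ => hA N).nullMeasurableSet) ⟨0, measure_ne_top _ _⟩]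
  refine le_iInf fun n => ?_
  refine (hN₀ (max n N₀) (le_max_right _ _)).trans (measure_mono ?_)
  exact Set.subset_iUnion₂ (s := fun N (_ : n ≤ N) => A N) (max n N₀) (le_max_left _ _)

theorem ae_exists_growth : ∀ᵐ x ∂gaussianSeq, ∃ T : ℝ, 0 ≤ T ∧ ∀ n : ℕ, ‖x n‖ ≤ T * ((n : ℝ) + 1) := by
  rw [ae_iff]
  set B := {x : ℕ → ℂ | ¬∃ T : ℝ, 0 ≤ T ∧ ∀ n : ℕ, ‖x n‖ ≤ T * ((n : ℝ) + 1)} with hB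
  have h1 : ∀ k : ℕ, gaussianSeq.real B ≤ 2 * Real.exp (-((k : ℝ) + 1)) := by
    intro k
    have hk : (1 : ℝ) ≤ (k : ℝ) + 1 := by linarith [Nat.cast_nonneg (α := ℝ) k]
    refine (measureReal_mono (s₂ := {x | ∃ n : ℕ, ((k : ℝ) + 1) * ((n : ℝ) + 1) < ‖x n‖}) ?_).trans
      ((gaussianSeq_real_exists_lt hk).trans ?_)
    · intro x hx
      simp only [hB, Set.mem_ofPred_eq] at hx ⊢
      by_contra! hcon
      exact hx ⟨(k : ℝ) + 1, by positivity, hcon⟩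
    · gcongr
      nlinarith
  have h2 : Filter.Tendsto (fun k : ℕ => 2 * Real.exp (-((k : ℝ) + 1))) Filter.atTop (nhds (2 * 0)) :=
    ((Real.tendsto_exp_neg_atTop_nhds_zero.comp
      (Filter.tendsto_atTop_add_const_right _ 1 tendsto_natCast_atTop_atTop))).const_mul 2
  rw [mul_zero] at h2
  have h3 : gaussianSeq.real B ≤ 0 := ge_of_tendsto' h2 h1
  exact (measureReal_eq_zero_iff).1 (h3.antisymm measureReal_nonneg)

/-- This ensures that the limit function is not identically zero, as Hurwitz's theorem requires. -/
theorem ae_head_ne_zero : ∀ᵐ x ∂gaussianSeq, x 0 ≠ 0 := by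
  have h1 : MeasurePreserving (fun x : ℕ → ℂ => x 0) gaussianSeq stdComplexGaussian :=
    measurePreserving_eval_infinitePi (fun _ : ℕ => stdComplexGaussian) 0
  have h2 : ∀ᵐ z ∂stdComplexGaussian, z ≠ 0 :=
    stdComplexGaussian_absolutelyContinuous.ae_le (Measure.ae_ne volume 0)
  exact h1.quasiMeasurePreserving.ae h2

theorem hyperbolicGAF_one (x : ℕ → ℂ) : hyperbolicGAF 1 x = fun z => ∑' n, x n * z ^ n := by
  funext z
  simp [hyperbolicGAF, hyperbolicCoeff_one]

theorem differentiable_reverseEval {N : ℕ} (c : Fin N → ℂ) : Differentiable ℂ (reverseEval c) := by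
  unfold reverseEval
  fun_prop

/-- The rescaled ratio of the orthogonal polynomial and its reversal. -/
noncomputable def szegoRatio (x : ℕ → ℂ) (N : ℕ) (z : ℂ) : ℂ :=
  ((Real.sqrt N : ℂ) / reverseEval (szegoCoeffs N x) z) * monicEval (szegoCoeffs N x) z

theorem szegoRatio_eq (x : ℕ → ℂ) (N : ℕ) {z : ℂ} (hz : ‖z‖ ≤ 1) :
    szegoRatio x N z = (Real.sqrt N : ℂ) * schurIterate N x z := by
  obtain ⟨h1, h2⟩ := monicEval_szegoCoeffs N x hz
  rw [szegoRatio, h2]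
  field_simp

theorem differentiableOn_szegoRatio (x : ℕ → ℂ) (N : ℕ) {R : ℝ} (hR : R ≤ 1) :
    DifferentiableOn ℂ (szegoRatio x N) (Metric.ball 0 R) := by
  refine DifferentiableOn.mul (DifferentiableOn.div (differentiableOn_const _)
    (differentiable_reverseEval _).differentiableOn fun z hz => ?_) (differentiable_monicEval _).differentiableOn
  exact (monicEval_szegoCoeffs N x ((mem_ball_zero_iff.1 hz).le.trans hR)).1

theorem zeroCount_szegoRatio (x : ℕ → ℂ) {N : ℕ} (hN : 0 < N) {r : ℝ} (hr : r ≤ 1) :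
    zeroCount (szegoRatio x N) r = zeroCount (monicEval (szegoCoeffs N x)) r := by
  have h0 : ∀ z ∈ Metric.ball (0 : ℂ) r, reverseEval (szegoCoeffs N x) z ≠ 0 := fun z hz =>
    (monicEval_szegoCoeffs N x ((mem_ball_zero_iff.1 hz).le.trans hr)).1
  refine zeroCount_mul_of_ne_zero ((differentiableOn_const _).div
    (differentiable_reverseEval _).differentiableOn h0) (differentiable_monicEval _).differentiableOn
    fun z hz => div_ne_zero ?_ (h0 z hz)
  exact_mod_cast (Real.sqrt_pos.2 (by exact_mod_cast hN)).ne'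

theorem differentiableOn_hyperbolicGAF {L T R : ℝ} (hL : 0 < L) (hR0 : 0 < R) (hR1 : R < 1) {x : ℕ → ℂ}
    (hx : ∀ n, ‖x n‖ ≤ T * ((n : ℝ) + 1)) : DifferentiableOn ℂ (hyperbolicGAF L x) (Metric.ball 0 R) :=
  differentiableOn_powerSeries (summable_hyperbolicGAF hL hR0 hR1 hx)

theorem tendstoUniformlyOn_szegoRatio {ρ : ℝ} (hρ0 : 0 < ρ) (hρ1 : ρ < 1) {T : ℝ} (hT : 0 ≤ T) {x : ℕ → ℂ}
    (hx : ∀ n, ‖x n‖ ≤ T * ((n : ℝ) + 1)) :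
    TendstoUniformlyOn (szegoRatio x) (hyperbolicGAF 1 x) Filter.atTop (Metric.closedBall 0 ρ) := by
  rw [hyperbolicGAF_one]
  refine (tendstoUniformlyOn_schurIterate hρ0 hρ1 hT hx).congr (Filter.Eventually.of_forall fun N z hz => ?_)
  exact (szegoRatio_eq x N ((mem_closedBall_zero_iff.1 hz).trans hρ1.le)).symm

theorem hyperbolicGAF_zero (L : ℝ) (x : ℕ → ℂ) : hyperbolicGAF L x 0 = x 0 := by
  rw [hyperbolicGAF, tsum_eq_single 0]
  · simp [hyperbolicCoeff_zero]
  · intro n hn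
    simp [hn]

theorem eventually_le_zeroCount_szegoCoeffs {r : ℝ} (hr0 : 0 < r) (hr1 : r < 1) {T : ℝ} (hT : 0 ≤ T)
    {x : ℕ → ℂ} (hx : ∀ n, ‖x n‖ ≤ T * ((n : ℝ) + 1)) (hx0 : x 0 ≠ 0) {m : ℕ}
    (hm : (m : ℕ∞) ≤ zeroCount (hyperbolicGAF 1 x) r) :
    ∀ᶠ N in Filter.atTop, (m : ℕ∞) ≤ zeroCount (monicEval (szegoCoeffs N x)) r := by
  have h := eventually_le_zeroCount (R := (1 + r) / 2) hr0 (by linarith)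
    (Filter.Eventually.of_forall fun N => differentiableOn_szegoRatio x N (by linarith))
    (differentiableOn_hyperbolicGAF one_pos (by linarith) (by linarith) hx)
    (tendstoUniformlyOn_szegoRatio hr0 hr1 hT hx)
    ⟨0, Metric.mem_ball_self (by linarith), by rwa [hyperbolicGAF_zero]⟩ hm
  filter_upwards [h, Filter.eventually_gt_atTop 0] with N hN hN0
  rwa [zeroCount_szegoRatio x hN0 hr1.le] at hN

theorem le_zeroCount_hyperbolicGAF_of_frequently {s r : ℝ} (hs : 0 < s) (hsr : s < r) (hr1 : r < 1) {T : ℝ}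
    (hT : 0 ≤ T) {x : ℕ → ℂ} (hx : ∀ n, ‖x n‖ ≤ T * ((n : ℝ) + 1)) (hx0 : x 0 ≠ 0) {m : ℕ}
    (hm : ∃ᶠ N in Filter.atTop, (m : ℕ∞) ≤ zeroCount (monicEval (szegoCoeffs N x)) s) :
    (m : ℕ∞) ≤ zeroCount (hyperbolicGAF 1 x) r := by
  have hr0 : 0 < r := hs.trans hsr
  refine le_zeroCount_of_frequently (R := (1 + r) / 2) hs.le hsr (by linarith)
    (Filter.Eventually.of_forall fun N => differentiableOn_szegoRatio x N (by linarith))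
    (differentiableOn_hyperbolicGAF one_pos (by linarith) (by linarith) hx)
    (tendstoUniformlyOn_szegoRatio hr0 hr1 hT hx)
    ⟨0, Metric.mem_ball_self (by linarith), by rwa [hyperbolicGAF_zero]⟩ ?_
  refine (hm.and_eventually (Filter.eventually_gt_atTop 0)).mono fun N hN => ?_
  rw [zeroCount_szegoRatio x hN.2 (hsr.trans hr1).le]
  exact hN.1

theorem gaussianSeq_le_zeroCount_szegoCoeffs {r : ℝ} (hr0 : 0 < r) (N m : ℕ) :
    MeasurableSet {x | (m : ℕ∞) ≤ zeroCount (monicEval (szegoCoeffs N x)) r} ∧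
    gaussianSeq {x | (m : ℕ∞) ≤ zeroCount (monicEval (szegoCoeffs N x)) r}
      = stableLaw N {c | (m : ℕ∞) ≤ zeroCount (monicEval c) r} := by
  have h := (isOpen_le_zeroCount_monicEval (N := N) hr0 m).measurableSet
  refine ⟨measurable_szegoCoeffs N h, ?_⟩
  rw [← map_szegoCoeffs, Measure.map_apply (measurable_szegoCoeffs N) h]
  rfl

theorem overcrowdingProb_one_le {Ω : Type*} [MeasurableSpace Ω] {P : Measure Ω} [IsProbabilityMeasure P]
    {a : ℕ → Ω → ℂ} (h : IsIIDStdComplexGaussian P a) {r : ℝ} (hr0 : 0 < r) (hr1 : r < 1) (m : ℕ) :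
    overcrowdingProb P a 1 r m ≤ Real.exp (2 / (1 - r ^ 2)) * r ^ (m * (m + 1)) := by
  refine (overcrowdingProb_le h (A := {x | ∀ᶠ N in Filter.atTop,
    x ∈ {x | (m : ℕ∞) ≤ zeroCount (monicEval (szegoCoeffs N x)) r}}) ?_).trans ?_
  · filter_upwards [ae_exists_growth, ae_head_ne_zero] with x hx hx0 hm
    obtain ⟨T, hT, hx⟩ := hx
    exact eventually_le_zeroCount_szegoCoeffs hr0 hr1 hT hx hx0 hm
  · refine ENNReal.toReal_le_of_le_ofReal (by positivity) (measure_setOf_eventually_le ?_)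
    filter_upwards [Filter.eventually_ge_atTop m] with N hN
    rw [(gaussianSeq_le_zeroCount_szegoCoeffs hr0 N m).2]
    exact stableLaw_le_zeroCount_le hr0 hr1 hN

theorem pow_le_overcrowdingProb_of_lt {Ω : Type*} [MeasurableSpace Ω] {P : Measure Ω} [IsProbabilityMeasure P]
    {a : ℕ → Ω → ℂ} (h : IsIIDStdComplexGaussian P a) {s r : ℝ} (hs : 0 < s) (hsr : s < r) (hr1 : r < 1)
    (m : ℕ) : s ^ (m * (m + 1)) ≤ overcrowdingProb P a 1 r m := by
  refine le_trans ?_ (le_overcrowdingProb h (A := {x | ∃ᶠ N in Filter.atTop,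
    x ∈ {x | (m : ℕ∞) ≤ zeroCount (monicEval (szegoCoeffs N x)) s}})
    (measurableSet_setOf_frequently fun N => (gaussianSeq_le_zeroCount_szegoCoeffs hs N m).1) ?_)
  · rw [Measure.real, ← ENNReal.ofReal_le_iff_le_toReal (measure_ne_top _ _)]
    refine le_measure_setOf_frequently (fun N => (gaussianSeq_le_zeroCount_szegoCoeffs hs N m).1) ?_
    filter_upwards [Filter.eventually_ge_atTop m] with N hN
    rw [(gaussianSeq_le_zeroCount_szegoCoeffs hs N m).2]
    exact le_stableLaw_le_zeroCount hs (hsr.trans hr1) hN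
  · filter_upwards [ae_exists_growth, ae_head_ne_zero] with x hx hx0 hm
    obtain ⟨T, hT, hx⟩ := hx
    exact le_zeroCount_hyperbolicGAF_of_frequently hs hsr hr1 hT hx hx0 hm

/-- The smaller radius lost in passing to the limit of the polynomials is recovered by letting `s`
increase to `r`. -/
theorem pow_le_overcrowdingProb {Ω : Type*} [MeasurableSpace Ω] {P : Measure Ω} [IsProbabilityMeasure P]
    {a : ℕ → Ω → ℂ} (h : IsIIDStdComplexGaussian P a) {r : ℝ} (hr0 : 0 < r) (hr1 : r < 1) (m : ℕ) :
    r ^ (m * (m + 1)) ≤ overcrowdingProb P a 1 r m := by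
  have h1 : Filter.Tendsto (fun s : ℝ => s ^ (m * (m + 1))) (nhdsWithin r (Set.Iio r))
      (nhds (r ^ (m * (m + 1)))) :=
    ((continuous_pow _).tendsto r).mono_left nhdsWithin_le_nhds
  refine le_of_tendsto h1 ?_
  filter_upwards [Ioo_mem_nhdsLT hr0] with s hs
  exact pow_le_overcrowdingProb_of_lt h hs.1 hs.2 hr1 m

/-! ### The overcrowding estimates -/

/-- With `t = √m` and `log m ≤ 2 t`, the left side is at most `2 K t³`. This is below `δ t⁴` once `t
≥ 2 K / δ` and is bounded before. -/
theorem exists_mul_log_le {K δ : ℝ} (hK : 0 ≤ K) (hδ : 0 < δ) :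
    ∃ B : ℝ, 0 ≤ B ∧ ∀ m : ℕ, 1 ≤ m → K * (m * Real.log m) ≤ δ * (m : ℝ) ^ 2 + B := by
  refine ⟨2 * K * (2 * K / δ) ^ 3, by positivity, fun m hm => ?_⟩
  set t := Real.sqrt m with ht
  have ht0 : 0 < t := Real.sqrt_pos.2 (by exact_mod_cast hm)
  have hm2 : (m : ℝ) = t ^ 2 := (Real.sq_sqrt (Nat.cast_nonneg m)).symm
  have hlog : Real.log m ≤ 2 * t := by
    rw [hm2, Real.log_pow]
    have := Real.log_le_sub_one_of_pos ht0
    push_cast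
    linarith
  have h1 : K * (m * Real.log m) ≤ 2 * K * t ^ 3 := by
    calc K * (m * Real.log m) ≤ K * (m * (2 * t)) := by gcongr
      _ = _ := by rw [hm2]; ring
  refine h1.trans ?_
  rw [hm2]
  have hB : 0 ≤ 2 * K * (2 * K / δ) ^ 3 := by positivity
  rcases le_total t (2 * K / δ) with h | h
  · have : 2 * K * t ^ 3 ≤ 2 * K * (2 * K / δ) ^ 3 := by gcongr
    have : 0 ≤ δ * (t ^ 2) ^ 2 := by positivity
    linarith
  · rw [div_le_iff₀ hδ] at h
    have := mul_le_mul_of_nonneg_right h (pow_nonneg ht0.le 3)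
    nlinarith

theorem theorem8p2 (L r : ℝ) (hL : 0 < L) (hr0 : 0 < r) (hr1 : r < 1) :
    ∃ β C₁ C₂ C₃ K : ℝ, 0 < β ∧ 0 < C₁ ∧ 0 < C₂ ∧ 0 < C₃ ∧
      ∀ (Ω : Type*) [MeasurableSpace Ω] (P : Measure Ω) [IsProbabilityMeasure P]
        (a : ℕ → Ω → ℂ), IsIIDStdComplexGaussian P a →
        ∀ m : ℕ, 1 ≤ m →
          -- the two-sided bound for general `L`
          C₁ * Real.exp (-((m : ℝ) ^ 2 * |Real.log r| + K * (m * Real.log m)))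
              ≤ overcrowdingProb P a L r m ∧
          overcrowdingProb P a L r m ≤ C₂ * Real.exp (-(β * (m : ℝ) ^ 2)) ∧
          -- the lower bound with `1 / |log r|`, in the range `1 / e < r < 1`
          (|Real.log r| < 1 →
            C₁ * Real.exp (-((m : ℝ) ^ 2 / |Real.log r|)) ≤ overcrowdingProb P a L r m) ∧
          -- the matching bounds for `L = 1`
          (L = 1 →
            r ^ (m * (m + 1)) ≤ overcrowdingProb P a L r m ∧
            overcrowdingProb P a L r m
              ≤ r ^ (m * (m + 1)) * (1 + C₃ * Real.exp (m * Real.log m))) := by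
  obtain ⟨C, K, hC, hK, hlower⟩ := exists_overcrowding_lower hL hr0 hr1
  obtain ⟨β, C₂, hβ, hC₂, hupper⟩ := exists_overcrowding_upper hL hr0 hr1
  have hl0 : 0 < |Real.log r| := abs_pos.2 (Real.log_neg hr0 hr1).ne
  obtain ⟨B, hB0, hB⟩ : ∃ B : ℝ, 0 ≤ B ∧ (|Real.log r| < 1 → ∀ m : ℕ, 1 ≤ m →
      (m : ℝ) ^ 2 * |Real.log r| + K * (m * Real.log m) ≤ (m : ℝ) ^ 2 / |Real.log r| + B) := by
    by_cases hl : |Real.log r| < 1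
    · have hδ : 0 < 1 / |Real.log r| - |Real.log r| := by
        have : 1 < 1 / |Real.log r| := by rwa [lt_div_iff₀ hl0, one_mul]
        linarith
      obtain ⟨B, hB0, hB⟩ := exists_mul_log_le hK hδ
      refine ⟨B, hB0, fun _ m hm => ?_⟩
      have := hB m hm
      rw [div_eq_mul_one_div]
      linarith
    · exact ⟨0, le_rfl, fun h => absurd h hl⟩
  -- The factor `exp (-B)` pays for absorbing `m log m` in the bound with `1 / |log r|`; it only
  -- weakens the other lower bound.
  refine ⟨β, C * Real.exp (-B), C₂, Real.exp (2 / (1 - r ^ 2)), K, hβ, by positivity, hC₂, Real.exp_pos _, ?_⟩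
  intro Ω _ P _ a ha m hm
  have hlow : C * Real.exp (-((m : ℝ) ^ 2 * |Real.log r| + K * (m * Real.log m)))
      ≤ overcrowdingProb P a L r m := by
    obtain ⟨A, hAm, hA, hCA⟩ := hlower m hm
    exact hCA.trans (le_overcrowdingProb ha hAm (Filter.Eventually.of_forall hA))
  refine ⟨?_, ?_, fun hl => ?_, ?_⟩
  · refine le_trans ?_ hlow
    gcongr
    exact mul_le_of_le_one_right hC.le (Real.exp_le_one_iff.2 (by linarith))
  · exact (overcrowdingProb_le ha (A := {x | (m : ℕ∞) ≤ zeroCount (hyperbolicGAF L x) r})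
      (Filter.Eventually.of_forall fun _ hx => hx)).trans (hupper m hm)
  · refine le_trans ?_ hlow
    rw [mul_assoc, ← Real.exp_add]
    gcongr
    linarith [hB hl m hm]
  · rintro rfl
    refine ⟨pow_le_overcrowdingProb ha hr0 hr1 m, (overcrowdingProb_one_le ha hr0 hr1 m).trans ?_⟩
    rw [mul_comm]
    gcongr
    have h1 : 1 ≤ Real.exp (m * Real.log m) := Real.one_le_exp
      (mul_nonneg (Nat.cast_nonneg m) (Real.log_nonneg (by exact_mod_cast hm)))
    nlinarith [Real.exp_pos (2 / (1 - r ^ 2))]
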